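/- **Setting.** Let $G$ be a Lie group of dimension $n$ which is a closed embedded submanifold of a Euclidean space, let $\mathfrak g=T_eG$ be its Lie algebra (a linear subspace of the ambient Euclidean space), let $\mathbb I$ be an inner product on $\mathfrak g$, let $R$ be an endomorphism of $\mathfrak g$ that is symmetric and positive semidefinite with respect to $\mathbb I$, and let $\psi\colon G\to\mathbb R$ be smooth. Let $L_g$ be the left translation by $g$, let $\nabla$ be the Levi-Civita connection of the left-invariant Riemannian metric on $G$ induced by $\mathbb I$, and let $\overset{\mathfrak g}{\nabla}$ be its restriction to $\mathfrak g$, i.e. $T_eL_g(\overset{\mathfrak g}{\nabla}_vw)=(\nabla_{v^{\rm L}}w^{\rm L})(g)$ for the left-invariant vector fields $v^{\rm L},w^{\rm L}$ generated by $v,w\in\mathfrak g$. Let $\operatorname{grad}\psi$ be the gradient of $\psi$ with respect to this metric. Let $T>0$, and let $\boldsymbol u\colon\mathbb R\to\mathbb R^n$ be measurable, bounded, $T$-periodic and zero-mean, such that the components of its zero-mean antiderivative $\boldsymbol U$ satisfy $\frac1T\int_0^TU^i(\tau)U^j(\tau)\,d\tau=\delta_{ij}$. Let $\alpha\colon\mathbb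 R\to\mathbb R$ be smooth such that $\alpha\alpha'$ is strictly increasing and positive. Let $a,\lambda,b,\kappa,h>0$ with $a\lambda-b\kappa>0$. Let $(e_1,\dots,e_n)$ be an $\mathbb I$-orthonormal basis of $\mathfrak g$, let $\mu=\sum_i\overset{\mathfrak g}{\nabla}_{e_i}e_i$, and for $\boldsymbol w\in\mathbb R^n$ write $w=\sum_iw^ie_i\in\mathfrak g$ (in the same way $u$, $U$ for $\boldsymbol u$, $\boldsymbol U$). For $\omega>0$ consider on $M=G\times\mathfrak g\times\mathbb R^n\times\mathbb R$ the closed-loop system $$\begin{aligned}\dot g&=T_eL_g(v),\\ \dot v+\overset{\mathfrak g}{\nabla}_vv&=-Rv-b\,(w-\kappa\,\alpha(\psi(g)-\eta)\,U(\omega t))+\lambda\,\alpha(\psi(g)-\eta)\,\omega\,u(\omega t)+\lambda^2\alpha^2(\psi(g)-\eta)\,\mu,\\ \dot{\boldsymbol w}&=-a\,(\boldsymbol w-\kappa\,\alpha(\psi(g)-\eta)\,\boldsymbol U(\omega t))+\kappa\,\alpha(\psi(g)-\eta)\,\omega\,\boldsymbol u(\omega t),\\ \dot\eta&=-h\,\eta+h\,\psi(g)\end{aligned}$$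 (solutions in the sense of Carathéodory) and the change of variables $$\phi^\omega_t(g,v,\boldsymbol w,\eta)=\big(g,\ v-\lambda\,\alpha(\psi(g)-\eta)\,U(\omega t),\ \boldsymbol w-\kappa\,\alpha(\psi(g)-\eta)\,\boldsymbol U(\omega t),\ \eta\big).$$ For a real-valued function $f$ on a manifold $X$, $x\in X$ and $y>f(x)$, let $f^{-1}(\le y,x)$ be the connected component containing $x$ of $\{f\le y\}$. **Theorem.** Assume that $\overset{\mathfrak g}{\nabla}_vv=0$ for every $v\in\mathfrak g$. Let $g_*\in G$ and $y_0>\psi(g_*)$ be such that $\psi^{-1}(\le y_0,g_*)$ is compact and $\operatorname{grad}\psi(g)\ne0$ for every $g\in\psi^{-1}(\le y_0,g_*)$ with $g\ne g_*$. Put $$\Xi=b\kappa\big((a\lambda-b\kappa)I+\lambda R\big)^{-1},\quad \|v\|_\Xi^2=\mathbb I(\Xi v,v),\quad \|v\|^2=\mathbb I(v,v),\quad \beta(z)=\int_0^z\big((\alpha\alpha')(\tilde z)-(\alpha\alpha')(0)\big)\,d\tilde z,$$ $$V(g,v,\boldsymbol w,\eta)=\tfrac12\|v\|^2+\tfrac12\big\|v-\tfrac\lambda\kappa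 w\big\|_\Xi^2+\lambda^2(\alpha\alpha')(0)\,(\psi(g)-\psi(g_*))+\lambda^2\beta(\psi(g)-\eta),$$ $x_*=(g_*,0,\boldsymbol 0,\psi(g_*))$, $V_0=\lambda^2(\alpha\alpha')(0)(y_0-\psi(g_*))$ and $S=V^{-1}(\le V_0,x_*)$. Then, for every $\omega>0$, every initial value problem for the closed-loop system has a unique maximal solution, and $x_*$ is $S$-practically uniformly asymptotically stable for the closed-loop system in the variables $\tilde x=\phi^\omega_t(x)$. That is, $S$ is a neighborhood of $x_*$ in $M$ and, with $|\cdot|$ the Euclidean norm of the ambient space of $M$: 1. for every $\varepsilon>0$ there are $\omega_0,\delta>0$ such that, for all $\omega\ge\omega_0$, $t_0\in\mathbb R$ and $\tilde x_0\in M$ with $|\tilde x_0-x_*|\le\delta$, the maximal solution $x$ with $x(t_0)=(\phi^\omega_{t_0})^{-1}(\tilde x_0)$ exists and satisfies $|\phi^\omega_t(x(t))-x_*|\le\varepsilon$ for all $t\ge t_0$; 2. for all $r,\varepsilon>0$ there are $\omega_0,\Delta,\rho>0$ such that, for all $\omega\ge\omega_0$, $t_0\in\mathbb R$ and $\tilde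 x_0\in S$ with $|\tilde x_0-x_*|\le r$, the maximal solution $x$ with $x(t_0)=(\phi^\omega_{t_0})^{-1}(\tilde x_0)$ exists for all $t\ge t_0$ and satisfies $|\phi^\omega_t(x(t))-x_*|\le\rho$ for all $t\ge t_0$ and $|\phi^\omega_t(x(t))-x_*|\le\varepsilon$ for all $t\ge t_0+\Delta$. -/

import Mathlib

open Set Filter Topology MeasureTheory Manifold ContDiff

noncomputable section

namespace ExtremumSeeking

/-! ### Practical stability -/

section PracticalStability

variable {M 𝔼 : Type*} [NormedAddCommGroup 𝔼] [NormedSpace ℝ 𝔼]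

/-- Solutions of `ẋ = f(t, x)` in the sense of Carathéodory.  The state space `M` sits in the
Euclidean space `𝔼` through `Φ`, and `f t x` is the (tangent) velocity vector at `Φ x`, as a vector
of `𝔼`.  The integral equation says that `Φ ∘ x` is locally absolutely continuous on `J` with
derivative `f(t, x(t))` for almost every `t`. -/
structure IsSolutionOn (Φ : M → 𝔼) (f : ℝ → M → 𝔼) (J : Set ℝ) (x : ℝ → M) : Prop where
  integrable : ∀ s ∈ J, ∀ t ∈ J, IntervalIntegrable (fun τ => f τ (x τ)) volume s t
  integral_eq : ∀ s ∈ J, ∀ t ∈ J, Φ (x t) - Φ (x s) = ∫ τ in s..t, f τ (x τ)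

/-- `x`, considered on the interval `J`, is a maximal solution of `ẋ = f(t, x)`, `x(t₀) = x₀`.
The values of `x` outside `J` are irrelevant. -/
structure IsMaximalSolution (Φ : M → 𝔼) (f : ℝ → M → 𝔼) (t₀ : ℝ) (x₀ : M)
    (J : Set ℝ) (x : ℝ → M) : Prop where
  ordConnected : J.OrdConnected
  mem : t₀ ∈ J
  initial : x t₀ = x₀
  solution : IsSolutionOn Φ f J x
  maximal : ∀ (J' : Set ℝ) (x' : ℝ → M), J'.OrdConnected → J ⊆ J' → EqOn x' x J →
    IsSolutionOn Φ f J' x' → J' = J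

/-- Every initial value problem for `ẋ = f(t, x)` has a unique maximal solution. -/
def HasUniqueMaximalSolutions (Φ : M → 𝔼) (f : ℝ → M → 𝔼) : Prop :=
  ∀ (t₀ : ℝ) (x₀ : M), (∃ J x, IsMaximalSolution Φ f t₀ x₀ J x) ∧
    ∀ J x J' x', IsMaximalSolution Φ f t₀ x₀ J x → IsMaximalSolution Φ f t₀ x₀ J' x' →
      J = J' ∧ EqOn x x' J

/-- `xs` is practically uniformly stable for `ẋ = f^ω(t, x)` in the variables `x̃ = φ^ω_t(x)`. -/
def IsPracticallyUniformlyStable (Φ : M → 𝔼) (f : ℝ → ℝ → M → 𝔼) (φ : ℝ → ℝ → M ≃ M)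
    (xs : M) : Prop :=
  ∀ ε > 0, ∃ om₀ > 0, ∃ δ > 0, ∀ om ≥ om₀, ∀ (t₀ : ℝ) (x₀ : M), ‖Φ x₀ - Φ xs‖ ≤ δ →
    ∀ (J : Set ℝ) (x : ℝ → M), IsMaximalSolution Φ (f om) t₀ ((φ om t₀).symm x₀) J x →
      ∀ t ≥ t₀, t ∈ J ∧ ‖Φ (φ om t (x t)) - Φ xs‖ ≤ ε

/-- `xs` is `S`-practically uniformly attractive for `ẋ = f^ω(t, x)` in the variables
`x̃ = φ^ω_t(x)`. -/
def IsPracticallyUniformlyAttractive (Φ : M → 𝔼) (f : ℝ → ℝ → M → 𝔼) (φ : ℝ → ℝ → M ≃ M)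
    (S : Set M) (xs : M) : Prop :=
  ∀ r > 0, ∀ ε > 0, ∃ om₀ > 0, ∃ Δ > 0, ∃ ρ > 0, ∀ om ≥ om₀, ∀ (t₀ : ℝ), ∀ x₀ ∈ S,
    ‖Φ x₀ - Φ xs‖ ≤ r →
    ∀ (J : Set ℝ) (x : ℝ → M), IsMaximalSolution Φ (f om) t₀ ((φ om t₀).symm x₀) J x →
      (∀ t ≥ t₀, t ∈ J ∧ ‖Φ (φ om t (x t)) - Φ xs‖ ≤ ρ) ∧
      (∀ t ≥ t₀ + Δ, ‖Φ (φ om t (x t)) - Φ xs‖ ≤ ε)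

/-- `S` is a neighborhood of `xs`, and `xs` is `S`-practically uniformly asymptotically stable for
`ẋ = f^ω(t, x)` in the variables `x̃ = φ^ω_t(x)`. -/
structure IsPracticallyUniformlyAsymptoticallyStable [TopologicalSpace M] (Φ : M → 𝔼)
    (f : ℝ → ℝ → M → 𝔼) (φ : ℝ → ℝ → M ≃ M) (S : Set M) (xs : M) : Prop where
  nhds : S ∈ 𝓝 xs
  stable : IsPracticallyUniformlyStable Φ f φ xs
  attractive : IsPracticallyUniformlyAttractive Φ f φ S xs

end PracticalStability

/-- The connected component, containing `x`, of the `y`-sublevel set of `f`. -/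
def sublevelComponent {X : Type*} [TopologicalSpace X] (f : X → ℝ) (y : ℝ) (x : X) : Set X :=
  connectedComponentIn {z | f z ≤ y} x

/-! ### The mechanical system -/

section System

variable (n N : ℕ) (G : Type*) [TopologicalSpace G] [ChartedSpace (EuclideanSpace ℝ (Fin n)) G]
  [Group G]

/-- The Lie algebra: the tangent space to `G` at the identity. -/
abbrev LieAlg : Type _ := GroupLieAlgebra (𝓡 n) G

instance : FiniteDimensional ℝ (LieAlg n G) :=
  inferInstanceAs (FiniteDimensional ℝ (EuclideanSpace ℝ (Fin n)))

instance [LieGroup (𝓡 n) ∞ G] : LieGroup (𝓡 n) (minSmoothness ℝ 3) G :=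
  LieGroup.of_le (n := ∞) (by
    rw [minSmoothness_of_isRCLikeNormedField]
    exact WithTop.coe_le_coe.2 (le_top : (3 : ℕ∞) ≤ ⊤))

/-- The mechanical system: a Lie group `G`, realized by `ι` as a closed embedded submanifold of the
Euclidean space of dimension `N`, an inner product `inner` on the Lie algebra, a dissipation
endomorphism `R`, which is symmetric and positive semidefinite, and a smooth objective function
`ψ`. -/
structure MechanicalSystem where
  ι : G → EuclideanSpace ℝ (Fin N)
  ι_embedding : IsSmoothEmbedding (𝓡 n) 𝓘(ℝ, EuclideanSpace ℝ (Fin N)) ∞ ι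
  ι_closed : IsClosed (range ι)
  inner : LinearMap.BilinForm ℝ (LieAlg n G)
  inner_symm : ∀ v w, inner v w = inner w v
  inner_pos : ∀ v, v ≠ 0 → 0 < inner v v
  R : Module.End ℝ (LieAlg n G)
  R_symm : ∀ v w, inner (R v) w = inner v (R w)
  R_nonneg : ∀ v, 0 ≤ inner (R v) v
  ψ : G → ℝ
  ψ_smooth : ContMDiff (𝓡 n) 𝓘(ℝ, ℝ) ∞ ψ

namespace MechanicalSystem

variable {n N G}
variable (S : MechanicalSystem n N G)

theorem inner_nondegenerate : S.inner.Nondegenerate := by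
  refine ⟨fun v hv => ?_, fun v hv => ?_⟩ <;>
  · by_contra h
    exact (S.inner_pos v h).ne' (hv v)

/-- The tangent map of the inclusion of `G` into Euclidean space, at `g`. -/
def dι (g : G) : TangentSpace (𝓡 n) g →L[ℝ] EuclideanSpace ℝ (Fin N) :=
  mvfderiv (𝓡 n) S.ι g

/-- The tangent map `T_eL_g` of the left translation by `g`, at the identity. -/
def tangentLeft (g : G) : LieAlg n G →L[ℝ] TangentSpace (𝓡 n) g :=
  mfderiv (𝓡 n) (𝓡 n) (fun k : G => g * k) (1 : G)

/-- The inverse `(T_eL_g)⁻¹` of the linear isomorphism `T_eL_g`. -/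
def tangentLeftInv (g : G) : TangentSpace (𝓡 n) g →L[ℝ] LieAlg n G :=
  (tangentLeft g).inverse

/-- The left-invariant Riemannian metric on `G` induced by the inner product on the Lie algebra. -/
def metric (g : G) (X Y : TangentSpace (𝓡 n) g) : ℝ :=
  S.inner (tangentLeftInv g X) (tangentLeftInv g Y)

/-- The gradient of `ψ` with respect to the left-invariant metric, at `g`; see `metric_grad`. -/
def grad (g : G) : TangentSpace (𝓡 n) g :=
  tangentLeft g ((S.inner.toDual S.inner_nondegenerate).symm
    (((mvfderiv (𝓡 n) S.ψ g).comp (tangentLeft g) : LieAlg n G →L[ℝ] ℝ) : LieAlg n G →ₗ[ℝ] ℝ))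

/-- The restriction of the Levi-Civita connection to the Lie algebra, by the Koszul formula
`2 𝕀(∇_v w, z) = 𝕀([v, w], z) - 𝕀([w, z], v) - 𝕀([v, z], w)` on left-invariant vector fields; see
`IsLeviCivita.apply_leftInvariant`. -/
def nabla [LieGroup (𝓡 n) ∞ G] (v w : LieAlg n G) : LieAlg n G :=
  (S.inner.toDual S.inner_nondegenerate).symm
    ((1 / 2 : ℝ) • (S.inner ⁅v, w⁆
      - S.inner v ∘ₗ (LieAlgebra.ad ℝ (LieAlg n G) w : Module.End ℝ (LieAlg n G))
      - S.inner w ∘ₗ (LieAlgebra.ad ℝ (LieAlg n G) v : Module.End ℝ (LieAlg n G))))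

/-- A connection on `G` is the Levi-Civita connection of the left-invariant metric if it is
torsion-free and compatible with the metric.  Note that `cov Y g (X g)` stands for `(∇_X Y)(g)`. -/
structure IsLeviCivita [LieGroup (𝓡 n) ∞ G]
    (cov : CovariantDerivative (𝓡 n) (EuclideanSpace ℝ (Fin n))
      (fun g : G => TangentSpace (𝓡 n) g)) : Prop where
  torsion_free : ∀ (X Y : Π g : G, TangentSpace (𝓡 n) g),
    ContMDiff (𝓡 n) (𝓡 n).tangent 1 (fun g => (⟨g, X g⟩ : TangentBundle (𝓡 n) G)) →
    ContMDiff (𝓡 n) (𝓡 n).tangent 1 (fun g => (⟨g, Y g⟩ : TangentBundle (𝓡 n) G)) →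
    ∀ g, cov Y g (X g) - cov X g (Y g) = VectorField.mlieBracket (𝓡 n) X Y g
  metric_compatible : ∀ (X Y : Π g : G, TangentSpace (𝓡 n) g),
    ContMDiff (𝓡 n) (𝓡 n).tangent 1 (fun g => (⟨g, X g⟩ : TangentBundle (𝓡 n) G)) →
    ContMDiff (𝓡 n) (𝓡 n).tangent 1 (fun g => (⟨g, Y g⟩ : TangentBundle (𝓡 n) G)) →
    ∀ (g : G) (Z : TangentSpace (𝓡 n) g),
      mvfderiv (𝓡 n) (fun k => S.metric k (X k) (Y k)) g Z
        = S.metric g (cov X g Z) (Y g) + S.metric g (X g) (cov Y g Z)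

theorem inner_nabla [LieGroup (𝓡 n) ∞ G] (v w z : LieAlg n G) :
    S.inner (S.nabla v w) z
      = (1 / 2) * (S.inner ⁅v, w⁆ z - S.inner v ⁅w, z⁆ - S.inner w ⁅v, z⁆) := by
  simp [nabla, LinearMap.BilinForm.apply_toDual_symm_apply]

theorem tangentLeft_apply (g : G) (v : LieAlg n G) :
    tangentLeft g v = mulInvariantVectorField v g := rfl

theorem tangentLeft_isInvertible [LieGroup (𝓡 n) ∞ G] (g : G) :
    (tangentLeft (n := n) g).IsInvertible := by
  have hd : ∀ a b : G, MDifferentiableAt (𝓡 n) (𝓡 n) (fun k : G => a * k) b := fun a b =>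
    (contMDiff_mul_left (I := 𝓡 n) (n := ∞)).contMDiffAt.mdifferentiableAt (by simp)
  refine ContinuousLinearMap.IsInvertible.of_inverse
    (g := mfderiv (𝓡 n) (𝓡 n) (fun k : G => g⁻¹ * k) (g * 1)) ?_ ?_
  · have A : mfderiv (𝓡 n) (𝓡 n) ((fun k : G => g * k) ∘ (fun k : G => g⁻¹ * k)) (g * 1)
        = ContinuousLinearMap.id _ _ := by
      have : (fun k : G => g * k) ∘ (fun k : G => g⁻¹ * k) = id := by ext; simp
      rw [this, mfderiv_id]
    rw [mfderiv_comp (I' := 𝓡 n) _ (hd _ _) (hd _ _), inv_mul_cancel_left g 1] at A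
    exact A
  · have A : mfderiv (𝓡 n) (𝓡 n) ((fun k : G => g⁻¹ * k) ∘ (fun k : G => g * k)) (1 : G)
        = ContinuousLinearMap.id _ _ := by
      have : (fun k : G => g⁻¹ * k) ∘ (fun k : G => g * k) = id := by ext; simp
      rw [this, mfderiv_id]
    rw [mfderiv_comp (I' := 𝓡 n) _ (hd _ _) (hd _ _)] at A
    exact A

theorem tangentLeftInv_tangentLeft [LieGroup (𝓡 n) ∞ G] (g : G) (v : LieAlg n G) :
    tangentLeftInv g (tangentLeft g v) = v := by
  obtain ⟨e, he⟩ := tangentLeft_isInvertible (n := n) g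
  simp [tangentLeftInv, ← he]

theorem tangentLeft_tangentLeftInv [LieGroup (𝓡 n) ∞ G] (g : G) (X : TangentSpace (𝓡 n) g) :
    tangentLeft g (tangentLeftInv g X) = X := by
  obtain ⟨e, he⟩ := tangentLeft_isInvertible (n := n) g
  simp [tangentLeftInv, ← he]

/-- `grad` is the gradient: `⟨grad ψ(g), Y⟩ = dψ_g(Y)` for every tangent vector `Y`. -/
theorem metric_grad [LieGroup (𝓡 n) ∞ G] (g : G) (Y : TangentSpace (𝓡 n) g) :
    S.metric g (S.grad g) Y = mvfderiv (𝓡 n) S.ψ g Y := by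
  rw [metric, grad, tangentLeftInv_tangentLeft, LinearMap.BilinForm.apply_toDual_symm_apply]
  simp [tangentLeft_tangentLeftInv]

/-- `nabla` is the restriction of the Levi-Civita connection to left-invariant vector fields:
`(∇_{v^L} w^L)(g) = T_eL_g(nabla v w)`. -/
theorem IsLeviCivita.apply_leftInvariant [LieGroup (𝓡 n) ∞ G]
    {cov : CovariantDerivative (𝓡 n) (EuclideanSpace ℝ (Fin n))
      (fun g : G => TangentSpace (𝓡 n) g)} (hcov : S.IsLeviCivita cov)
    (v w : LieAlg n G) (g : G) :
    cov (fun k => tangentLeft k w) g (tangentLeft g v) = tangentLeft g (S.nabla v w) := by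
  have hsm : ∀ v : LieAlg n G, ContMDiff (𝓡 n) (𝓡 n).tangent 1
      (fun g => (⟨g, tangentLeft g v⟩ : TangentBundle (𝓡 n) G)) := fun v =>
    (contMDiff_mulInvariantVectorField (I := 𝓡 n) v).of_le (by
      rw [minSmoothness_of_isRCLikeNormedField]; norm_num)
  -- `D v w` is the body representation of `(∇_{v^L} w^L)(g)`
  set D : LieAlg n G → LieAlg n G → LieAlg n G := fun v w =>
    tangentLeftInv g (cov (fun k => tangentLeft k w) g (tangentLeft g v)) with hD
  have htor : ∀ v w, D v w - D w v = ⁅v, w⁆ := by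
    intro v w
    have h := hcov.torsion_free _ _ (hsm v) (hsm w) g
    have h2 : VectorField.mlieBracket (𝓡 n) (fun k : G => tangentLeft k v)
        (fun k => tangentLeft k w) g = tangentLeft g ⁅v, w⁆ :=
      (congrFun (mulInvariantVector_mlieBracket (I := 𝓡 n) v w) g).symm
    rw [h2] at h
    have h3 := congrArg (tangentLeftInv g) h
    rwa [map_sub, tangentLeftInv_tangentLeft] at h3
  have hmet : ∀ u v w, S.inner (D u v) w + S.inner v (D u w) = 0 := by
    intro u v w
    have h := hcov.metric_compatible _ _ (hsm v) (hsm w) g (tangentLeft g u)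
    have h2 : (fun k : G => S.metric k (tangentLeft k v) (tangentLeft k w))
        = fun _ => S.inner v w := by
      funext k
      simp only [metric, tangentLeftInv_tangentLeft]
    rw [h2] at h
    have h4 : mvfderiv (𝓡 n) (fun _ : G => S.inner v w) g = 0 := by
      simp [mvfderiv, mfderiv_const]
    rw [h4] at h
    simp only [metric, tangentLeftInv_tangentLeft] at h
    exact h.symm
  have key : D v w = S.nabla v w := by
    apply (S.inner.toDual S.inner_nondegenerate).injective
    ext z
    simp only [LinearMap.BilinForm.toDual_def]
    rw [S.inner_nabla, ← htor v w, ← htor w z, ← htor v z]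
    simp only [map_sub, LinearMap.sub_apply]
    have e1 := hmet v w z
    have e2 := hmet w v z
    have e3 := hmet z v w
    rw [S.inner_symm (D z v) w] at e3
    linarith
  rw [← key, hD, tangentLeft_tangentLeftInv]

end MechanicalSystem

/-- The antiderivative of the `T`-periodic map `u` which has zero mean over a period. -/
def zeroMeanAntideriv {n : ℕ} (T : ℝ) (u : ℝ → EuclideanSpace ℝ (Fin n)) (t : ℝ) :
    EuclideanSpace ℝ (Fin n) :=
  (∫ s in (0 : ℝ)..t, u s) - (1 / T) • ∫ τ in (0 : ℝ)..T, ∫ s in (0 : ℝ)..τ, u s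

/-- The components of the control law: the perturbation signals `u` of period `T`, the design
function `α`, the gains `a`, `lam`, `b`, `κ`, `h`, and an orthonormal basis `e` of the Lie
algebra. -/
structure ControlLaw {n N : ℕ} {G : Type*} [TopologicalSpace G]
    [ChartedSpace (EuclideanSpace ℝ (Fin n)) G] [Group G] (S : MechanicalSystem n N G) where
  T : ℝ
  T_pos : 0 < T
  u : ℝ → EuclideanSpace ℝ (Fin n)
  u_measurable : Measurable u
  u_bounded : ∃ B : ℝ, ∀ t, ‖u t‖ ≤ B
  u_periodic : Function.Periodic u T
  u_zeroMean : ∫ t in (0 : ℝ)..T, u t = 0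
  u_orthonormal : ∀ i j : Fin n,
    (1 / T) * ∫ τ in (0 : ℝ)..T, zeroMeanAntideriv T u τ i * zeroMeanAntideriv T u τ j
      = if i = j then 1 else 0
  α : ℝ → ℝ
  α_smooth : ContDiff ℝ ∞ α
  α_mul_deriv_strictMono : StrictMono fun z => α z * deriv α z
  α_mul_deriv_pos : ∀ z, 0 < α z * deriv α z
  a : ℝ
  lam : ℝ
  b : ℝ
  κ : ℝ
  h : ℝ
  a_pos : 0 < a
  lam_pos : 0 < lam
  b_pos : 0 < b
  κ_pos : 0 < κ
  h_pos : 0 < h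
  gain_condition : 0 < a * lam - b * κ
  e : Module.Basis (Fin n) ℝ (LieAlg n G)
  e_orthonormal : ∀ i j, S.inner (e i) (e j) = if i = j then 1 else 0

/-- The state manifold `G × 𝔤 × ℝⁿ × ℝ`, with elements `(g, v, w, η)`. -/
abbrev State (n : ℕ) (G : Type*) [TopologicalSpace G] [ChartedSpace (EuclideanSpace ℝ (Fin n)) G]
    [Group G] : Type _ :=
  G × LieAlg n G × EuclideanSpace ℝ (Fin n) × ℝ

/-- The Euclidean space which contains the state manifold, with its Euclidean norm. -/
abbrev Ambient (n N : ℕ) : Type :=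
  WithLp 2 (EuclideanSpace ℝ (Fin N) ×
    WithLp 2 (EuclideanSpace ℝ (Fin N) × WithLp 2 (EuclideanSpace ℝ (Fin n) × ℝ)))

/-- The vector of the ambient Euclidean space with the given components. -/
def Ambient.mk {n N : ℕ} (p q : EuclideanSpace ℝ (Fin N)) (w : EuclideanSpace ℝ (Fin n)) (η : ℝ) :
    Ambient n N :=
  WithLp.toLp 2 (p, WithLp.toLp 2 (q, WithLp.toLp 2 (w, η)))

/-- The inclusion of the state manifold into Euclidean space. -/
def MechanicalSystem.stateEmbedding {n N : ℕ} {G : Type*} [TopologicalSpace G]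
    [ChartedSpace (EuclideanSpace ℝ (Fin n)) G] [Group G] (S : MechanicalSystem n N G)
    (x : State n G) : Ambient n N :=
  Ambient.mk (S.ι x.1) (S.dι 1 x.2.1) x.2.2.1 x.2.2.2

namespace ControlLaw

variable {n N G}
variable {S : MechanicalSystem n N G} (C : ControlLaw S)

/-- The zero-mean antiderivative of the perturbation signals. -/
def U (t : ℝ) : EuclideanSpace ℝ (Fin n) := zeroMeanAntideriv C.T C.u t

/-- The product `α α'`. -/
def αα' (z : ℝ) : ℝ := C.α z * deriv C.α z

/-- The isomorphism from `ℝⁿ` to the Lie algebra given by the orthonormal basis. -/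
def E (w : EuclideanSpace ℝ (Fin n)) : LieAlg n G := ∑ i, w i • C.e i

/-- The sum of the vectors `∇_{e_i} e_i`. -/
def μ [LieGroup (𝓡 n) ∞ G] : LieAlg n G := ∑ i, S.nabla (C.e i) (C.e i)

/-- The right-hand side of the closed-loop system with parameter `om`: the velocities `ġ` in the
tangent space `T_gG`, and `v̇`, `ẇ`, `η̇`. -/
def closedLoopField [LieGroup (𝓡 n) ∞ G] (om t : ℝ) :
    (x : State n G) →
      TangentSpace (𝓡 n) x.1 × LieAlg n G × EuclideanSpace ℝ (Fin n) × ℝ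
  | (g, v, w, η) =>
    (MechanicalSystem.tangentLeft g v,
      - S.nabla v v - S.R v
        - C.b • (C.E w - (C.κ * C.α (S.ψ g - η)) • C.E (C.U (om * t)))
        + (C.lam * C.α (S.ψ g - η) * om) • C.E (C.u (om * t))
        + (C.lam ^ 2 * C.α (S.ψ g - η) ^ 2) • C.μ,
      - C.a • (w - (C.κ * C.α (S.ψ g - η)) • C.U (om * t))
        + (C.κ * C.α (S.ψ g - η) * om) • C.u (om * t),
      - C.h * η + C.h * S.ψ g)

/-- The closed-loop vector field with values in the ambient Euclidean space. -/
def closedLoop [LieGroup (𝓡 n) ∞ G] (om t : ℝ) (x : State n G) : Ambient n N :=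
  Ambient.mk (S.dι x.1 (C.closedLoopField om t x).1) (S.dι 1 (C.closedLoopField om t x).2.1)
    (C.closedLoopField om t x).2.2.1 (C.closedLoopField om t x).2.2.2

/-- The change of variables. -/
def changeOfVariables (om t : ℝ) : State n G ≃ State n G where
  toFun x := (x.1,
    x.2.1 - (C.lam * C.α (S.ψ x.1 - x.2.2.2)) • C.E (C.U (om * t)),
    x.2.2.1 - (C.κ * C.α (S.ψ x.1 - x.2.2.2)) • C.U (om * t),
    x.2.2.2)
  invFun x := (x.1,
    x.2.1 + (C.lam * C.α (S.ψ x.1 - x.2.2.2)) • C.E (C.U (om * t)),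
    x.2.2.1 + (C.κ * C.α (S.ψ x.1 - x.2.2.2)) • C.U (om * t),
    x.2.2.2)
  left_inv x := by simp
  right_inv x := by simp

/-- The endomorphism `Ξ = b κ ((a λ - b κ) I + λ R)⁻¹`; the inverse exists by `isUnit_Ξ`. -/
def Ξ : Module.End ℝ (LieAlg n G) :=
  (C.b * C.κ) • Ring.inverse ((C.a * C.lam - C.b * C.κ) • 1 + C.lam • S.R)

theorem isUnit_Ξ : IsUnit ((C.a * C.lam - C.b * C.κ) • 1 + C.lam • S.R) := by
  rw [LinearMap.isUnit_iff_ker_eq_bot, LinearMap.ker_eq_bot']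
  intro v hv
  by_contra h
  have h1 : S.inner ((((C.a * C.lam - C.b * C.κ) • 1 + C.lam • S.R) :
      Module.End ℝ (LieAlg n G)) v) v = 0 := by rw [hv]; simp
  simp only [LinearMap.add_apply, LinearMap.smul_apply, Module.End.one_apply, map_add, map_smul,
    smul_eq_mul] at h1
  have h2 := mul_pos C.gain_condition (S.inner_pos v h)
  have h3 := mul_nonneg C.lam_pos.le (S.R_nonneg v)
  linarith

/-- `‖v‖_A = √(𝕀(A v, v))` for a symmetric, positive semidefinite endomorphism `A`. -/
def _root_.ExtremumSeeking.MechanicalSystem.seminorm (S : MechanicalSystem n N G)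
    (A : Module.End ℝ (LieAlg n G)) (v : LieAlg n G) : ℝ :=
  √(S.inner (A v) v)

/-- `β(z)` is the integral of `α α' - (α α')(0)` from `0` to `z`. -/
def β (z : ℝ) : ℝ := ∫ s in (0 : ℝ)..z, (C.αα' s - C.αα' 0)

/-- The energy-like function `V`, with reference point `gs`. -/
def V (gs : G) : State n G → ℝ
  | (g, v, w, η) =>
    (1 / 2) * S.seminorm 1 v ^ 2 + (1 / 2) * S.seminorm C.Ξ (v - (C.lam / C.κ) • C.E w) ^ 2
      + C.lam ^ 2 * C.αα' 0 * (S.ψ g - S.ψ gs) + C.lam ^ 2 * C.β (S.ψ g - η)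

end ControlLaw

end System

end ExtremumSeeking

end

noncomputable section

namespace ExtremumSeeking

/-! ### A compact isolating neighborhood of a sublevel component -/

/-- A compact component of a sublevel set has arbitrarily small compact neighborhoods on whose
frontier the function is strictly larger. -/
theorem exists_isolating_nhd {Y : Type*} [TopologicalSpace Y] [T2Space Y] [LocallyCompactSpace Y]
    {V : Y → ℝ} (hV : Continuous V) {V₀ : ℝ} {x : Y} (hx : V x ≤ V₀)
    (hS : IsCompact (sublevelComponent V V₀ x)) {O : Set Y} (hO : IsOpen O)
    (hSO : sublevelComponent V V₀ x ⊆ O) :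
    ∃ W N : Set Y, IsOpen W ∧ IsCompact N ∧ sublevelComponent V V₀ x ⊆ W ∧ W ⊆ N ∧ N ⊆ O ∧
      ∃ V₁ > V₀, ∀ y ∈ N, y ∉ W → V₁ ≤ V y := by
  obtain ⟨N₀, hN₀, hSN, hNO⟩ := exists_compact_between hS hO hSO
  set A : Set Y := N₀ ∩ {z | V z ≤ V₀} with hA
  have hAc : IsCompact A := hN₀.inter_right (isClosed_le hV continuous_const)
  have hSA : sublevelComponent V V₀ x ⊆ A := fun y hy =>
    ⟨interior_subset (hSN hy), connectedComponentIn_subset _ _ hy⟩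
  have hxS : x ∈ sublevelComponent V V₀ x := mem_connectedComponentIn hx
  have hxA : x ∈ A := hSA hxS
  have : CompactSpace A := isCompact_iff_compactSpace.1 hAc
  have hcomp : (Subtype.val '' connectedComponent (⟨x, hxA⟩ : A)) ⊆ sublevelComponent V V₀ x := by
    rw [← connectedComponentIn_eq_image hxA]
    exact connectedComponentIn_mono _ inter_subset_right
  have hcomp' : sublevelComponent V V₀ x ⊆ Subtype.val '' connectedComponent (⟨x, hxA⟩ : A) := by
    rw [← connectedComponentIn_eq_image hxA]
    exact isPreconnected_connectedComponentIn.subset_connectedComponentIn hxS hSA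
  obtain ⟨⟨Z, hZc, hxZ⟩, hZ⟩ : ∃ Z : { s : Set A // IsClopen s ∧ (⟨x, hxA⟩ : A) ∈ s },
      (Z : Set A) ⊆ Subtype.val ⁻¹' interior N₀ := by
    have : Nonempty { s : Set A // IsClopen s ∧ (⟨x, hxA⟩ : A) ∈ s } :=
      ⟨⟨univ, isClopen_univ, mem_univ _⟩⟩
    refine exists_subset_nhds_of_isCompact' ?_ (fun Z => Z.2.1.1.isCompact)
      (fun Z => Z.2.1.1) ?_
    · rintro ⟨s, hs, hxs⟩ ⟨t, ht, hxt⟩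
      exact ⟨⟨s ∩ t, hs.inter ht, hxs, hxt⟩, inter_subset_left, inter_subset_right⟩
    · intro y hy
      rw [← connectedComponent_eq_iInter_isClopen] at hy
      exact (isOpen_interior.preimage continuous_subtype_val).mem_nhds
        (hSN (hcomp ⟨y, hy, rfl⟩))
  set Q : Set Y := Subtype.val '' Z with hQ
  have hQc : IsCompact Q := hZc.1.isCompact.image continuous_subtype_val
  set Q' : Set Y := Subtype.val '' Zᶜ with hQ'
  have hQ'c : IsCompact Q' := hZc.compl.1.isCompact.image continuous_subtype_val
  have hSQ : sublevelComponent V V₀ x ⊆ Q :=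
    hcomp'.trans (image_mono (hZc.connectedComponent_subset hxZ))
  have hQQ' : Disjoint Q Q' := by
    rw [Set.disjoint_image_iff Subtype.val_injective]
    exact disjoint_compl_right
  have hAQ : A ⊆ Q ∪ Q' := by
    intro y hy
    by_cases h : (⟨y, hy⟩ : A) ∈ Z
    · exact Or.inl ⟨_, h, rfl⟩
    · exact Or.inr ⟨_, h, rfl⟩
  have hQO : Q ⊆ interior N₀ ∩ Q'ᶜ := by
    intro y hy
    refine ⟨?_, fun h => Set.disjoint_left.1 hQQ' hy h⟩
    obtain ⟨z, hz, rfl⟩ := hy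
    exact hZ hz
  obtain ⟨N, hN, hQN, hNN⟩ := exists_compact_between hQc
    (isOpen_interior.inter hQ'c.isClosed.isOpen_compl) hQO
  refine ⟨interior N, N, isOpen_interior, hN, hSQ.trans hQN, interior_subset,
    fun y hy => hNO (interior_subset (hNN hy).1), ?_⟩
  have hF : IsCompact (N \ interior N) := hN.diff isOpen_interior
  have hgt : ∀ y ∈ N \ interior N, V₀ < V y := by
    rintro y ⟨hy, hy'⟩
    by_contra! h
    have hyA : y ∈ A := ⟨interior_subset (hNN hy).1, h⟩
    rcases hAQ hyA with h1 | h1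
    · exact hy' (hQN h1)
    · exact (hNN hy).2 h1
  rcases (N \ interior N).eq_empty_or_nonempty with h | h
  · exact ⟨V₀ + 1, by linarith, fun y hy hy' => absurd (show y ∈ N \ interior N from ⟨hy, hy'⟩)
      (by simp [h])⟩
  · obtain ⟨y, hy, hmin⟩ := hF.exists_isMinOn h hV.continuousOn
    exact ⟨V y, hgt y hy, fun z hz hz' => hmin ⟨hz, hz'⟩⟩

/-! ### Oscillating integrals -/

/-- The integral of a Lipschitz function against a rapidly oscillating zero-mean periodic function
is small. -/
theorem exists_oscillation_bound {p : ℝ → ℝ} {T : ℝ} (hT : 0 < T) (hp : Continuous p)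
    (hper : Function.Periodic p T) (hzero : ∫ t in (0 : ℝ)..T, p t = 0) :
    ∃ K, 0 ≤ K ∧ ∀ om > 0, ∀ a b, a ≤ b → b ≤ a + 1 → ∀ (c : ℝ → ℝ) (L : NNReal) (M : ℝ),
      LipschitzOnWith L c (Icc a b) → (∀ t ∈ Icc a b, |c t| ≤ M) →
      |∫ t in a..b, c t * p (om * t)| ≤ K * (L + 2 * M) / om := by
  set P : ℝ → ℝ := fun t => ∫ s in (0 : ℝ)..t, p s with hP
  have hPd : ∀ t, HasDerivAt P (p t) t := fun t =>
    intervalIntegral.integral_hasDerivAt_right (hp.intervalIntegrable _ _)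
      hp.stronglyMeasurable.stronglyMeasurableAtFilter hp.continuousAt
  have hPc : Continuous P := continuous_iff_continuousAt.2 fun t => (hPd t).continuousAt
  have hPper : Function.Periodic P T := fun t => by
    have h := intervalIntegral.integral_add_adjacent_intervals
      (hp.intervalIntegrable (μ := volume) 0 t) (hp.intervalIntegrable (μ := volume) t (t + T))
    rw [hper.intervalIntegral_add_eq t 0, zero_add, hzero, add_zero] at h
    exact h.symm
  obtain ⟨K, hK⟩ : ∃ K, ∀ t, |P t| ≤ K := by
    obtain ⟨K, hK⟩ := (isCompact_Icc (a := 0) (b := 0 + T)).exists_bound_of_continuousOn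
      hPc.continuousOn
    refine ⟨K, fun t => ?_⟩
    obtain ⟨s, hs, hst⟩ := hPper.exists_mem_Ico hT t 0
    rw [hst]
    exact hK s (Ico_subset_Icc_self hs)
  have hK0 : 0 ≤ K := (abs_nonneg _).trans (hK 0)
  refine ⟨K, hK0, fun om hom a b hab hb c L M hL hM => ?_⟩
  set Q : ℝ → ℝ := fun t => P (om * t) / om with hQ
  have hQd : ∀ t, HasDerivAt Q (p (om * t)) t := fun t => by
    have h := ((hPd (om * t)).comp t ((hasDerivAt_id t).const_mul om)).div_const om
    convert! h using 1
    field_simp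
  have hQ' : deriv Q = fun t => p (om * t) := funext fun t => (hQd t).deriv
  have hQac : AbsolutelyContinuousOnInterval Q a b := by
    refine ContDiffOn.absolutelyContinuousOnInterval (ContDiff.contDiffOn ?_)
    rw [contDiff_one_iff_deriv]
    refine ⟨fun t => (hQd t).differentiableAt, ?_⟩
    rw [hQ']
    fun_prop
  have hcac : AbsolutelyContinuousOnInterval c a b :=
    LipschitzOnWith.absolutelyContinuousOnInterval (K := L) (by rwa [uIcc_of_le hab])
  have hQb : ∀ t, |Q t| ≤ K / om := fun t => by
    rw [hQ, abs_div, abs_of_pos hom]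
    exact div_le_div_of_nonneg_right (hK _) hom.le
  have hparts := hcac.integral_mul_deriv_eq_deriv_mul hQac
  rw [hQ'] at hparts
  rw [hparts]
  have h1 : ‖∫ t in a..b, deriv c t * Q t‖ ≤ L * (K / om) * |b - a| := by
    refine intervalIntegral.norm_integral_le_of_norm_le_const_ae ?_
    have hb : ∀ᵐ t : ℝ, t ≠ b := by simp [ae_iff]
    filter_upwards [hb] with t htb ht
    rw [uIoc_of_le hab] at ht
    rw [norm_mul]
    refine mul_le_mul ?_ (hQb t) (norm_nonneg _) L.2
    exact norm_deriv_le_of_lipschitzOn (Icc_mem_nhds ht.1 (lt_of_le_of_ne ht.2 htb)) hL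
  have h2 : |b - a| ≤ 1 := by rw [abs_of_nonneg (by linarith)]; linarith
  have hKom : 0 ≤ K / om := div_nonneg hK0 hom.le
  have h3 : |∫ t in a..b, deriv c t * Q t| ≤ L * (K / om) :=
    h1.trans (mul_le_of_le_one_right (by positivity) h2)
  have h4 : ∀ t ∈ Icc a b, |c t * Q t| ≤ M * (K / om) := fun t ht => by
    rw [abs_mul]
    exact mul_le_mul (hM t ht) (hQb t) (abs_nonneg _) ((abs_nonneg _).trans (hM t ht))
  have h5 := h4 b (right_mem_Icc.2 hab)
  have h6 := h4 a (left_mem_Icc.2 hab)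
  calc _ ≤ |c b * Q b| + |c a * Q a| + |∫ t in a..b, deriv c t * Q t| :=
        (abs_sub _ _).trans (add_le_add_left (abs_sub _ _) _)
    _ ≤ M * (K / om) + M * (K / om) + L * (K / om) := by linarith
    _ = _ := by ring

/-- A Lipschitz function with small integrals is small. -/
theorem exists_small_of_integral_small (L : NNReal) {ε : ℝ} (hε : 0 < ε) :
    ∃ δ > 0, ∀ (a : ℝ) (f : ℝ → ℝ), LipschitzOnWith L f (Icc a (a + 1)) →
      (∀ s ∈ Icc a (a + 1), ∀ t ∈ Icc a (a + 1), s ≤ t → |∫ τ in s..t, f τ| ≤ δ) →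
      ∀ t ∈ Icc a (a + 1), |f t| ≤ ε := by
  set h : ℝ := min 1 (ε / (2 * (L + 1))) with hh
  have hL : (0 : ℝ) ≤ L := L.2
  have hh0 : 0 < h := lt_min one_pos (by positivity)
  have hh1 : h ≤ 1 := min_le_left _ _
  have hLh : L * h ≤ ε / 2 := by
    have h1 : h ≤ ε / (2 * (L + 1)) := min_le_right _ _
    calc L * h ≤ (L + 1) * (ε / (2 * (L + 1))) := by gcongr; linarith
      _ = ε / 2 := by field_simp
  refine ⟨ε / 2 * h, by positivity, fun a f hf hint t ht => ?_⟩
  obtain ⟨s, hs, hst, hts, hs1⟩ : ∃ s, a ≤ s ∧ s ≤ t ∧ t ≤ s + h ∧ s + h ≤ a + 1 := by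
    refine ⟨min t (a + 1 - h), le_min ht.1 (by linarith), min_le_left _ _, ?_, ?_⟩
    · rcases min_cases t (a + 1 - h) with h1 | h1 <;> rw [h1.1] <;> linarith [ht.2]
    · linarith [min_le_right t (a + 1 - h)]
  have hsub : Icc s (s + h) ⊆ Icc a (a + 1) := Icc_subset_Icc hs hs1
  have hI := hint s ⟨hs, by linarith⟩ (s + h) ⟨by linarith, hs1⟩ (by linarith)
  have hfi : IntervalIntegrable f volume s (s + h) := by
    refine ContinuousOn.intervalIntegrable ?_
    rw [uIcc_of_le (by linarith)]
    exact hf.continuousOn.mono hsub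
  have hdist : ∀ τ ∈ Icc s (s + h), |f τ - f t| ≤ ε / 2 := fun τ hτ => by
    have h1 := hf.dist_le_mul τ (hsub hτ) t ht
    rw [Real.dist_eq, Real.dist_eq] at h1
    refine h1.trans (le_trans ?_ hLh)
    gcongr
    rw [abs_le]
    constructor <;> linarith [hτ.1, hτ.2]
  have hdiff : |∫ τ in s..(s + h), (f τ - f t)| ≤ ε / 2 * h := by
    have := intervalIntegral.norm_integral_le_of_norm_le_const (a := s) (b := s + h)
      (f := fun τ => f τ - f t) (C := ε / 2) (fun τ hτ => by
        rw [uIoc_of_le (by linarith)] at hτ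
        exact hdist τ ⟨hτ.1.le, hτ.2⟩)
    rwa [add_sub_cancel_left, abs_of_pos hh0] at this
  rw [intervalIntegral.integral_sub hfi intervalIntegrable_const,
    intervalIntegral.integral_const, add_sub_cancel_left, smul_eq_mul] at hdiff
  have h3 : |h * f t| ≤ ε * h := by
    calc |h * f t| = |(∫ τ in s..(s + h), f τ) - ((∫ τ in s..(s + h), f τ) - h * f t)| := by
          congr 1; ring
      _ ≤ _ := abs_sub _ _
      _ ≤ ε / 2 * h + ε / 2 * h := add_le_add hI hdiff
      _ = ε * h := by ring
  rw [abs_mul, abs_of_pos hh0, mul_comm] at h3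
  exact le_of_mul_le_mul_right h3 hh0

end ExtremumSeeking
end

noncomputable section

namespace ExtremumSeeking

/-! ### A Lyapunov argument for rapidly oscillating systems -/

theorem eq_zero_of_abs_sum_abs {ι : Type*} [Fintype ι] {f : ι → ℝ} (h : |∑ k, (|f k|)| = 0)
    (k : ι) : f k = 0 := by
  rw [abs_eq_zero, Finset.sum_eq_zero_iff_of_nonneg fun _ _ => abs_nonneg _] at h
  exact abs_eq_zero.1 (h k (Finset.mem_univ k))

section Averaging

variable {Y : Type*}

/-- `fbar` is the averaged derivative of `f` along the trajectories `Tr om J y` with frequency `om`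
which stay in `N`. -/
def HasAverage (Tr : ℝ → Set ℝ → (ℝ → Y) → Prop) (N : Set Y) (f fbar : Y → ℝ) : Prop :=
  ∃ C : ℝ, ∀ om > 0, ∀ (a b : ℝ) (y : ℝ → Y), a ≤ b → b ≤ a + 1 → Tr om (Icc a b) y →
    MapsTo y (Icc a b) N → |f (y b) - f (y a) - ∫ τ in a..b, fbar (y τ)| ≤ C / om

/-- `f` tends to zero, uniformly on intervals of length one, along a sequence of trajectories. -/
def VanishesAlong (a : ℕ → ℝ) (y : ℕ → ℝ → Y) (f : Y → ℝ) : Prop :=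
  ∀ ε > 0, ∀ᶠ i in atTop, ∀ t ∈ Icc (a i) (a i + 1), |f (y i t)| ≤ ε

/-- The integrals of `f` over subintervals tend to zero uniformly along a sequence of
trajectories. -/
def IntegralVanishesAlong (a : ℕ → ℝ) (y : ℕ → ℝ → Y) (f : Y → ℝ) : Prop :=
  ∀ ε > 0, ∀ᶠ i in atTop, ∀ s ∈ Icc (a i) (a i + 1), ∀ t ∈ Icc (a i) (a i + 1), s ≤ t →
    |∫ τ in s..t, f (y i τ)| ≤ ε

variable {a : ℕ → ℝ} {y : ℕ → ℝ → Y} {N : Set Y} {Tr : ℝ → Set ℝ → (ℝ → Y) → Prop}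

theorem VanishesAlong.abs_add {f g : Y → ℝ} (hf : VanishesAlong a y f)
    (hg : VanishesAlong a y g) : VanishesAlong a y (fun x => |f x| + |g x|) := fun ε hε => by
  filter_upwards [hf (ε / 2) (by linarith), hg (ε / 2) (by linarith)] with i h1 h2 t ht
  rw [abs_of_nonneg (by positivity)]
  linarith [h1 t ht, h2 t ht]

theorem VanishesAlong.sum_abs {ι : Type*} [Fintype ι] {f : ι → Y → ℝ}
    (hf : ∀ k, VanishesAlong a y (f k)) : VanishesAlong a y (fun x => ∑ k, |f k x|) :=
  fun ε hε => by
    have hc : (0 : ℝ) < Fintype.card ι + 1 := by positivity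
    have h : ∀ k, ∀ᶠ i in atTop, ∀ t ∈ Icc (a i) (a i + 1),
        |f k (y i t)| ≤ ε / (Fintype.card ι + 1) := fun k => hf k _ (by positivity)
    filter_upwards [eventually_all.2 h] with i hi t ht
    rw [abs_of_nonneg (Finset.sum_nonneg fun _ _ => abs_nonneg _)]
    calc ∑ k, |f k (y i t)| ≤ ∑ _k : ι, ε / (Fintype.card ι + 1) :=
          Finset.sum_le_sum fun k _ => hi k t ht
      _ = Fintype.card ι * (ε / (Fintype.card ι + 1)) := by simp
      _ ≤ ε := by
        rw [mul_div_assoc', div_le_iff₀ hc]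
        nlinarith

theorem VanishesAlong.of_zero_imp [TopologicalSpace Y] [T2Space Y] {f g : Y → ℝ} (hN : IsCompact N)
    (hy : ∀ i, MapsTo (y i) (Icc (a i) (a i + 1)) N) (hfc : ContinuousOn f N)
    (hgc : ContinuousOn g N) (hfg : ∀ x ∈ N, f x = 0 → g x = 0) (hf : VanishesAlong a y f) :
    VanishesAlong a y g := fun ε hε => by
  have hB : IsCompact (N ∩ (fun x => |g x|) ⁻¹' Ici ε) := by
    refine hN.of_isClosed_subset ?_ inter_subset_left
    exact hgc.abs.preimage_isClosed_of_isClosed hN.isClosed isClosed_Ici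
  obtain ⟨δ, hδ, h⟩ : ∃ δ > 0, ∀ x ∈ N ∩ (fun x => |g x|) ⁻¹' Ici ε, δ ≤ |f x| := by
    rcases (N ∩ (fun x => |g x|) ⁻¹' Ici ε).eq_empty_or_nonempty with h | h
    · exact ⟨1, one_pos, by simp [h]⟩
    · obtain ⟨x, hx, hmin⟩ := hB.exists_isMinOn h (hfc.abs.mono inter_subset_left)
      refine ⟨|f x|, abs_pos.2 fun h0 => ?_, fun z hz => hmin hz⟩
      have h1 := hx.2
      rw [mem_preimage, hfg x hx.1 h0, abs_zero] at h1
      exact absurd h1 (not_le.2 hε)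
  filter_upwards [hf (δ / 2) (by linarith)] with i hi t ht
  by_contra! hgt
  linarith [hi t ht, h (y i t) ⟨hy i ht, hgt.le⟩]

theorem IntegralVanishesAlong.vanishesAlong {L : NNReal} {f : Y → ℝ}
    (hL : ∀ i, LipschitzOnWith L (fun t => f (y i t)) (Icc (a i) (a i + 1)))
    (hf : IntegralVanishesAlong a y f) : VanishesAlong a y f := fun ε hε => by
  obtain ⟨δ, hδ, h⟩ := exists_small_of_integral_small L hε
  filter_upwards [hf δ hδ] with i hi
  exact h (a i) _ (hL i) hi

variable (hmono : ∀ om J J' y, Tr om J y → J' ⊆ J → Tr om J' y)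
include hmono

theorem VanishesAlong.integralVanishesAlong_average {om : ℕ → ℝ} (hom : Tendsto om atTop atTop)
    (htr : ∀ i, Tr (om i) (Icc (a i) (a i + 1)) (y i))
    (hy : ∀ i, MapsTo (y i) (Icc (a i) (a i + 1)) N) {f fbar : Y → ℝ}
    (havg : HasAverage Tr N f fbar) (c : ℝ) (hf : VanishesAlong a y (fun x => f x - c)) :
    IntegralVanishesAlong a y fbar := fun ε hε => by
  obtain ⟨C, hC⟩ := havg
  have hlim : Tendsto (fun i => C / om i) atTop (𝓝 0) := hom.const_div_atTop C
  filter_upwards [hf (ε / 4) (by linarith), hom.eventually_gt_atTop 0,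
    hlim.eventually_lt_const (show 0 < ε / 4 by linarith)] with i h1 h2 h3 s hs t ht hst
  have hsub : Icc s t ⊆ Icc (a i) (a i + 1) := Icc_subset_Icc hs.1 ht.2
  have h := hC (om i) h2 s t (y i) hst (by linarith [hs.1, ht.2]) (hmono _ _ _ _ (htr i) hsub)
    ((hy i).mono_left hsub)
  have h4 := abs_le.1 (h1 s hs)
  have h5 := abs_le.1 (h1 t ht)
  have h6 := abs_le.1 h
  rw [abs_le]
  constructor <;> linarith

omit hmono in
/-- Along trajectories of high frequency, the Lyapunov function is almost nonincreasing. -/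
theorem HasAverage.exists_almost_nonincreasing {V q : Y → ℝ}
    (hV : HasAverage Tr N V (fun x => -q x)) (hq : ∀ x ∈ N, 0 ≤ q x) {σ : ℝ} (hσ : 0 < σ) :
    ∃ om₀ > 0, ∀ om ≥ om₀, ∀ (a b : ℝ) (y : ℝ → Y), a ≤ b → b ≤ a + 1 → Tr om (Icc a b) y →
      MapsTo y (Icc a b) N → V (y b) ≤ V (y a) + σ := by
  obtain ⟨C, hC⟩ := hV
  refine ⟨(|C| + 1) / σ, by positivity, fun om hom a b y hab hb htr hy => ?_⟩
  have hom0 : 0 < om := lt_of_lt_of_le (by positivity) hom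
  have h := hC om hom0 a b y hab hb htr hy
  have h1 : C / om ≤ σ := by
    rw [div_le_iff₀ hom0]
    rw [ge_iff_le, div_le_iff₀ hσ] at hom
    linarith [le_abs_self C]
  rw [intervalIntegral.integral_neg] at h
  have h2 : 0 ≤ ∫ τ in a..b, q (y τ) :=
    intervalIntegral.integral_nonneg hab fun t ht => hq _ (hy ht)
  linarith [(abs_le.1 h).2]

/-- Along trajectories of high frequency which start away from `ys`, the Lyapunov function
decreases by a fixed amount in unit time, if `ys` is the only solution of the averaged system on
which the Lyapunov function is constant. -/
theorem HasAverage.exists_decrease [MetricSpace Y] {ι κ : Type*} [Fintype ι] [Fintype κ] (hN : IsCompact N)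
    (hLip : ∃ L : NNReal, ∀ om a b y, Tr om (Icc a b) y → MapsTo y (Icc a b) N →
      LipschitzOnWith L y (Icc a b))
    {V q : Y → ℝ} {w F : ι → Y → ℝ} {z d : κ → Y → ℝ} {ys : Y}
    (hV : HasAverage Tr N V (fun x => -q x)) (hq : ∀ x ∈ N, 0 ≤ q x) (hqL : LocallyLipschitz q)
    (hw : ∀ k, HasAverage Tr N (w k) (F k)) (hwc : ∀ k, Continuous (w k))
    (hFL : ∀ k, LocallyLipschitz (F k))
    (hz : ∀ k, HasAverage Tr N (z k) (d k)) (hzc : ∀ k, Continuous (z k))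
    (hdL : ∀ k, LocallyLipschitz (d k))
    (h₁ : ∀ x ∈ N, q x = 0 → ∀ k, w k x = 0)
    (h₂ : ∀ x ∈ N, q x = 0 → (∀ k, F k x = 0) → ∀ k, z k x = z k ys)
    (h₃ : ∀ x ∈ N, q x = 0 → (∀ k, F k x = 0) → (∀ k, d k x = 0) → x = ys)
    {η : ℝ} (hη : 0 < η) :
    ∃ γ > 0, ∃ om₀ > 0, ∀ om ≥ om₀, ∀ (a : ℝ) (y : ℝ → Y), Tr om (Icc a (a + 1)) y →
      MapsTo y (Icc a (a + 1)) N → η ≤ dist (y a) ys → V (y (a + 1)) ≤ V (y a) - γ := by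
  by_contra! hcon
  have hpos : ∀ i : ℕ, (0 : ℝ) < 1 / (i + 1) := fun i => Nat.one_div_pos_of_nat
  choose om hom a y htr hy hdist hVy using
    fun i : ℕ => hcon (1 / (i + 1)) (hpos i) (i + 1) (by positivity)
  have homt : Tendsto om atTop atTop := tendsto_atTop_mono
    (fun i => (hom i).le) (tendsto_atTop_add_const_right _ 1 tendsto_natCast_atTop_atTop)
  obtain ⟨L, hL⟩ := hLip
  have hcomp : ∀ f : Y → ℝ, LocallyLipschitz f → ∃ L' : NNReal, ∀ i,
      LipschitzOnWith L' (fun t => f (y i t)) (Icc (a i) (a i + 1)) := fun f hf => by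
    obtain ⟨K, hK⟩ :=
      (hf.locallyLipschitzOn (s := N)).exists_lipschitzOnWith_of_compact hN
    exact ⟨K * L, fun i => hK.comp (hL _ _ _ _ (htr i) (hy i)) (hy i)⟩
  have hvan : ∀ f : Y → ℝ, LocallyLipschitz f → IntegralVanishesAlong a y f →
      VanishesAlong a y f := fun f hf h => by
    obtain ⟨L', hL'⟩ := hcomp f hf
    exact h.vanishesAlong hL'
  have hqv : VanishesAlong a y q := by
    refine hvan q hqL fun ε hε => ?_
    obtain ⟨C, hC⟩ := hV
    have hlim : Tendsto (fun i => C / om i) atTop (𝓝 0) := homt.const_div_atTop C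
    filter_upwards [hlim.eventually_lt_const (show 0 < ε / 2 by linarith),
      homt.eventually_gt_atTop 0,
      tendsto_one_div_add_atTop_nhds_zero_nat.eventually_lt_const (show 0 < ε / 2 by linarith)]
      with i h1 h2 h3 s hs t ht hst
    have h := hC (om i) h2 (a i) (a i + 1) (y i) (by linarith) le_rfl (htr i) (hy i)
    rw [intervalIntegral.integral_neg] at h
    have hnn : ∀ τ ∈ Icc (a i) (a i + 1), 0 ≤ q (y i τ) := fun τ hτ => hq _ (hy i hτ)
    obtain ⟨L', hL'⟩ := hcomp q hqL
    have hint : IntervalIntegrable (fun τ => q (y i τ)) volume (a i) (a i + 1) := by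
      refine ContinuousOn.intervalIntegrable ?_
      rw [uIcc_of_le (by linarith)]
      exact (hL' i).continuousOn
    have h4 : 0 ≤ ∫ τ in s..t, q (y i τ) := intervalIntegral.integral_nonneg hst
      fun τ hτ => hnn τ ⟨hs.1.trans hτ.1, hτ.2.trans ht.2⟩
    have h5 : ∫ τ in s..t, q (y i τ) ≤ ∫ τ in (a i)..(a i + 1), q (y i τ) := by
      refine intervalIntegral.integral_mono_interval hs.1 hst ht.2 ?_ hint
      refine (ae_restrict_iff' measurableSet_Ioc).2 (Eventually.of_forall fun τ hτ => ?_)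
      exact hnn τ ⟨hτ.1.le, hτ.2⟩
    rw [abs_of_nonneg h4]
    linarith [(abs_le.1 h).2, hVy i]
  have hwv : ∀ k, VanishesAlong a y (w k) := fun k =>
    hqv.of_zero_imp hN hy hqL.continuous.continuousOn (hwc k).continuousOn
      fun x hx h => h₁ x hx h k
  have hFv : ∀ k, VanishesAlong a y (F k) := fun k => hvan _ (hFL k)
    (VanishesAlong.integralVanishesAlong_average hmono homt htr hy (hw k) 0
      (by simpa using hwv k))
  have hqF := hqv.abs_add (VanishesAlong.sum_abs hFv)
  have hqc := hqL.continuous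
  have hFc := fun k => (hFL k).continuous
  have hdc := fun k => (hdL k).continuous
  have hzv : ∀ k, VanishesAlong a y (fun x => z k x - z k ys) := fun k => by
    refine hqF.of_zero_imp hN hy (by fun_prop) (by fun_prop) fun x hx h => ?_
    rw [add_eq_zero_iff_of_nonneg (abs_nonneg _) (abs_nonneg _)] at h
    exact sub_eq_zero.2 (h₂ x hx (abs_eq_zero.1 h.1) (eq_zero_of_abs_sum_abs h.2) k)
  have hdv : ∀ k, VanishesAlong a y (d k) := fun k => hvan _ (hdL k)
    (VanishesAlong.integralVanishesAlong_average hmono homt htr hy (hz k) _ (hzv k))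
  have hall := hqF.abs_add (VanishesAlong.sum_abs hdv)
  have hdistv : VanishesAlong a y (fun x => dist x ys) := by
    refine hall.of_zero_imp hN hy (by fun_prop) (by fun_prop) fun x hx h => ?_
    rw [add_eq_zero_iff_of_nonneg (abs_nonneg _) (abs_nonneg _), abs_eq_zero,
      add_eq_zero_iff_of_nonneg (abs_nonneg _) (abs_nonneg _)] at h
    rw [h₃ x hx (abs_eq_zero.1 h.1.1) (eq_zero_of_abs_sum_abs h.1.2) (eq_zero_of_abs_sum_abs h.2), dist_self]
  obtain ⟨i, hi⟩ := (hdistv (η / 2) (by linarith)).exists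
  have h1 := hi (a i) (left_mem_Icc.2 (by linarith))
  rw [abs_of_nonneg dist_nonneg] at h1
  linarith [hdist i]

end Averaging

/-! ### Practical stability from a Lyapunov function -/

section PracticalLyapunov

variable {Y : Type*} [MetricSpace Y] {Tr : ℝ → Set ℝ → (ℝ → Y) → Prop}
  (hmono : ∀ om J J' y, Tr om J y → J' ⊆ J → Tr om J' y)
  {W N : Set Y} {V : Y → ℝ} {ys : Y} {om σ η γ m : ℝ}
  (hU : ∀ (a b : ℝ) (y : ℝ → Y), a ≤ b → b ≤ a + 1 → Tr om (Icc a b) y →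
    MapsTo y (Icc a b) N → V (y b) ≤ V (y a) + σ)
  (hD : ∀ (a : ℝ) (y : ℝ → Y), Tr om (Icc a (a + 1)) y → MapsTo y (Icc a (a + 1)) N →
    η ≤ dist (y a) ys → V (y (a + 1)) ≤ V (y a) - γ)
  (hm : ∀ x, dist x ys < η → V x ≤ m) (hγ : 0 < γ)
include hmono hU hD hm hγ

theorem le_max_of_decrease_step {t₀ t₁ : ℝ} {y : ℝ → Y} (htr : Tr om (Icc t₀ t₁) y)
    (hy : MapsTo y (Icc t₀ t₁) N) {B : ℝ} (h₀ : V (y t₀) ≤ B) (hB : m + σ ≤ B) (k : ℕ)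
    (hk : t₀ + k ≤ t₁) : V (y (t₀ + k)) ≤ B := by
  induction k with
  | zero => simpa using h₀
  | succ k ih =>
    push_cast at hk ⊢
    rw [← add_assoc] at hk ⊢
    have hk0 : (0 : ℝ) ≤ k := k.cast_nonneg
    have hsub : Icc (t₀ + k) (t₀ + k + 1) ⊆ Icc t₀ t₁ := Icc_subset_Icc (by linarith) hk
    have ih' := ih (by linarith)
    rcases lt_or_ge (dist (y (t₀ + k)) ys) η with h | h
    · have := hU _ _ y (by linarith) le_rfl (hmono _ _ _ _ htr hsub) (hy.mono_left hsub)
      linarith [hm _ h]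
    · have := hD _ y (hmono _ _ _ _ htr hsub) (hy.mono_left hsub) h
      linarith

theorem le_max_of_decrease {t₀ t₁ : ℝ} {y : ℝ → Y} (htr : Tr om (Icc t₀ t₁) y)
    (hy : MapsTo y (Icc t₀ t₁) N) {B : ℝ} (h₀ : V (y t₀) ≤ B) (hB : m + σ ≤ B) {t : ℝ}
    (ht : t ∈ Icc t₀ t₁) : V (y t) ≤ B + σ := by
  have h1 : (⌊t - t₀⌋₊ : ℝ) ≤ t - t₀ := Nat.floor_le (by linarith [ht.1])
  have h2 : t - t₀ < ⌊t - t₀⌋₊ + 1 := Nat.lt_floor_add_one _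
  have h3 := le_max_of_decrease_step hmono hU hD hm hγ htr hy h₀ hB ⌊t - t₀⌋₊
    (by linarith [ht.2])
  have h0 : (0 : ℝ) ≤ ⌊t - t₀⌋₊ := Nat.cast_nonneg _
  have hsub : Icc (t₀ + ⌊t - t₀⌋₊) t ⊆ Icc t₀ t₁ := Icc_subset_Icc (by linarith) ht.2
  have h4 := hU _ t y (by linarith) (by linarith) (hmono _ _ _ _ htr hsub) (hy.mono_left hsub)
  linarith

theorem mem_of_decrease {t₀ : ℝ} {J : Set ℝ} {y : ℝ → Y} (hJ : J.OrdConnected) (ht₀ : t₀ ∈ J)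
    (htr : Tr om J y) (hyc : ContinuousOn y J) (hW : IsOpen W) (hN : IsCompact N) (hWN : W ⊆ N)
    {V₁ : ℝ} (hV₁ : ∀ x ∈ N, x ∉ W → V₁ ≤ V x) {B : ℝ} (h₀ : V (y t₀) ≤ B) (hB : m + σ ≤ B)
    (hBV : B + σ < V₁) (hy₀ : y t₀ ∈ W) {t : ℝ} (ht : t ∈ J) (ht0 : t₀ ≤ t) : y t ∈ W := by
  by_contra hcon
  have hsub : Icc t₀ t ⊆ J := hJ.out ht₀ ht
  have hcl : IsCompact (Icc t₀ t ∩ y ⁻¹' Wᶜ) := isCompact_Icc.of_isClosed_subset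
    ((hyc.mono hsub).preimage_isClosed_of_isClosed isClosed_Icc hW.isClosed_compl)
    inter_subset_left
  obtain ⟨t₁, ht₁, hleast⟩ := hcl.exists_isLeast ⟨t, right_mem_Icc.2 ht0, hcon⟩
  have hne : t₀ < t₁ := lt_of_le_of_ne ht₁.1.1 fun h => ht₁.2 (h ▸ hy₀)
  have hsub' : Icc t₀ t₁ ⊆ J := (Icc_subset_Icc_right ht₁.1.2).trans hsub
  have hbefore : ∀ s ∈ Ico t₀ t₁, y s ∈ W := fun s hs => by
    by_contra hsW
    exact absurd (hleast ⟨⟨hs.1, hs.2.le.trans ht₁.1.2⟩, hsW⟩) (not_le.2 hs.2)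
  have hyt₁ : y t₁ ∈ N := by
    have h1 : ContinuousWithinAt y (Ico t₀ t₁) t₁ :=
      (hyc t₁ (hsub' (right_mem_Icc.2 hne.le))).mono (Ico_subset_Icc_self.trans hsub')
    have h2 : t₁ ∈ closure (Ico t₀ t₁) := by
      rw [closure_Ico hne.ne]
      exact right_mem_Icc.2 hne.le
    have h3 := h1.mem_closure_image h2
    exact hN.isClosed.closure_subset_iff.2
      (by rintro _ ⟨s, hs, rfl⟩; exact hWN (hbefore s hs)) h3
  have hmaps : MapsTo y (Icc t₀ t₁) N := fun s hs => by
    rcases eq_or_lt_of_le hs.2 with h | h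
    · rw [h]; exact hyt₁
    · exact hWN (hbefore s ⟨hs.1, h⟩)
  have h5 := le_max_of_decrease hmono hU hD hm hγ (hmono _ _ _ _ htr hsub') hmaps h₀ hB
    (right_mem_Icc.2 hne.le)
  linarith [hV₁ _ hyt₁ ht₁.2]

theorem le_of_decrease_of_large_time {t₀ : ℝ} {y : ℝ → Y} (htr : Tr om (Ici t₀) y)
    (hy : MapsTo y (Ici t₀) N) (hV : ∀ x ∈ N, 0 ≤ V x) (hσ : 0 ≤ σ) {K : ℕ}
    (hK : V (y t₀) < K * γ) {t : ℝ} (ht : t₀ + K ≤ t) : V (y t) ≤ m + 2 * σ := by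
  obtain ⟨k, hk, hdist⟩ : ∃ k : ℕ, k ≤ K ∧ dist (y (t₀ + k)) ys < η := by
    by_contra! h
    have h1 : ∀ k : ℕ, k ≤ K → V (y (t₀ + k)) ≤ V (y t₀) - k * γ := fun k => by
      induction k with
      | zero => simp
      | succ k ih =>
        intro hk
        have hk0 : (0 : ℝ) ≤ k := k.cast_nonneg
        have hsub : Icc (t₀ + k) (t₀ + k + 1) ⊆ Ici t₀ := fun s hs => by
          have := hs.1
          rw [mem_Ici]
          linarith
        have h2 := hD _ y (hmono _ _ _ _ htr hsub) (hy.mono_left hsub) (h k (by omega))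
        have h3 := ih (by omega)
        push_cast
        rw [← add_assoc]
        linarith
    have hmem : t₀ + (K : ℝ) ∈ Ici t₀ := by rw [mem_Ici]; linarith [K.cast_nonneg (α := ℝ)]
    linarith [h1 K le_rfl, hV _ (hy hmem)]
  have hk0 : (0 : ℝ) ≤ k := k.cast_nonneg
  have hkK : (k : ℝ) ≤ K := Nat.cast_le.2 hk
  have hsub : Icc (t₀ + k) t ⊆ Ici t₀ := fun s hs => by
    have := hs.1
    rw [mem_Ici]
    linarith
  have := le_max_of_decrease hmono hU hD hm hγ (hmono _ _ _ _ htr hsub) (hy.mono_left hsub)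
    (show V (y (t₀ + k)) ≤ m + σ by linarith [hm _ hdist]) le_rfl
    (right_mem_Icc.2 (by linarith))
  linarith

omit hmono hU hD hm hγ in
theorem exists_pos_forall_lt_imp_dist_lt (hN : IsCompact N) (hVc : Continuous V)
    (hVpos : ∀ x ∈ N, x ≠ ys → 0 < V x) {ε : ℝ} (hε : 0 < ε) :
    ∃ c > 0, ∀ x ∈ N, V x < c → dist x ys < ε := by
  have hc : IsCompact (N ∩ {x | ε ≤ dist x ys}) :=
    hN.inter_right (isClosed_le continuous_const (by fun_prop))
  rcases (N ∩ {x | ε ≤ dist x ys}).eq_empty_or_nonempty with h | h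
  · refine ⟨1, one_pos, fun x hx _ => ?_⟩
    by_contra! hd
    exact (h.subset ⟨hx, hd⟩ : x ∈ (∅ : Set Y))
  · obtain ⟨x, hx, hmin⟩ := hc.exists_isMinOn h hVc.continuousOn
    refine ⟨V x, hVpos x hx.1 fun h0 => ?_, fun z hz hzV => ?_⟩
    · have := hx.2
      rw [mem_ofPred_eq, h0, dist_self] at this
      linarith
    · by_contra! hd
      exact absurd (hmin ⟨hz, hd⟩) (not_le.2 hzV)

end PracticalLyapunov

section

variable {Y : Type*} [MetricSpace Y] {Tr : ℝ → Set ℝ → (ℝ → Y) → Prop}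
  {P : ℝ → ℝ → Set ℝ → (ℝ → Y) → Prop} {W N : Set Y} {V : Y → ℝ} {ys : Y} {V₀ V₁ : ℝ}

/-- Practical stability of `ys`, and practical attractivity on the sublevel set of level `V₀`, for
the maximal solutions `P om t₀ J y`. -/
theorem practicallyStable_of_lyapunov
    (hmono : ∀ om J J' y, Tr om J y → J' ⊆ J → Tr om J' y)
    (hP : ∀ om t₀ J y, P om t₀ J y → J.OrdConnected ∧ t₀ ∈ J ∧ Tr om J y ∧ ContinuousOn y J)
    (hesc : ∀ om > 0, ∀ t₀ J y, P om t₀ J y → (∀ t ∈ J, t₀ ≤ t → y t ∈ N) → Ici t₀ ⊆ J)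
    (hW : IsOpen W) (hN : IsCompact N) (hWN : W ⊆ N) (hys : ys ∈ W) (hVc : Continuous V)
    (hVys : V ys = 0) (hVpos : ∀ x ∈ N, x ≠ ys → 0 < V x) (hV₀ : 0 < V₀) (hV₁ : V₀ < V₁)
    (hWV : ∀ x ∈ N, x ∉ W → V₁ ≤ V x)
    (hU : ∀ σ > 0, ∃ om₀ > 0, ∀ om ≥ om₀, ∀ (a b : ℝ) (y : ℝ → Y), a ≤ b → b ≤ a + 1 →
      Tr om (Icc a b) y → MapsTo y (Icc a b) N → V (y b) ≤ V (y a) + σ)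
    (hD : ∀ η > 0, ∃ γ > 0, ∃ om₀ > 0, ∀ om ≥ om₀, ∀ (a : ℝ) (y : ℝ → Y),
      Tr om (Icc a (a + 1)) y → MapsTo y (Icc a (a + 1)) N → η ≤ dist (y a) ys →
        V (y (a + 1)) ≤ V (y a) - γ) :
    (∀ ε > 0, ∃ om₀ > 0, ∃ δ > 0, ∀ om ≥ om₀, ∀ t₀ J y, P om t₀ J y → dist (y t₀) ys ≤ δ →
      ∀ t ≥ t₀, t ∈ J ∧ dist (y t) ys ≤ ε) ∧
    (∀ ε > 0, ∃ om₀ > 0, ∃ Δ > 0, ∀ om ≥ om₀, ∀ t₀ J y, P om t₀ J y → y t₀ ∈ W →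
      V (y t₀) ≤ V₀ → (∀ t ≥ t₀, t ∈ J ∧ y t ∈ N) ∧ ∀ t ≥ t₀ + Δ, dist (y t) ys ≤ ε) := by
  have hVnn : ∀ x ∈ N, 0 ≤ V x := fun x hx => by
    by_cases h : x = ys
    · rw [h, hVys]
    · exact (hVpos x hx h).le
  -- the common choice of constants
  have key : ∀ ε > 0, ∃ m > 0, ∃ η > 0, ∃ γ > 0, ∃ om₀ > 0, 4 * m < V₀ ∧ 4 * m < V₁ - V₀ ∧
      (∀ x ∈ N, V x < 4 * m → dist x ys < ε) ∧ (∀ x, dist x ys < η → V x ≤ m ∧ x ∈ W) ∧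
      ∀ om ≥ om₀, (∀ (a b : ℝ) (y : ℝ → Y), a ≤ b → b ≤ a + 1 →
        Tr om (Icc a b) y → MapsTo y (Icc a b) N → V (y b) ≤ V (y a) + m) ∧
        ∀ (a : ℝ) (y : ℝ → Y), Tr om (Icc a (a + 1)) y → MapsTo y (Icc a (a + 1)) N →
          η ≤ dist (y a) ys → V (y (a + 1)) ≤ V (y a) - γ := by
    intro ε hε
    obtain ⟨c, hc, hcε⟩ := exists_pos_forall_lt_imp_dist_lt hN hVc hVpos hε
    obtain ⟨m, hm0, hm⟩ : ∃ m : ℝ, 0 < m ∧ m < min (c / 4) (min (V₀ / 4) ((V₁ - V₀) / 4)) :=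
      exists_between (lt_min (by linarith) (lt_min (by linarith) (by linarith)))
    rw [lt_min_iff, lt_min_iff] at hm
    obtain ⟨η, hη, hηm⟩ := Metric.mem_nhds_iff.1
      (inter_mem (hVc.continuousAt.preimage_mem_nhds (Iic_mem_nhds (by rw [hVys]; exact hm0)))
        (hW.mem_nhds hys))
    obtain ⟨om₁, hom₁, h1⟩ := hU m hm0
    obtain ⟨γ, hγ, om₂, hom₂, h2⟩ := hD η hη
    exact ⟨m, hm0, η, hη, γ, hγ, max om₁ om₂, lt_max_of_lt_left hom₁, by linarith, by linarith,
      fun x hx h => hcε x hx (by linarith), fun x hx => hηm hx,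
      fun om hom => ⟨h1 om (le_trans (le_max_left _ _) hom),
        h2 om (le_trans (le_max_right _ _) hom)⟩⟩
  constructor
  · intro ε hε
    obtain ⟨m, hm0, η, hη, γ, hγ, om₀, hom₀, hmV₀, hmV₁, hmε, hmη, hom⟩ := key ε hε
    refine ⟨om₀, hom₀, η / 2, by linarith, fun om hom' t₀ J y hPy hdist => ?_⟩
    obtain ⟨hJ, ht₀, htr, hyc⟩ := hP _ _ _ _ hPy
    obtain ⟨h1, h2⟩ := hom om hom'
    have h3 := hmη (y t₀) (by linarith)
    have hmem : ∀ t ∈ J, t₀ ≤ t → y t ∈ W := fun t ht ht0 =>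
      mem_of_decrease hmono h1 h2 (fun x hx => (hmη x hx).1) hγ hJ ht₀ htr hyc hW hN hWN hWV
        (show V (y t₀) ≤ m + m by linarith [h3.1]) le_rfl (by linarith) h3.2 ht ht0
    have hJt := hesc om (by linarith) t₀ J y hPy fun t ht ht0 => hWN (hmem t ht ht0)
    refine fun t ht => ⟨hJt ht, (hmε _ (hWN (hmem t (hJt ht) ht)) ?_).le⟩
    have hsub : Icc t₀ t ⊆ J := fun s hs => hJt hs.1
    have := le_max_of_decrease hmono h1 h2 (fun x hx => (hmη x hx).1) hγ
      (hmono _ _ _ _ htr hsub) (fun s hs => hWN (hmem s (hsub hs) hs.1))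
      (show V (y t₀) ≤ m + m by linarith [h3.1]) le_rfl (right_mem_Icc.2 ht)
    linarith
  · intro ε hε
    obtain ⟨m, hm0, η, hη, γ, hγ, om₀, hom₀, hmV₀, hmV₁, hmε, hmη, hom⟩ := key ε hε
    obtain ⟨K, hK⟩ := exists_nat_gt (V₀ / γ)
    have hKpos : (0 : ℝ) < K := lt_trans (by positivity) hK
    rw [div_lt_iff₀ hγ] at hK
    refine ⟨om₀, hom₀, K, hKpos, fun om hom' t₀ J y hPy hyW hyV => ?_⟩
    obtain ⟨hJ, ht₀, htr, hyc⟩ := hP _ _ _ _ hPy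
    obtain ⟨h1, h2⟩ := hom om hom'
    have hmem : ∀ t ∈ J, t₀ ≤ t → y t ∈ W := fun t ht ht0 =>
      mem_of_decrease hmono h1 h2 (fun x hx => (hmη x hx).1) hγ hJ ht₀ htr hyc hW hN hWN hWV
        hyV (by linarith) (by linarith) hyW ht ht0
    have hJt := hesc om (by linarith) t₀ J y hPy fun t ht ht0 => hWN (hmem t ht ht0)
    refine ⟨fun t ht => ⟨hJt ht, hWN (hmem t (hJt ht) ht)⟩, fun t ht => ?_⟩
    have htt : t₀ ≤ t := by linarith
    refine (hmε _ (hWN (hmem t (hJt htt) htt)) ?_).le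
    have := le_of_decrease_of_large_time hmono h1 h2 (fun x hx => (hmη x hx).1) hγ
      (hmono _ _ _ _ htr hJt) (fun s hs => hWN (hmem s (hJt hs) hs)) hVnn hm0.le
      (lt_of_le_of_lt hyV hK) ht
    linarith

end

end ExtremumSeeking
end

noncomputable section

namespace ExtremumSeeking

/-! ### Maximal solutions -/

section MaximalSolutions

variable {M 𝔼 : Type*} [NormedAddCommGroup 𝔼] [NormedSpace ℝ 𝔼] {Φ : M → 𝔼} {f : ℝ → M → 𝔼}
  {J : Set ℝ} {x : ℝ → M} {t₀ : ℝ}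

theorem IsSolutionOn.mono (h : IsSolutionOn Φ f J x) {J' : Set ℝ} (hJ : J' ⊆ J) :
    IsSolutionOn Φ f J' x :=
  ⟨fun s hs t ht => h.1 s (hJ hs) t (hJ ht), fun s hs t ht => h.2 s (hJ hs) t (hJ ht)⟩

theorem isSolutionOn_of_base
    (h : ∀ t ∈ J, IntervalIntegrable (fun τ => f τ (x τ)) volume t₀ t ∧
      Φ (x t) - Φ (x t₀) = ∫ τ in t₀..t, f τ (x τ)) : IsSolutionOn Φ f J x := by
  refine ⟨fun s hs t ht => (h s hs).1.symm.trans (h t ht).1, fun s hs t ht => ?_⟩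
  rw [← intervalIntegral.integral_add_adjacent_intervals (h s hs).1.symm (h t ht).1,
    intervalIntegral.integral_symm, ← (h s hs).2, ← (h t ht).2]
  abel

theorem IsSolutionOn.base_congr {x' : ℝ → M} (hJ : J.OrdConnected) (h : IsSolutionOn Φ f J x)
    (ht₀ : t₀ ∈ J) (hx : EqOn x' x J) {t : ℝ} (ht : t ∈ J) :
    IntervalIntegrable (fun τ => f τ (x' τ)) volume t₀ t ∧
      Φ (x' t) - Φ (x' t₀) = ∫ τ in t₀..t, f τ (x' τ) := by
  have hsub : uIcc t₀ t ⊆ J := hJ.uIcc_subset ht₀ ht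
  have heq : EqOn (fun τ => f τ (x' τ)) (fun τ => f τ (x τ)) (uIcc t₀ t) := fun τ hτ => by
    simp only [hx (hsub hτ)]
  refine ⟨(h.1 t₀ ht₀ t ht).congr fun τ hτ => (heq (uIoc_subset_uIcc hτ)).symm, ?_⟩
  rw [intervalIntegral.integral_congr heq, hx ht, hx ht₀]
  exact h.2 t₀ ht₀ t ht

theorem IsSolutionOn.congr {x' : ℝ → M} (hJ : J.OrdConnected) (h : IsSolutionOn Φ f J x)
    (hx : EqOn x' x J) : IsSolutionOn Φ f J x' :=
  ⟨fun _ hs _ ht => (h.base_congr hJ hs hx ht).1, fun _ hs _ ht => (h.base_congr hJ hs hx ht).2⟩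

/-- If solutions of initial value problems are unique, then there is a solution which extends all
others. -/
theorem exists_isMaximalSolution
    (hU : ∀ (J : Set ℝ) (x x' : ℝ → M) (t₀ : ℝ), J.OrdConnected → t₀ ∈ J →
      IsSolutionOn Φ f J x → IsSolutionOn Φ f J x' → x t₀ = x' t₀ → EqOn x x' J)
    (t₀ : ℝ) (x₀ : M) :
    ∃ J x, IsMaximalSolution Φ f t₀ x₀ J x ∧ ∀ J' x', J'.OrdConnected → t₀ ∈ J' → x' t₀ = x₀ →
      IsSolutionOn Φ f J' x' → J' ⊆ J ∧ EqOn x' x J' := by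
  classical
  set 𝒥 : Set (Set ℝ × (ℝ → M)) := {p | p.1.OrdConnected ∧ t₀ ∈ p.1 ∧ p.2 t₀ = x₀ ∧
    IsSolutionOn Φ f p.1 p.2} with h𝒥
  have hne : (({t₀}, fun _ => x₀) : Set ℝ × (ℝ → M)) ∈ 𝒥 := by
    refine ⟨ordConnected_singleton, rfl, rfl, ⟨?_, ?_⟩⟩ <;>
    · rintro s rfl t rfl
      simp
  have huniq : ∀ p ∈ 𝒥, ∀ q ∈ 𝒥, EqOn p.2 q.2 (p.1 ∩ q.1) := fun p hp q hq =>
    hU _ _ _ t₀ (hp.1.inter hq.1) ⟨hp.2.1, hq.2.1⟩ (hp.2.2.2.mono inter_subset_left)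
      (hq.2.2.2.mono inter_subset_right) (hp.2.2.1.trans hq.2.2.1.symm)
  set J : Set ℝ := ⋃ p ∈ 𝒥, p.1 with hJ
  set x : ℝ → M := fun t => if h : ∃ p ∈ 𝒥, t ∈ p.1 then h.choose.2 t else x₀ with hx
  have hxp : ∀ p ∈ 𝒥, EqOn x p.2 p.1 := fun p hp t ht => by
    have h : ∃ p ∈ 𝒥, t ∈ p.1 := ⟨p, hp, ht⟩
    simp only [hx, dif_pos h]
    exact huniq _ h.choose_spec.1 _ hp ⟨h.choose_spec.2, ht⟩
  have hsubJ : ∀ p ∈ 𝒥, p.1 ⊆ J := fun p hp => subset_biUnion_of_mem (u := fun p => p.1) hp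
  have hJo : J.OrdConnected := by
    refine IsPreconnected.ordConnected ?_
    rw [hJ, biUnion_eq_iUnion]
    refine isPreconnected_iUnion ⟨t₀, mem_iInter.2 fun p => p.2.2.1⟩
      fun p => p.2.1.isPreconnected
  have hsol : IsSolutionOn Φ f J x := by
    refine isSolutionOn_of_base (t₀ := t₀) fun t ht => ?_
    obtain ⟨p, hp, htp⟩ := mem_iUnion₂.1 ht
    exact hp.2.2.2.base_congr hp.1 hp.2.1 (hxp p hp) htp
  have hall : ∀ J' x', J'.OrdConnected → t₀ ∈ J' → x' t₀ = x₀ →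
      IsSolutionOn Φ f J' x' → J' ⊆ J ∧ EqOn x' x J' := fun J' x' h1 h2 h3 h4 =>
    ⟨hsubJ (J', x') ⟨h1, h2, h3, h4⟩, (hxp (J', x') ⟨h1, h2, h3, h4⟩).symm⟩
  have hx₀ : x t₀ = x₀ := hxp _ hne rfl
  have ht₀ : t₀ ∈ J := hsubJ _ hne rfl
  exact ⟨J, x, ⟨hJo, ht₀, hx₀, hsol, fun J' x' h1 h2 h3 h4 =>
    (hall J' x' h1 (h2 ht₀) ((h3 ht₀).trans hx₀) h4).1.antisymm h2⟩, hall⟩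

theorem hasUniqueMaximalSolutions_of_unique
    (hU : ∀ (J : Set ℝ) (x x' : ℝ → M) (t₀ : ℝ), J.OrdConnected → t₀ ∈ J →
      IsSolutionOn Φ f J x → IsSolutionOn Φ f J x' → x t₀ = x' t₀ → EqOn x x' J) :
    HasUniqueMaximalSolutions Φ f := fun t₀ x₀ => by
  obtain ⟨J, x, hJx, hall⟩ := exists_isMaximalSolution hU t₀ x₀
  have h : ∀ J' x', IsMaximalSolution Φ f t₀ x₀ J' x' → J' = J ∧ EqOn x' x J' :=
    fun J' x' h => by
      obtain ⟨h1, h2⟩ := hall J' x' h.1 h.2 h.3 h.4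
      exact ⟨(h.5 J x hJx.1 h1 h2.symm hJx.4).symm, h2⟩
  refine ⟨⟨J, x, hJx⟩, fun J₁ x₁ J₂ x₂ h1 h2 => ?_⟩
  obtain ⟨rfl, h3⟩ := h _ _ h1
  obtain ⟨rfl, h4⟩ := h _ _ h2
  exact ⟨rfl, h3.trans h4.symm⟩

end MaximalSolutions

/-! ### Integral equations and derivatives on order-connected sets -/

section IntegralEquations

variable {𝔼 : Type*} [NormedAddCommGroup 𝔼] [NormedSpace ℝ 𝔼] {J : Set ℝ}

theorem _root_.Set.OrdConnected.exists_Icc_mem_nhdsWithin (hJ : J.OrdConnected) {t : ℝ}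
    (ht : t ∈ J) : ∃ a b, t ∈ Icc a b ∧ Icc a b ⊆ J ∧ Icc a b ∈ 𝓝[J] t := by
  obtain ⟨a, haJ, hat, ha⟩ : ∃ a ∈ J, a ≤ t ∧ J ∩ Ici a ∈ 𝓝[J] t := by
    by_cases h : ∃ a ∈ J, a < t
    · obtain ⟨a, ha, hat⟩ := h
      exact ⟨a, ha, hat.le, inter_mem self_mem_nhdsWithin
        (mem_nhdsWithin_of_mem_nhds (Ici_mem_nhds hat))⟩
    · push Not at h
      exact ⟨t, ht, le_rfl, mem_of_superset self_mem_nhdsWithin fun s hs => ⟨hs, h s hs⟩⟩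
  obtain ⟨b, hbJ, htb, hb⟩ : ∃ b ∈ J, t ≤ b ∧ J ∩ Iic b ∈ 𝓝[J] t := by
    by_cases h : ∃ b ∈ J, t < b
    · obtain ⟨b, hb, hbt⟩ := h
      exact ⟨b, hb, hbt.le, inter_mem self_mem_nhdsWithin
        (mem_nhdsWithin_of_mem_nhds (Iic_mem_nhds hbt))⟩
    · push Not at h
      exact ⟨t, ht, le_rfl, mem_of_superset self_mem_nhdsWithin fun s hs => ⟨hs, h s hs⟩⟩
  exact ⟨a, b, ⟨hat, htb⟩, hJ.out haJ hbJ, mem_of_superset (inter_mem ha hb)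
    fun s hs => ⟨hs.1.2, hs.2.2⟩⟩

theorem continuousOn_of_integral_eq (hJ : J.OrdConnected) {φ g : ℝ → 𝔼}
    (hg : ∀ s ∈ J, ∀ t ∈ J, IntervalIntegrable g volume s t)
    (h : ∀ s ∈ J, ∀ t ∈ J, φ t - φ s = ∫ τ in s..t, g τ) : ContinuousOn φ J := fun t ht => by
  obtain ⟨a, b, htab, hsub, hnhds⟩ := hJ.exists_Icc_mem_nhdsWithin ht
  have hab : a ≤ b := htab.1.trans htab.2
  have ha : a ∈ J := hsub (left_mem_Icc.2 hab)
  have hc : ContinuousOn (fun s => φ a + ∫ τ in a..s, g τ) (Icc a b) := by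
    refine continuousOn_const.add ?_
    have := intervalIntegral.continuousOn_primitive_interval' (a := a) (b₁ := a) (b₂ := b)
      (hg a ha b (hsub (right_mem_Icc.2 hab))) left_mem_uIcc
    rwa [uIcc_of_le hab] at this
  have hc' : ContinuousOn φ (Icc a b) := hc.congr fun s hs => by
    change φ s = φ a + ∫ τ in a..s, g τ
    rw [← h a ha s (hsub hs)]
    abel
  exact (hc' t htab).mono_of_mem_nhdsWithin hnhds

theorem hasDerivWithinAt_of_integral_eq [CompleteSpace 𝔼] (hJ : J.OrdConnected) {φ g : ℝ → 𝔼}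
    (hg : ContinuousOn g J) (h : ∀ s ∈ J, ∀ t ∈ J, φ t - φ s = ∫ τ in s..t, g τ) {t : ℝ}
    (ht : t ∈ J) : HasDerivWithinAt φ (g t) J t := by
  obtain ⟨a, b, htab, hsub, hnhds⟩ := hJ.exists_Icc_mem_nhdsWithin ht
  have hab : a ≤ b := htab.1.trans htab.2
  have ha : a ∈ J := hsub (left_mem_Icc.2 hab)
  set G : ℝ → 𝔼 := IccExtend hab ((Icc a b).domRestrict g) with hG
  have hGc : Continuous G := (hg.mono hsub).domRestrict.Icc_extend'
  have hGg : EqOn G g (Icc a b) := fun s hs => by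
    rw [hG, IccExtend_of_mem _ _ hs, domRestrict_apply]
  have hd : HasDerivAt (fun s => φ a + ∫ τ in a..s, G τ) (G t) t :=
    (intervalIntegral.integral_hasDerivAt_right (hGc.intervalIntegrable _ _)
      hGc.stronglyMeasurable.stronglyMeasurableAtFilter hGc.continuousAt).const_add _
  rw [hGg htab] at hd
  refine (hd.hasDerivWithinAt.congr (s := Icc a b) (fun s hs => ?_) ?_).mono_of_mem_nhdsWithin
    hnhds
  all_goals
    first
    | rw [intervalIntegral.integral_congr (g := g)
        fun τ hτ => hGg ((uIcc_subset_Icc (left_mem_Icc.2 hab) hs) hτ), ← h a ha s (hsub hs)]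
    | rw [intervalIntegral.integral_congr (g := g)
        fun τ hτ => hGg ((uIcc_subset_Icc (left_mem_Icc.2 hab) htab) hτ), ← h a ha t ht]
    abel

theorem integral_eq_of_hasDerivWithinAt [CompleteSpace 𝔼] (hJ : J.OrdConnected) {φ g : ℝ → 𝔼}
    (hφ : ∀ t ∈ J, HasDerivWithinAt φ (g t) J t) {s t : ℝ} (hs : s ∈ J) (ht : t ∈ J)
    (hg : IntervalIntegrable g volume s t) : φ t - φ s = ∫ τ in s..t, g τ := by
  have hsub : uIcc s t ⊆ J := hJ.uIcc_subset hs ht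
  refine (intervalIntegral.integral_eq_sub_of_hasDeriv_right
    (fun τ hτ => ((hφ τ (hsub hτ)).continuousWithinAt).mono hsub) (fun τ hτ => ?_) hg).symm
  have hnhds : J ∈ 𝓝 τ := mem_of_superset (Ioo_mem_nhds hτ.1 hτ.2)
    (Ioo_subset_Icc_self.trans hsub)
  exact ((hφ τ (mem_of_mem_nhds hnhds)).hasDerivAt hnhds).hasDerivWithinAt

end IntegralEquations

/-! ### Locally Lipschitz differential equations on isometrically embedded spaces -/

section LocallyLipschitzODE

variable {Y 𝔼 : Type*} [MetricSpace Y] [NormedAddCommGroup 𝔼] [NormedSpace ℝ 𝔼]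
  [CompleteSpace 𝔼] {Φ : Y → 𝔼} {F : ℝ → Y → 𝔼} {J : Set ℝ} {y : ℝ → Y}

omit [CompleteSpace 𝔼] in
theorem IsSolutionOn.continuousOn (hΦ : IsInducing Φ) (hJ : J.OrdConnected)
    (h : IsSolutionOn Φ F J y) : ContinuousOn y J :=
  hΦ.continuousOn_iff.2 (continuousOn_of_integral_eq hJ h.1 h.2)

theorem IsSolutionOn.hasDerivWithinAt (hΦ : Isometry Φ) (hF : Continuous (Function.uncurry F))
    (hJ : J.OrdConnected) (h : IsSolutionOn Φ F J y) {t : ℝ} (ht : t ∈ J) :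
    HasDerivWithinAt (Φ ∘ y) (F t (y t)) J t :=
  hasDerivWithinAt_of_integral_eq hJ (g := fun τ => F τ (y τ))
    (hF.comp_continuousOn (continuousOn_id.prodMk
      (h.continuousOn hΦ.isEmbedding.isInducing hJ))) h.2 ht

theorem isSolutionOn_of_hasDerivWithinAt (hΦ : IsInducing Φ)
    (hF : Continuous (Function.uncurry F)) (hJ : J.OrdConnected)
    (h : ∀ t ∈ J, HasDerivWithinAt (Φ ∘ y) (F t (y t)) J t) : IsSolutionOn Φ F J y := by
  have hy : ContinuousOn y J := hΦ.continuousOn_iff.2 fun t ht => (h t ht).continuousWithinAt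
  have hint : ∀ s ∈ J, ∀ t ∈ J, IntervalIntegrable (fun τ => F τ (y τ)) volume s t :=
    fun s hs t ht => ContinuousOn.intervalIntegrable
      (hF.comp_continuousOn (continuousOn_id.prodMk (hy.mono (hJ.uIcc_subset hs ht))))
  exact ⟨hint, fun s hs t ht => integral_eq_of_hasDerivWithinAt hJ h hs ht (hint s hs t ht)⟩

theorem IsSolutionOn.eqOn_of_locallyLipschitz (hΦ : Isometry Φ)
    (hF : Continuous (Function.uncurry F))
    (hL : ∀ N : Set Y, IsCompact N → ∃ K : NNReal, ∀ t, LipschitzOnWith K (F t) N)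
    {y' : ℝ → Y} {t₀ : ℝ} (hJ : J.OrdConnected) (ht₀ : t₀ ∈ J) (h : IsSolutionOn Φ F J y)
    (h' : IsSolutionOn Φ F J y') (heq : y t₀ = y' t₀) : EqOn y y' J := by
  have main : ∀ a ∈ J, ∀ b ∈ J, a ≤ b → (y a = y' a ∨ y b = y' b) → EqOn y y' (Icc a b) := by
    intro a ha b hb hab hor
    have : Nonempty Y := ⟨y a⟩
    have hsub : Icc a b ⊆ J := hJ.out ha hb
    have hyc := (h.continuousOn hΦ.isEmbedding.isInducing hJ).mono hsub
    have hyc' := (h'.continuousOn hΦ.isEmbedding.isInducing hJ).mono hsub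
    set N : Set Y := y '' Icc a b ∪ y' '' Icc a b with hN
    have hNc : IsCompact N := (isCompact_Icc.image_of_continuousOn hyc).union
      (isCompact_Icc.image_of_continuousOn hyc')
    obtain ⟨K, hK⟩ := hL N hNc
    have hinv : ∀ x, Function.invFun Φ (Φ x) = x := Function.leftInverse_invFun hΦ.injective
    set v : ℝ → 𝔼 → 𝔼 := fun t z => F t (Function.invFun Φ z) with hv
    have hvF : ∀ t x, v t (Φ x) = F t x := fun t x => by rw [hv]; simp only [hinv]
    have hvL : ∀ t, LipschitzOnWith K (v t) (Φ '' N) := by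
      rintro t _ ⟨x, hx, rfl⟩ _ ⟨x', hx', rfl⟩
      rw [hvF, hvF, hΦ.edist_eq]
      exact hK t hx hx'
    have hd : ∀ t ∈ Icc a b, HasDerivWithinAt (Φ ∘ y) (v t ((Φ ∘ y) t)) (Icc a b) t :=
      fun t ht => by
        rw [Function.comp_apply, hvF]
        exact (h.hasDerivWithinAt hΦ hF hJ (hsub ht)).mono hsub
    have hd' : ∀ t ∈ Icc a b, HasDerivWithinAt (Φ ∘ y') (v t ((Φ ∘ y') t)) (Icc a b) t :=
      fun t ht => by
        rw [Function.comp_apply, hvF]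
        exact (h'.hasDerivWithinAt hΦ hF hJ (hsub ht)).mono hsub
    have hm : ∀ t ∈ Icc a b, (Φ ∘ y) t ∈ Φ '' N := fun t ht =>
      mem_image_of_mem _ (Or.inl (mem_image_of_mem _ ht))
    have hm' : ∀ t ∈ Icc a b, (Φ ∘ y') t ∈ Φ '' N := fun t ht =>
      mem_image_of_mem _ (Or.inr (mem_image_of_mem _ ht))
    suffices EqOn (Φ ∘ y) (Φ ∘ y') (Icc a b) from fun t ht => hΦ.injective (this ht)
    rcases hor with hor | hor
    · refine ODE_solution_unique_of_mem_Icc_right (v := v) (s := fun _ => Φ '' N) (K := K)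
        (fun t _ => hvL t) (fun t ht => (hd t ht).continuousWithinAt) (fun t ht => ?_)
        (fun t ht => hm t (Ico_subset_Icc_self ht))
        (fun t ht => (hd' t ht).continuousWithinAt) (fun t ht => ?_)
        (fun t ht => hm' t (Ico_subset_Icc_self ht)) (congrArg Φ hor)
      · exact (hd t (Ico_subset_Icc_self ht)).mono_of_mem_nhdsWithin (Icc_mem_nhdsGE_of_mem ht)
      · exact (hd' t (Ico_subset_Icc_self ht)).mono_of_mem_nhdsWithin (Icc_mem_nhdsGE_of_mem ht)
    · refine ODE_solution_unique_of_mem_Icc_left (v := v) (s := fun _ => Φ '' N) (K := K)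
        (fun t _ => hvL t) (fun t ht => (hd t ht).continuousWithinAt) (fun t ht => ?_)
        (fun t ht => hm t (Ioc_subset_Icc_self ht))
        (fun t ht => (hd' t ht).continuousWithinAt) (fun t ht => ?_)
        (fun t ht => hm' t (Ioc_subset_Icc_self ht)) (congrArg Φ hor)
      · exact (hd t (Ioc_subset_Icc_self ht)).mono_of_mem_nhdsWithin (Icc_mem_nhdsLE_of_mem ht)
      · exact (hd' t (Ioc_subset_Icc_self ht)).mono_of_mem_nhdsWithin (Icc_mem_nhdsLE_of_mem ht)
  intro t ht
  rcases le_total t₀ t with hle | hle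
  · exact main t₀ ht₀ t ht hle (Or.inl heq) (right_mem_Icc.2 hle)
  · exact main t ht t₀ ht₀ hle (Or.inr heq) (left_mem_Icc.2 hle)

/-- Solutions have bounded speed in compact sets. -/
theorem IsSolutionOn.lipschitzOnWith (hΦ : Isometry Φ) (hF : Continuous (Function.uncurry F))
    (hJ : J.OrdConnected) (h : IsSolutionOn Φ F J y) {C : NNReal}
    (hC : ∀ t ∈ J, ‖F t (y t)‖ ≤ C) : LipschitzOnWith C y J := by
  have h1 : LipschitzOnWith C (Φ ∘ y) J :=
    Convex.lipschitzOnWith_of_nnnorm_hasDerivWithin_le hJ.convex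
      (fun t ht => h.hasDerivWithinAt hΦ hF hJ ht) fun t ht => hC t ht
  intro s hs t ht
  rw [← hΦ.edist_eq]
  exact h1 hs ht

/-- A maximal solution which stays in a compact set exists for all future times. -/
theorem IsMaximalSolution.Ici_subset (hΦ : Isometry Φ) (hF : Continuous (Function.uncurry F))
    (hloc : ∀ (t₀ : ℝ) (y₀ : Y), ∃ ε > 0, ∃ z : ℝ → Y, z t₀ = y₀ ∧
      IsSolutionOn Φ F (Icc t₀ (t₀ + ε)) z)
    {t₀ : ℝ} {y₀ : Y} (h : IsMaximalSolution Φ F t₀ y₀ J y) {N : Set Y} (hN : IsCompact N)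
    (hyN : ∀ t ∈ J, t₀ ≤ t → y t ∈ N) : Ici t₀ ⊆ J := by
  by_contra hcon
  obtain ⟨T, hT, hTJ⟩ := not_subset.1 hcon
  have ht₀ := h.mem
  have hbdd : BddAbove J := ⟨T, fun t ht => by
    by_contra! hlt
    exact hTJ (h.ordConnected.out ht₀ ht ⟨hT, hlt.le⟩)⟩
  set b := sSup J with hb
  have ht₀b : t₀ ≤ b := le_csSup hbdd ht₀
  have hJb : ∀ t ∈ J, t ≤ b := fun t ht => le_csSup hbdd ht
  have hIco : Ico t₀ b ⊆ J := fun t ht => by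
    obtain ⟨s, hs, hts⟩ := exists_lt_of_lt_csSup ⟨t₀, ht₀⟩ ht.2
    exact h.ordConnected.out ht₀ hs ⟨ht.1, hts.le⟩
  obtain ⟨yb, hybJ, hyb⟩ : ∃ yb : Y, (b ∈ J → yb = y b) ∧
      (b ∉ J → ContinuousOn (Function.update y b yb) (Icc t₀ b)) := by
    by_cases hbJ : b ∈ J
    · exact ⟨y b, fun _ => rfl, fun h => absurd hbJ h⟩
    have hlt : t₀ < b := lt_of_le_of_ne ht₀b fun h => hbJ (h ▸ ht₀)
    obtain ⟨C, hC⟩ := ((isCompact_Icc (a := t₀) (b := b)).prod hN).exists_bound_of_continuousOn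
      hF.continuousOn
    have hlip : LipschitzOnWith (Real.toNNReal C) y (Ico t₀ b) :=
      (h.solution.mono hIco).lipschitzOnWith hΦ hF ordConnected_Ico fun t ht =>
        (hC (t, y t) ⟨Ico_subset_Icc_self ht, hyN t (hIco ht) ht.1⟩).trans
          (Real.le_coe_toNNReal C)
    set s : ℕ → ℝ := fun k => b - (b - t₀) * (1 / (k + 1)) with hs
    have hsb : Tendsto s atTop (𝓝 b) := by
      have := (tendsto_one_div_add_atTop_nhds_zero_nat (𝕜 := ℝ)).const_mul (b - t₀)
      simpa [hs] using this.const_sub b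
    have hsm : ∀ k, s k ∈ Ico t₀ b := fun k => by
      have h1 : (0 : ℝ) < 1 / (k + 1) := Nat.one_div_pos_of_nat
      have h2 : (1 : ℝ) / (k + 1) ≤ 1 := by
        rw [div_le_one (by positivity)]
        linarith [k.cast_nonneg (α := ℝ)]
      constructor <;> simp only [hs] <;> nlinarith
    obtain ⟨yb, -, φ, hφ, hlim⟩ := hN.tendsto_subseq
      fun k => hyN (s k) (hIco (hsm k)) (hsm k).1
    have hdist : ∀ t ∈ Ico t₀ b, dist (y t) yb ≤ Real.toNNReal C * (b - t) := fun t ht => by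
      have h1 : Tendsto (fun k => dist (y t) (y (s (φ k)))) atTop (𝓝 (dist (y t) yb)) :=
        tendsto_const_nhds.dist hlim
      have h2 : Tendsto (fun k => (Real.toNNReal C : ℝ) * dist t (s (φ k))) atTop
          (𝓝 (Real.toNNReal C * dist t b)) :=
        (tendsto_const_nhds.dist (hsb.comp hφ.tendsto_atTop)).const_mul _
      have h3 := le_of_tendsto_of_tendsto' h1 h2 fun k => hlip.dist_le_mul t ht _ (hsm _)
      rwa [Real.dist_eq, abs_sub_comm, abs_of_pos (by linarith [ht.2])] at h3
    refine ⟨yb, fun h => absurd h hbJ, fun _ t ht => ?_⟩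
    rcases eq_or_lt_of_le ht.2 with htb | htb
    · rw [htb, continuousWithinAt_update_same, Icc_sdiff_right, tendsto_iff_dist_tendsto_zero]
      refine squeeze_zero' (Eventually.of_forall fun _ => dist_nonneg)
        (eventually_nhdsWithin_of_forall hdist) ?_
      have : Continuous fun τ : ℝ => (Real.toNNReal C : ℝ) * (b - τ) := by fun_prop
      exact (this.tendsto' b 0 (by simp)).mono_left nhdsWithin_le_nhds
    · have h1 : ContinuousWithinAt y (Icc t₀ b) t :=
        (hlip.continuousOn t ⟨ht.1, htb⟩).mono_of_mem_nhdsWithin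
          (mem_of_superset (inter_mem self_mem_nhdsWithin
            (mem_nhdsWithin_of_mem_nhds (Iio_mem_nhds htb))) fun τ hτ => ⟨hτ.1.1, hτ.2⟩)
      exact (continuousWithinAt_update_of_ne htb.ne).2 h1
  obtain ⟨ε, hε, z, hz, hzsol⟩ := hloc b yb
  set y₁ : ℝ → Y := fun t => if t < b then y t else z t with hy₁
  have hy₁y : EqOn y₁ y J := fun t ht => by
    rcases eq_or_lt_of_le (hJb t ht) with htb | htb
    · simp only [hy₁, htb, lt_irrefl, if_false, hz]
      exact hybJ (htb ▸ ht)
    · simp only [hy₁, htb, if_true]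
  have hy₁z : EqOn y₁ z (Ici b) := fun t ht => if_neg (not_lt.2 ht)
  have hJ' : (J ∪ Icc b (b + ε)).OrdConnected := by
    refine IsPreconnected.ordConnected ?_
    have h1 : J ∪ Icc b (b + ε) = J ∪ Icc t₀ (b + ε) := by
      refine subset_antisymm (union_subset_union_right _ (Icc_subset_Icc_left ht₀b)) ?_
      rintro t (ht | ht)
      · exact Or.inl ht
      · rcases lt_or_ge t b with h1 | h1
        · exact Or.inl (hIco ⟨ht.1, h1⟩)
        · exact Or.inr ⟨h1, ht.2⟩
    rw [h1]
    exact h.ordConnected.isPreconnected.union t₀ ht₀ (left_mem_Icc.2 (by linarith))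
      isPreconnected_Icc
  have hbase : IntervalIntegrable (fun τ => F τ (y₁ τ)) volume t₀ b ∧
      Φ (y₁ b) - Φ (y₁ t₀) = ∫ τ in t₀..b, F τ (y₁ τ) := by
    by_cases hbJ : b ∈ J
    · exact h.solution.base_congr h.ordConnected ht₀ hy₁y hbJ
    have hc : ContinuousOn y₁ (Icc t₀ b) := (hyb hbJ).congr fun t ht => by
      rcases eq_or_lt_of_le ht.2 with rfl | htb
      · simp only [hy₁, lt_irrefl, if_false, hz, Function.update_self]
      · simp only [hy₁, htb, if_true, Function.update_of_ne htb.ne]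
    have hint : IntervalIntegrable (fun τ => F τ (y₁ τ)) volume t₀ b := by
      refine ContinuousOn.intervalIntegrable ?_
      rw [uIcc_of_le ht₀b]
      exact hF.comp_continuousOn (continuousOn_id.prodMk hc)
    refine ⟨hint, (intervalIntegral.integral_eq_sub_of_hasDerivAt_of_le ht₀b
      (hΦ.continuous.comp_continuousOn hc) (fun t ht => ?_) hint).symm⟩
    have htJ : Ioo t₀ b ⊆ J := Ioo_subset_Ico_self.trans hIco
    have hnhds : J ∈ 𝓝 t := mem_of_superset (Ioo_mem_nhds ht.1 ht.2) htJ
    have h1 := (h.solution.congr h.ordConnected hy₁y).hasDerivWithinAt hΦ hF h.ordConnected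
      (htJ ht)
    exact h1.hasDerivAt hnhds
  have hsol : IsSolutionOn Φ F (J ∪ Icc b (b + ε)) y₁ := by
    refine isSolutionOn_of_base (t₀ := t₀) ?_
    rintro t (ht | ht)
    · exact h.solution.base_congr h.ordConnected ht₀ hy₁y ht
    · obtain ⟨h1, h2⟩ := hzsol.base_congr ordConnected_Icc (left_mem_Icc.2 (by linarith))
        (fun s hs => hy₁z hs.1) ht
      refine ⟨hbase.1.trans h1, ?_⟩
      rw [← intervalIntegral.integral_add_adjacent_intervals hbase.1 h1, ← h2, ← hbase.2]
      abel
  have hmax := h.maximal _ _ hJ' subset_union_left hy₁y hsol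
  have : b + ε ∈ J := by
    rw [← hmax]
    exact Or.inr (right_mem_Icc.2 (by linarith))
  linarith [hJb _ this]

end LocallyLipschitzODE

end ExtremumSeeking
end

noncomputable section

namespace ExtremumSeeking

/-! ### Smooth functions on the Lie group -/

section LieGroupCalculus

variable {n N : ℕ} {G : Type*} [TopologicalSpace G] [ChartedSpace (EuclideanSpace ℝ (Fin n)) G]
  [Group G] {F : Type*} [NormedAddCommGroup F] [NormedSpace ℝ F]

namespace MechanicalSystem

/-- A smooth function on a submanifold extends locally to a smooth function on the ambient
space. -/
theorem exists_contDiffAt_extension (S : MechanicalSystem n N G) {m : ℕ∞} {f : G → F} {g₀ : G}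
    (hf : ContMDiffAt (𝓡 n) 𝓘(ℝ, F) m f g₀) :
    ∃ fe : EuclideanSpace ℝ (Fin N) → F, ContDiffAt ℝ m fe (S.ι g₀) ∧
      ∀ᶠ g in 𝓝 g₀, fe (S.ι g) = f g := by
  set h := S.ι_embedding.isImmersion.isImmersionAt g₀ with hh
  have hm : (m : ℕ∞ω) ≤ ∞ := WithTop.coe_le_coe.2 le_top
  have hkey : ∀ g ∈ h.domChart.source, (h.equiv.symm (h.codChart (S.ι g))).1 = h.domChart g := by
    intro g hg
    have hmem : h.domChart g ∈ (h.domChart.extend (𝓡 n)).target := by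
      simpa using h.domChart.map_source hg
    have h1 := h.writtenInCharts hmem
    simp only [Function.comp_apply, OpenPartialHomeomorph.extend_coe,
      OpenPartialHomeomorph.extend_coe_symm, modelWithCornersSelf_coe,
      modelWithCornersSelf_coe_symm, id_eq, h.domChart.left_inv hg] at h1
    rw [h1]
    simp
  set fe : EuclideanSpace ℝ (Fin N) → F :=
    fun z => f (h.domChart.symm (h.equiv.symm (h.codChart z)).1) with hfe
  have hfeq : ∀ g ∈ h.domChart.source, fe (S.ι g) = f g := fun g hg => by
    simp only [hfe]
    rw [hkey g hg, h.domChart.left_inv hg]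
  refine ⟨fe, ?_, mem_of_superset (h.domChart.open_source.mem_nhds h.mem_domChart_source) hfeq⟩
  rw [← contMDiffAt_iff_contDiffAt]
  have h1 : ContMDiffAt 𝓘(ℝ, EuclideanSpace ℝ (Fin N)) 𝓘(ℝ, EuclideanSpace ℝ (Fin N)) m
      h.codChart (S.ι g₀) :=
    ((contMDiffOn_of_mem_maximalAtlas h.codChart_mem_maximalAtlas).contMDiffAt
      (h.codChart.open_source.mem_nhds h.mem_codChart_source)).of_le hm
  have h2 : ContMDiffAt (𝓡 n) (𝓡 n) m h.domChart.symm (h.domChart g₀) :=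
    ((contMDiffOn_symm_of_mem_maximalAtlas h.domChart_mem_maximalAtlas).contMDiffAt
      (h.domChart.open_target.mem_nhds (h.domChart.map_source h.mem_domChart_source))).of_le hm
  have h3 : ContMDiffAt 𝓘(ℝ, EuclideanSpace ℝ (Fin N)) (𝓡 n) m
      (fun z => (h.equiv.symm (h.codChart z)).1) (S.ι g₀) := by
    have : ContDiff ℝ m fun z => (h.equiv.symm z).1 :=
      contDiff_fst.comp h.equiv.symm.contDiff
    exact this.contMDiff.contMDiffAt.comp _ h1
  have h4 : ContMDiffAt 𝓘(ℝ, EuclideanSpace ℝ (Fin N)) (𝓡 n) m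
      (fun z => h.domChart.symm (h.equiv.symm (h.codChart z)).1) (S.ι g₀) :=
    ContMDiffAt.comp_of_eq h2 h3 (hkey g₀ h.mem_domChart_source)
  refine ContMDiffAt.comp_of_eq hf h4 ?_
  rw [hkey g₀ h.mem_domChart_source, h.domChart.left_inv h.mem_domChart_source]

/-- The chain rule along curves which are differentiable in the ambient space. -/
theorem hasDerivWithinAt_comp (S : MechanicalSystem n N G) {f : G → F} {γ : ℝ → G} {J : Set ℝ}
    {t : ℝ} (hf : ContMDiffAt (𝓡 n) 𝓘(ℝ, F) 1 f (γ t)) {X : TangentSpace (𝓡 n) (γ t)}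
    (hγ : HasDerivWithinAt (S.ι ∘ γ) (S.dι (γ t) X) J t) :
    HasDerivWithinAt (f ∘ γ) (mvfderiv (𝓡 n) f (γ t) X) J t := by
  obtain ⟨fe, hfe, heq⟩ := S.exists_contDiffAt_extension hf
  have hd : DifferentiableAt ℝ fe (S.ι (γ t)) := hfe.differentiableAt (by simp)
  have hιd : MDifferentiableAt (𝓡 n) 𝓘(ℝ, EuclideanSpace ℝ (Fin N)) S.ι (γ t) :=
    S.ι_embedding.contMDiff.contMDiffAt.mdifferentiableAt (by simp)
  have h1 : mvfderiv (𝓡 n) f (γ t) X = fderiv ℝ fe (S.ι (γ t)) (S.dι (γ t) X) := by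
    have h2 : mfderiv (𝓡 n) 𝓘(ℝ, F) (fe ∘ S.ι) (γ t) = mfderiv (𝓡 n) 𝓘(ℝ, F) f (γ t) :=
      Filter.EventuallyEq.mfderiv_eq heq
    have h3 := mfderiv_comp (γ t) (I' := 𝓘(ℝ, EuclideanSpace ℝ (Fin N)))
      hd.mdifferentiableAt hιd
    rw [h3, mfderiv_eq_fderiv] at h2
    exact (congrArg (fun A => A X) h2).symm
  rw [h1]
  have hc : ContinuousWithinAt γ J t :=
    S.ι_embedding.isEmbedding.isInducing.continuousWithinAt_iff.2 hγ.continuousWithinAt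
  have h2 : HasDerivWithinAt (fe ∘ (S.ι ∘ γ)) (fderiv ℝ fe (S.ι (γ t)) (S.dι (γ t) X)) J t :=
    hd.hasFDerivAt.comp_hasDerivWithinAt t hγ
  exact h2.congr_of_eventuallyEq ((hc.eventually heq).mono fun s hs => hs.symm)
    (heq.self_of_nhds).symm

/-- Continuously differentiable functions on a submanifold are locally Lipschitz for the ambient
distance. -/
theorem exists_lipschitz (S : MechanicalSystem n N G) {f : G → F} {g₀ : G}
    (hf : ContMDiffAt (𝓡 n) 𝓘(ℝ, F) 1 f g₀) :
    ∃ K : NNReal, ∃ W ∈ 𝓝 g₀, ∀ g ∈ W, ∀ g' ∈ W, edist (f g) (f g') ≤ K * edist (S.ι g) (S.ι g') := by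
  obtain ⟨fe, hfe, heq⟩ := S.exists_contDiffAt_extension hf
  obtain ⟨K, s, hs, hK⟩ := hfe.exists_lipschitzOnWith
  refine ⟨K, _, inter_mem heq
    (S.ι_embedding.contMDiff.continuous.continuousAt.preimage_mem_nhds hs), ?_⟩
  rintro g ⟨hg, hgs⟩ g' ⟨hg', hgs'⟩
  rw [← hg, ← hg']
  exact hK hgs hgs'

variable [LieGroup (𝓡 n) ∞ G]

omit [LieGroup (𝓡 n) ∞ G] in
theorem mvfderiv_tangentLeft [LieGroup (𝓡 n) ∞ G] {f : G → F} {g : G}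
    (hf : MDifferentiableAt (𝓡 n) 𝓘(ℝ, F) f g) (v : LieAlg n G) :
    mvfderiv (𝓡 n) f g (tangentLeft g v)
      = mfderiv (𝓡 n) 𝓘(ℝ, F) (fun k => f (g * k)) (1 : G) v := by
  have hd : MDifferentiableAt (𝓡 n) (𝓡 n) (fun k : G => g * k) 1 :=
    (contMDiff_mul_left (I := 𝓡 n) (n := ∞)).contMDiffAt.mdifferentiableAt (by simp)
  have h := mfderiv_comp_of_eq (x := (1 : G)) (y := g) (I' := 𝓡 n) hf hd (mul_one g)
  have h' : mfderiv (𝓡 n) 𝓘(ℝ, F) (fun k => f (g * k)) (1 : G)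
    = (mfderiv (𝓡 n) 𝓘(ℝ, F) f (g * 1)).comp (mfderiv (𝓡 n) (𝓡 n) (fun k : G => g * k) 1) := h
  rw [h']
  have h2 : ∀ g' : G, g' = g → ∀ w : EuclideanSpace ℝ (Fin n),
      (mfderiv (𝓡 n) 𝓘(ℝ, F) f g : EuclideanSpace ℝ (Fin n) →L[ℝ] F) w =
        (mfderiv (𝓡 n) 𝓘(ℝ, F) f g' : EuclideanSpace ℝ (Fin n) →L[ℝ] F) w := by
    rintro _ rfl w
    rfl
  exact h2 (g * 1) (mul_one g) _

/-- The derivative of a smooth function along a left-invariant vector field is continuously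
differentiable. -/
theorem contMDiffAt_mvfderiv_tangentLeft {f : G → F} {g₀ : G}
    (hf : ContMDiffAt (𝓡 n) 𝓘(ℝ, F) ∞ f g₀) (v : LieAlg n G) :
    ContMDiffAt (𝓡 n) 𝓘(ℝ, F) 1 (fun g => mvfderiv (𝓡 n) f g (tangentLeft g v)) g₀ := by
  have hu : ContMDiffAt ((𝓡 n).prod (𝓡 n)) 𝓘(ℝ, F) ∞
      (Function.uncurry fun g k : G => f (g * k)) (g₀, 1) := by
    refine ContMDiffAt.comp_of_eq (g := f) (y := g₀) hf
      (contMDiff_mul (𝓡 n) ∞).contMDiffAt (mul_one g₀)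
  have hman : IsManifold (𝓡 n) ∞ G := inferInstance
  have : IsManifold (𝓡 n) 1 G := inferInstance
  let w : EuclideanSpace ℝ (Fin n) := v
  have h := ContMDiffAt.mfderiv_apply (m := 1) (fun g k : G => f (g * k)) (fun _ => (1 : G)) id
    (fun _ => w) (x₀ := g₀) hu contMDiffAt_const contMDiffAt_id
    (contMDiffAt_const (I := 𝓡 n)) (by
      rw [one_add_one_eq_two]
      exact WithTop.coe_le_coe.2 (le_top : (2 : ℕ∞) ≤ ⊤))
  refine h.congr_of_eventuallyEq ?_
  have hf1 : ContMDiffAt (𝓡 n) 𝓘(ℝ, F) 1 f g₀ :=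
    hf.of_le (WithTop.coe_le_coe.2 (le_top : (1 : ℕ∞) ≤ ⊤))
  have hev : ∀ᶠ g in 𝓝 g₀, ContMDiffAt (𝓡 n) 𝓘(ℝ, F) 1 f g :=
    (contMDiffAt_iff_contMDiffAt_nhds (by simp)).1 hf1
  filter_upwards [hev] with g hg
  have e := inTangentCoordinates_eq (I := 𝓡 n) (I' := 𝓘(ℝ, F)) (fun _ : G => (1 : G))
    (fun x : G => f (x * 1)) (fun x => mfderiv (𝓡 n) 𝓘(ℝ, F) (fun k : G => f (x * k)) 1)
    (x₀ := g₀) (x := g) (by simp)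
    (by rw [chartAt_self_eq]; exact mem_univ _)
  rw [TangentBundle.coordChange_model_space] at e
  have e2 := congrArg (fun A : EuclideanSpace ℝ (Fin n) →L[ℝ] F => A w) e
  refine (mvfderiv_tangentLeft (hg.mdifferentiableAt (by simp)) v).trans (Eq.trans ?_ e2.symm)
  have e3 : (tangentBundleCore (𝓡 n) G).coordChange (achart _ (1 : G)) (achart _ (1 : G)) 1 w = w :=
    (tangentBundleCore (𝓡 n) G).coordChange_self _ _ (mem_achart_source _ _) _
  exact (congrArg (fun z : EuclideanSpace ℝ (Fin n) =>
    (mfderiv (𝓡 n) 𝓘(ℝ, F) (fun k : G => f (g * k)) 1 : EuclideanSpace ℝ (Fin n) →L[ℝ] F) z)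
    e3).symm

omit [LieGroup (𝓡 n) ∞ G] in
/-- In local coordinates, left-invariant vector fields are continuously differentiable. -/
theorem exists_chart [LieGroup (𝓡 n) ∞ G] (S : MechanicalSystem n N G) (v : Fin n → LieAlg n G)
    (g₀ : G) :
    ∃ (σ : EuclideanSpace ℝ (Fin n) → G) (u₀ : EuclideanSpace ℝ (Fin n))
      (b : Fin n → EuclideanSpace ℝ (Fin n) → EuclideanSpace ℝ (Fin n)), σ u₀ = g₀ ∧
      (∀ i, ContDiffAt ℝ 1 (b i) u₀) ∧ ContDiffAt ℝ 1 (S.ι ∘ σ) u₀ ∧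
      ∀ᶠ u in 𝓝 u₀, ∃ A : EuclideanSpace ℝ (Fin n) →L[ℝ] EuclideanSpace ℝ (Fin N),
        HasFDerivAt (S.ι ∘ σ) A u ∧ ∀ i, A (b i u) = S.dι (σ u) (tangentLeft (σ u) (v i)) := by
  have hman : IsManifold (𝓡 n) ∞ G := inferInstance
  have : IsManifold (𝓡 n) 1 G := inferInstance
  set φ := extChartAt (𝓡 n) g₀ with hφ
  have hσ : ∀ u ∈ φ.target, ContMDiffAt (𝓡 n) (𝓡 n) ∞ φ.symm u := fun u hu =>
    (contMDiffOn_extChartAt_symm g₀).contMDiffAt ((isOpen_extChartAt_target g₀).mem_nhds hu)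
  have hu₀ : φ g₀ ∈ φ.target := mem_extChartAt_target g₀
  have hσ₀ : φ.symm (φ g₀) = g₀ := extChartAt_to_inv g₀
  refine ⟨φ.symm, φ g₀, fun i u => mvfderiv (𝓡 n) φ (φ.symm u) (tangentLeft (φ.symm u) (v i)),
    hσ₀, fun i => ?_, ?_, ?_⟩
  · rw [← contMDiffAt_iff_contDiffAt]
    exact ContMDiffAt.comp_of_eq
      (contMDiffAt_mvfderiv_tangentLeft (contMDiffAt_extChartAt (n := ∞)) (v i))
      ((hσ _ hu₀).of_le (WithTop.coe_le_coe.2 (le_top : (1 : ℕ∞) ≤ ⊤))) hσ₀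
  · rw [← contMDiffAt_iff_contDiffAt]
    exact (S.ι_embedding.contMDiff.contMDiffAt.comp _ (hσ _ hu₀)).of_le
      (WithTop.coe_le_coe.2 (le_top : (1 : ℕ∞) ≤ ⊤))
  · filter_upwards [(isOpen_extChartAt_target g₀).mem_nhds hu₀] with u hu
    have hs : φ.symm u ∈ φ.source := φ.map_target hu
    have hσd : MDifferentiableAt (𝓡 n) (𝓡 n) φ.symm u := (hσ u hu).mdifferentiableAt (by simp)
    have hιd : MDifferentiableAt (𝓡 n) 𝓘(ℝ, EuclideanSpace ℝ (Fin N)) S.ι (φ.symm u) :=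
      S.ι_embedding.contMDiff.contMDiffAt.mdifferentiableAt (by simp)
    have hφd : MDifferentiableAt (𝓡 n) 𝓘(ℝ, EuclideanSpace ℝ (Fin n)) φ (φ.symm u) :=
      (contMDiffAt_extChartAt' (n := ∞) (by rwa [← extChartAt_source (𝓡 n)])).mdifferentiableAt
        (by simp)
    have hcomp := (hιd.comp u hσd)
    refine ⟨mfderiv (𝓡 n) 𝓘(ℝ, EuclideanSpace ℝ (Fin N)) (S.ι ∘ φ.symm) u, ?_, fun i => ?_⟩
    · rw [mfderiv_eq_fderiv]
      exact (mdifferentiableAt_iff_differentiableAt.1 hcomp).hasFDerivAt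
    · set X : TangentSpace (𝓡 n) (φ.symm u) := tangentLeft (φ.symm u) (v i) with hX
      have h1 : mfderiv (𝓡 n) (𝓡 n) (φ.symm ∘ φ) (φ.symm u) = ContinuousLinearMap.id ℝ _ := by
        rw [← mfderiv_id]
        refine Filter.EventuallyEq.mfderiv_eq ?_
        filter_upwards [(isOpen_extChartAt_source g₀).mem_nhds hs] with g hg
        exact φ.left_inv hg
      have h2 := mfderiv_comp_of_eq (x := φ.symm u) (y := u) (I' := 𝓡 n) hσd hφd
        (φ.right_inv hu)
      rw [h1] at h2
      have h3 := mfderiv_comp u (I' := 𝓡 n) hιd hσd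
      rw [h3]
      have h4 := congrArg (fun A : EuclideanSpace ℝ (Fin n) →L[ℝ] EuclideanSpace ℝ (Fin n) =>
        A X) h2
      have h5 : ∀ u' : EuclideanSpace ℝ (Fin n), u' = u → ∀ w : EuclideanSpace ℝ (Fin n),
        (mfderiv (𝓡 n) (𝓡 n) φ.symm u' : EuclideanSpace ℝ (Fin n) →L[ℝ] EuclideanSpace ℝ (Fin n)) w
        = (mfderiv (𝓡 n) (𝓡 n) φ.symm u :
            EuclideanSpace ℝ (Fin n) →L[ℝ] EuclideanSpace ℝ (Fin n)) w := by
        rintro _ rfl w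
        rfl
      have h6 := h4.trans (h5 _ (φ.right_inv hu) _)
      exact congrArg (fun w : EuclideanSpace ℝ (Fin n) =>
        (mfderiv (𝓡 n) 𝓘(ℝ, EuclideanSpace ℝ (Fin N)) S.ι (φ.symm u) :
          EuclideanSpace ℝ (Fin n) →L[ℝ] EuclideanSpace ℝ (Fin N)) w) h6.symm

end MechanicalSystem

end LieGroupCalculus

end ExtremumSeeking
end

noncomputable section

namespace ExtremumSeeking

/-! ### Functions which are Lipschitz near a point -/

section LipschitzNear

variable {α β γ : Type*} [PseudoEMetricSpace α] [PseudoEMetricSpace β] [PseudoEMetricSpace γ]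

/-- `f` is Lipschitz on a neighborhood of `x`. -/
def LipschitzNear (f : α → β) (x : α) : Prop := ∃ K, ∃ t ∈ 𝓝 x, LipschitzOnWith K f t

theorem LipschitzNear.continuousAt {f : α → β} {x : α} (hf : LipschitzNear f x) :
    ContinuousAt f x := by
  obtain ⟨K, t, ht, h⟩ := hf
  exact (h.continuousOn).continuousAt ht

theorem LipschitzNear.comp {g : β → γ} {f : α → β} {x : α} (hg : LipschitzNear g (f x))
    (hf : LipschitzNear f x) : LipschitzNear (g ∘ f) x := by
  have hc := hf.continuousAt
  obtain ⟨K, t, ht, h⟩ := hf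
  obtain ⟨K', t', ht', h'⟩ := hg
  exact ⟨K' * K, t ∩ f ⁻¹' t', inter_mem ht (hc.preimage_mem_nhds ht'),
    h'.comp (h.mono inter_subset_left) fun _ hy => hy.2⟩

theorem LipschitzNear.prodMk {f : α → β} {g : α → γ} {x : α} (hf : LipschitzNear f x)
    (hg : LipschitzNear g x) : LipschitzNear (fun y => (f y, g y)) x := by
  obtain ⟨K, t, ht, h⟩ := hf
  obtain ⟨K', t', ht', h'⟩ := hg
  exact ⟨max K K', t ∩ t', inter_mem ht ht',
    (h.mono inter_subset_left).prodMk (h'.mono inter_subset_right)⟩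

end LipschitzNear

/-! ### The reduced system -/

/-- A trivialized mechanical system on a metric space `X`, isometrically realized as a closed subset
of a Euclidean space, in which `D x ξ` is the velocity at `x` of body velocity `ξ`, together with a
control law. -/
structure ReducedSystem (n N : ℕ) (X : Type*) [MetricSpace X] where
  ι : X → EuclideanSpace ℝ (Fin N)
  ι_isometry : Isometry ι
  ι_closed : IsClosed (range ι)
  D : X → EuclideanSpace ℝ (Fin n) →L[ℝ] EuclideanSpace ℝ (Fin N)
  D_lip : LocallyLipschitz D
  D_injective : ∀ x, Function.Injective (D x)
  ψ : X → ℝ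
  ψ_lip : LocallyLipschitz ψ
  p : X → EuclideanSpace ℝ (Fin n)
  p_lip : LocallyLipschitz p
  chain : ∀ (γ : ℝ → X) (J : Set ℝ) (t : ℝ) (ξ : EuclideanSpace ℝ (Fin n)),
    HasDerivWithinAt (ι ∘ γ) (D (γ t) ξ) J t →
      HasDerivWithinAt (ψ ∘ γ) (inner ℝ (p (γ t)) ξ) J t
  chart : ∀ x₀ : X, ∃ (σ : EuclideanSpace ℝ (Fin n) → X) (u₀ : EuclideanSpace ℝ (Fin n))
    (b : EuclideanSpace ℝ (Fin n) → EuclideanSpace ℝ (Fin n) →L[ℝ] EuclideanSpace ℝ (Fin n)),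
    σ u₀ = x₀ ∧ LipschitzNear b u₀ ∧ LipschitzNear σ u₀ ∧ ∀ᶠ u in 𝓝 u₀,
      ∃ A : EuclideanSpace ℝ (Fin n) →L[ℝ] EuclideanSpace ℝ (Fin N),
        HasFDerivAt (ι ∘ σ) A u ∧ ∀ ξ, A (b u ξ) = D (σ u) ξ
  R : EuclideanSpace ℝ (Fin n) →L[ℝ] EuclideanSpace ℝ (Fin n)
  R_symm : ∀ v w, inner ℝ (R v) w = inner ℝ v (R w)
  R_nonneg : ∀ v, 0 ≤ inner ℝ (R v) v
  T : ℝ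
  T_pos : 0 < T
  U : ℝ → EuclideanSpace ℝ (Fin n)
  U_continuous : Continuous U
  U_periodic : Function.Periodic U T
  U_zeroMean : ∀ i, ∫ t in (0 : ℝ)..T, U t i = 0
  U_orthonormal : ∀ i j, ∫ t in (0 : ℝ)..T, (U t i * U t j - if i = j then 1 else 0) = 0
  α : ℝ → ℝ
  α_smooth : ContDiff ℝ ∞ α
  α_mul_deriv_strictMono : StrictMono fun z => α z * deriv α z
  α_mul_deriv_pos : ∀ z, 0 < α z * deriv α z
  a : ℝ
  lam : ℝ
  b : ℝ
  κ : ℝ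
  h : ℝ
  a_pos : 0 < a
  lam_pos : 0 < lam
  b_pos : 0 < b
  κ_pos : 0 < κ
  h_pos : 0 < h
  gain_condition : 0 < a * lam - b * κ

namespace ReducedSystem

variable {n N : ℕ} {X : Type*} [MetricSpace X] (𝒮 : ReducedSystem n N X)

/-- The state space of the reduced system. -/
abbrev RState (n : ℕ) (X : Type*) : Type _ :=
  X × EuclideanSpace ℝ (Fin n) × EuclideanSpace ℝ (Fin n) × ℝ

/-- The ambient space of the state space, with its product norm. -/
abbrev RAmbient (n N : ℕ) : Type :=
  EuclideanSpace ℝ (Fin N) × EuclideanSpace ℝ (Fin n) × EuclideanSpace ℝ (Fin n) × ℝ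

/-- The inclusion of the state space into the ambient space. -/
def Φ (y : RState n X) : RAmbient n N := (𝒮.ι y.1, y.2)

theorem isometry_Φ : Isometry 𝒮.Φ := fun x y => by
  rw [Prod.edist_eq, Prod.edist_eq (x := x)]
  simp only [Φ, 𝒮.ι_isometry.edist_eq]

include 𝒮 in
theorem properSpace : ProperSpace X := ⟨fun x r => by
  rw [𝒮.ι_isometry.isEmbedding.isInducing.isCompact_iff]
  have h : 𝒮.ι '' Metric.closedBall x r = Metric.closedBall (𝒮.ι x) r ∩ range 𝒮.ι := by
    ext z
    constructor
    · rintro ⟨y, hy, rfl⟩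
      exact ⟨by rwa [Metric.mem_closedBall, 𝒮.ι_isometry.dist_eq], y, rfl⟩
    · rintro ⟨hy, y, rfl⟩
      exact ⟨y, by rwa [Metric.mem_closedBall, 𝒮.ι_isometry.dist_eq] at hy, rfl⟩
  rw [h]
  exact (isCompact_closedBall _ _).inter_right 𝒮.ι_closed⟩

/-- The error of the filtered objective. -/
def err (y : RState n X) : ℝ := 𝒮.ψ y.1 - y.2.2.2

/-- The body velocity. -/
def vel (U : EuclideanSpace ℝ (Fin n)) (y : RState n X) : EuclideanSpace ℝ (Fin n) :=
  y.2.1 + (𝒮.lam * 𝒮.α (𝒮.err y)) • U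

/-- The derivative of the error. -/
def errDeriv (U : EuclideanSpace ℝ (Fin n)) (y : RState n X) : ℝ :=
  inner ℝ (𝒮.p y.1) (𝒮.vel U y) - 𝒮.h * 𝒮.err y

/-- The reduced vector field, as a function of the value of `U` and of the state. -/
def field (U : EuclideanSpace ℝ (Fin n)) (y : RState n X) : RAmbient n N :=
  (𝒮.D y.1 (𝒮.vel U y),
    - 𝒮.R (𝒮.vel U y) - 𝒮.b • y.2.2.1 - (𝒮.lam * deriv 𝒮.α (𝒮.err y) * 𝒮.errDeriv U y) • U,
    - 𝒮.a • y.2.2.1 - (𝒮.κ * deriv 𝒮.α (𝒮.err y) * 𝒮.errDeriv U y) • U,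
    𝒮.h * 𝒮.err y)

theorem contDiff_deriv_α : ContDiff ℝ ∞ (deriv 𝒮.α) :=
  (contDiff_infty_iff_deriv.1 𝒮.α_smooth).2

/-- The reduced vector field in terms of the trivialization `D` and of the values of `U`, `p`, `ψ`
and of the state. -/
def rhs {F : Type*} [NormedAddCommGroup F] [NormedSpace ℝ F]
    (z : (EuclideanSpace ℝ (Fin n) →L[ℝ] F) × EuclideanSpace ℝ (Fin n) ×
      EuclideanSpace ℝ (Fin n) × ℝ × EuclideanSpace ℝ (Fin n) × EuclideanSpace ℝ (Fin n) × ℝ) :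
    F × EuclideanSpace ℝ (Fin n) × EuclideanSpace ℝ (Fin n) × ℝ :=
  (z.1 (z.2.2.2.2.1 + (𝒮.lam * 𝒮.α (z.2.2.2.1 - z.2.2.2.2.2.2)) • z.2.1),
    - 𝒮.R (z.2.2.2.2.1 + (𝒮.lam * 𝒮.α (z.2.2.2.1 - z.2.2.2.2.2.2)) • z.2.1)
      - 𝒮.b • z.2.2.2.2.2.1
      - (𝒮.lam * deriv 𝒮.α (z.2.2.2.1 - z.2.2.2.2.2.2) *
        (inner ℝ z.2.2.1 (z.2.2.2.2.1 + (𝒮.lam * 𝒮.α (z.2.2.2.1 - z.2.2.2.2.2.2)) • z.2.1)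
          - 𝒮.h * (z.2.2.2.1 - z.2.2.2.2.2.2))) • z.2.1,
    - 𝒮.a • z.2.2.2.2.2.1
      - (𝒮.κ * deriv 𝒮.α (z.2.2.2.1 - z.2.2.2.2.2.2) *
        (inner ℝ z.2.2.1 (z.2.2.2.2.1 + (𝒮.lam * 𝒮.α (z.2.2.2.1 - z.2.2.2.2.2.2)) • z.2.1)
          - 𝒮.h * (z.2.2.2.1 - z.2.2.2.2.2.2))) • z.2.1,
    𝒮.h * (z.2.2.2.1 - z.2.2.2.2.2.2))

theorem contDiff_rhs {F : Type*} [NormedAddCommGroup F] [NormedSpace ℝ F] :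
    ContDiff ℝ 1 (𝒮.rhs (F := F)) := by
  have h1 : ContDiff ℝ 1 𝒮.α := 𝒮.α_smooth.of_le (WithTop.coe_le_coe.2 (le_top : (1 : ℕ∞) ≤ ⊤))
  have h2 : ContDiff ℝ 1 (deriv 𝒮.α) :=
    𝒮.contDiff_deriv_α.of_le (WithTop.coe_le_coe.2 (le_top : (1 : ℕ∞) ≤ ⊤))
  have hs : ContDiff ℝ 1 fun z : (EuclideanSpace ℝ (Fin n) →L[ℝ] F) × EuclideanSpace ℝ (Fin n) ×
      EuclideanSpace ℝ (Fin n) × ℝ × EuclideanSpace ℝ (Fin n) × EuclideanSpace ℝ (Fin n) × ℝ =>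
      z.2.2.2.1 - z.2.2.2.2.2.2 := by fun_prop
  have hv : ContDiff ℝ 1 fun z : (EuclideanSpace ℝ (Fin n) →L[ℝ] F) × EuclideanSpace ℝ (Fin n) ×
      EuclideanSpace ℝ (Fin n) × ℝ × EuclideanSpace ℝ (Fin n) × EuclideanSpace ℝ (Fin n) × ℝ =>
      z.2.2.2.2.1 + (𝒮.lam * 𝒮.α (z.2.2.2.1 - z.2.2.2.2.2.2)) • z.2.1 := by fun_prop
  have hp : ContDiff ℝ 1 fun z : (EuclideanSpace ℝ (Fin n) →L[ℝ] F) × EuclideanSpace ℝ (Fin n) ×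
      EuclideanSpace ℝ (Fin n) × ℝ × EuclideanSpace ℝ (Fin n) × EuclideanSpace ℝ (Fin n) × ℝ =>
      z.2.2.1 := by fun_prop
  have hw : ContDiff ℝ 1 fun z : (EuclideanSpace ℝ (Fin n) →L[ℝ] F) × EuclideanSpace ℝ (Fin n) ×
      EuclideanSpace ℝ (Fin n) × ℝ × EuclideanSpace ℝ (Fin n) × EuclideanSpace ℝ (Fin n) × ℝ =>
      z.2.2.2.2.2.1 := by fun_prop
  have hU : ContDiff ℝ 1 fun z : (EuclideanSpace ℝ (Fin n) →L[ℝ] F) × EuclideanSpace ℝ (Fin n) ×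
      EuclideanSpace ℝ (Fin n) × ℝ × EuclideanSpace ℝ (Fin n) × EuclideanSpace ℝ (Fin n) × ℝ =>
      z.2.1 := by fun_prop
  have hi := (hp.inner ℝ hv).sub (contDiff_const (c := 𝒮.h) |>.mul hs)
  exact (contDiff_fst.clm_apply hv).prodMk
    (((((𝒮.R.contDiff.comp hv).neg).sub (hw.const_smul 𝒮.b)).sub
      (((contDiff_const (c := 𝒮.lam).mul (h2.comp hs)).mul hi).smul hU)).prodMk
    (((hw.const_smul (-𝒮.a)).sub
      (((contDiff_const (c := 𝒮.κ).mul (h2.comp hs)).mul hi).smul hU)).prodMk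
      (contDiff_const (c := 𝒮.h) |>.mul hs)))

theorem field_eq_rhs (U : EuclideanSpace ℝ (Fin n)) (y : RState n X) :
    𝒮.field U y = 𝒮.rhs (𝒮.D y.1, U, 𝒮.p y.1, 𝒮.ψ y.1, y.2) := rfl

theorem locallyLipschitz_field : LocallyLipschitz (Function.uncurry 𝒮.field) := by
  have hX : LipschitzWith 1 (fun z : EuclideanSpace ℝ (Fin n) × RState n X => z.2.1) :=
    LipschitzWith.prod_fst.comp LipschitzWith.prod_snd |>.weaken (by simp)
  have hY : LipschitzWith 1 (fun z : EuclideanSpace ℝ (Fin n) × RState n X => z.2.2) :=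
    LipschitzWith.prod_snd.comp LipschitzWith.prod_snd |>.weaken (by simp)
  have hU : LipschitzWith 1 (fun z : EuclideanSpace ℝ (Fin n) × RState n X => z.1) :=
    LipschitzWith.prod_fst
  have h2 : LocallyLipschitz (fun z : EuclideanSpace ℝ (Fin n) × RState n X =>
      (𝒮.D z.2.1, z.1, 𝒮.p z.2.1, 𝒮.ψ z.2.1, z.2.2)) :=
    (𝒮.D_lip.comp hX.locallyLipschitz).prodMk (hU.locallyLipschitz.prodMk
      ((𝒮.p_lip.comp hX.locallyLipschitz).prodMk
      ((𝒮.ψ_lip.comp hX.locallyLipschitz).prodMk hY.locallyLipschitz)))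
  have h3 : Function.uncurry 𝒮.field = 𝒮.rhs ∘ fun z : EuclideanSpace ℝ (Fin n) × RState n X =>
      (𝒮.D z.2.1, z.1, 𝒮.p z.2.1, 𝒮.ψ z.2.1, z.2.2) := by
    funext z
    exact 𝒮.field_eq_rhs z.1 z.2
  rw [h3]
  exact 𝒮.contDiff_rhs.locallyLipschitz.comp h2

theorem continuous_field : Continuous (Function.uncurry 𝒮.field) :=
  𝒮.locallyLipschitz_field.continuous

theorem continuous_uncurry_field (om : ℝ) :
    Continuous (Function.uncurry fun (t : ℝ) (y : RState n X) => 𝒮.field (𝒮.U (om * t)) y) := by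
  have h := 𝒮.continuous_field
  have hU := 𝒮.U_continuous
  exact h.comp (f := fun z : ℝ × RState n X => (𝒮.U (om * z.1), z.2)) (by fun_prop)

theorem exists_bound_U : ∃ B, ∀ t, ‖𝒮.U t‖ ≤ B := by
  obtain ⟨B, hB⟩ := (isCompact_Icc (a := 0) (b := 0 + 𝒮.T)).exists_bound_of_continuousOn
    𝒮.U_continuous.continuousOn
  refine ⟨B, fun t => ?_⟩
  obtain ⟨s, hs, hst⟩ := 𝒮.U_periodic.exists_mem_Ico 𝒮.T_pos t 0
  rw [hst]
  exact hB s (Ico_subset_Icc_self hs)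

theorem exists_lipschitzOnWith_field {K : Set (RState n X)} (hK : IsCompact K) :
    ∃ L : NNReal, ∀ t, LipschitzOnWith L (𝒮.field (𝒮.U t)) K := by
  obtain ⟨B, hB⟩ := 𝒮.exists_bound_U
  obtain ⟨L, hL⟩ := (𝒮.locallyLipschitz_field.locallyLipschitzOn
    (s := Metric.closedBall 0 B ×ˢ K)).exists_lipschitzOnWith_of_compact
    ((isCompact_closedBall _ _).prod hK)
  refine ⟨L, fun t y hy y' hy' => ?_⟩
  have hUm : 𝒮.U t ∈ Metric.closedBall 0 B := by simpa using hB t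
  have := hL (x := (𝒮.U t, y)) ⟨hUm, hy⟩ (y := (𝒮.U t, y')) ⟨hUm, hy'⟩
  have he : edist (𝒮.U t, y) (𝒮.U t, y') = edist y y' := by simp [Prod.edist_eq]
  rwa [he] at this

theorem exists_bound_field {K : Set (RState n X)} (hK : IsCompact K) :
    ∃ C : NNReal, ∀ t, ∀ y ∈ K, ‖𝒮.field (𝒮.U t) y‖ ≤ C := by
  obtain ⟨B, hB⟩ := 𝒮.exists_bound_U
  obtain ⟨C, hC⟩ := ((isCompact_closedBall (0 : EuclideanSpace ℝ (Fin n)) B).prod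
    hK).exists_bound_of_continuousOn 𝒮.continuous_field.continuousOn
  exact ⟨Real.toNNReal C, fun t y hy =>
    (hC (𝒮.U t, y) ⟨by simpa using hB t, hy⟩).trans (Real.le_coe_toNNReal C)⟩

/-- Existence of local solutions of the equation `z' = f(U(t), z)`. -/
theorem exists_local_solution {E Z : Type*} [NormedAddCommGroup E] [NormedAddCommGroup Z]
    [NormedSpace ℝ Z] [CompleteSpace Z] {f : E × Z → Z} {U : ℝ → E} (hU : Continuous U) {t₀ : ℝ}
    {z₀ : Z} (hf : LipschitzNear f (U t₀, z₀)) {W : Set Z} (hW : W ∈ 𝓝 z₀) :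
    ∃ ε > 0, ∃ z : ℝ → Z, z t₀ = z₀ ∧ ∀ t ∈ Icc t₀ (t₀ + ε), z t ∈ W ∧
      HasDerivWithinAt z (f (U t, z t)) (Icc t₀ (t₀ + ε)) t := by
  have hc := hf.continuousAt
  obtain ⟨K, Q, hQ, hK⟩ := hf
  have hQ' := inter_mem hQ (hc.preimage_mem_nhds (Metric.ball_mem_nhds (f (U t₀, z₀)) one_pos))
  rw [nhds_prod_eq, mem_prod_iff] at hQ'
  obtain ⟨Q₁, hQ₁, Q₂, hQ₂, hsub⟩ := hQ'
  obtain ⟨r, hr, hrQ⟩ := Metric.nhds_basis_closedBall.mem_iff.1 hQ₂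
  obtain ⟨ε₁, hε₁, hεQ⟩ := Metric.nhds_basis_closedBall.mem_iff.1
    (hU.continuousAt.preimage_mem_nhds hQ₁)
  set L : NNReal := ⟨‖f (U t₀, z₀)‖ + 1, by positivity⟩ with hL
  have hL0 : (0 : ℝ) < L := by rw [hL]; change 0 < ‖f (U t₀, z₀)‖ + 1; positivity
  set ε : ℝ := min ε₁ (r / L) with hε
  have hε0 : 0 < ε := lt_min hε₁ (by positivity)
  have hUm : ∀ t ∈ Icc (t₀ - ε) (t₀ + ε), U t ∈ Q₁ := fun t ht => hεQ (by
    have h1 := min_le_left ε₁ (r / L)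
    rw [Metric.mem_closedBall, Real.dist_eq, abs_le]
    constructor <;> linarith [ht.1, ht.2])
  have hPL : IsPicardLindelof (fun t z => f (U t, z)) (tmin := t₀ - ε) (tmax := t₀ + ε)
      ⟨t₀, by constructor <;> linarith⟩ z₀ ⟨r, hr.le⟩ 0 L K := by
    have hrQ' : ∀ z ∈ Metric.closedBall z₀ ((⟨r, hr.le⟩ : NNReal) : ℝ), z ∈ Q₂ :=
      fun z hz => hrQ hz
    refine ⟨fun t ht z hz z' hz' => ?_, fun z hz t ht => ?_, fun t ht z hz => ?_, ?_⟩
    · have hm : (U t, z) ∈ Q₁ ×ˢ Q₂ := ⟨hUm t ht, hrQ' _ hz⟩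
      have hm' : (U t, z') ∈ Q₁ ×ˢ Q₂ := ⟨hUm t ht, hrQ' _ hz'⟩
      have := hK (hsub hm).1 (hsub hm').1
      have he : edist (U t, z) (U t, z') = edist z z' := by simp [Prod.edist_eq]
      rwa [he] at this
    · exact ContinuousOn.comp (hK.continuousOn.mono fun q (hq : q ∈ Q₁ ×ˢ Q₂) => (hsub hq).1)
        (f := fun t => (U t, z)) (by fun_prop) (fun t ht => ⟨hUm t ht, hrQ' _ hz⟩) t ht
    · have h1 := (hsub (show (U t, z) ∈ Q₁ ×ˢ Q₂ from ⟨hUm t ht, hrQ' _ hz⟩)).2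
      rw [mem_preimage, mem_ball_iff_norm] at h1
      have h2 := norm_sub_norm_le (f (U t, z)) (f (U t₀, z₀))
      change _ ≤ ‖f (U t₀, z₀)‖ + 1
      linarith
    · have h1 : max (t₀ + ε - t₀) (t₀ - (t₀ - ε)) = ε := by simp
      change (L : ℝ) * max (t₀ + ε - t₀) (t₀ - (t₀ - ε)) ≤ r - 0
      rw [h1, sub_zero, mul_comm]
      exact (le_div_iff₀ hL0).1 (min_le_right _ _)
  obtain ⟨z, hz, hzd⟩ := hPL.exists_eq_forall_mem_Icc_hasDerivWithinAt₀
  have hzc : ContinuousWithinAt z (Icc t₀ (t₀ + ε)) t₀ :=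
    ((hzd t₀ ⟨by linarith, by linarith⟩).continuousWithinAt).mono
      (Icc_subset_Icc_left (by linarith))
  have hpre := hzc.preimage_mem_nhdsWithin (by rw [hz]; exact hW)
  obtain ⟨δ, hδ, hδW⟩ := Metric.mem_nhdsWithin_iff.1 hpre
  refine ⟨min ε (δ / 2), lt_min hε0 (by linarith), z, hz, fun t ht => ⟨hδW ⟨?_, ?_⟩, ?_⟩⟩
  · have := min_le_right ε (δ / 2)
    rw [Metric.mem_ball, Real.dist_eq, abs_lt]
    constructor <;> linarith [ht.1, ht.2]
  · exact ⟨ht.1, ht.2.trans (by linarith [min_le_left ε (δ / 2)])⟩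
  · have := min_le_left ε (δ / 2)
    exact (hzd t ⟨by linarith [ht.1], by linarith [ht.2]⟩).mono
      (Icc_subset_Icc (by linarith) (by linarith))

/-- The reduced system has local solutions. -/
theorem exists_local (om t₀ : ℝ) (y₀ : RState n X) : ∃ ε > 0, ∃ y : ℝ → RState n X, y t₀ = y₀ ∧
    IsSolutionOn 𝒮.Φ (fun t y => 𝒮.field (𝒮.U (om * t)) y) (Icc t₀ (t₀ + ε)) y := by
  obtain ⟨x₀, q₀⟩ := y₀
  obtain ⟨σ, u₀, b, hσ, hb, hσl, hA⟩ := 𝒮.chart x₀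
  set f : EuclideanSpace ℝ (Fin n) × EuclideanSpace ℝ (Fin n) ×
      EuclideanSpace ℝ (Fin n) × EuclideanSpace ℝ (Fin n) × ℝ →
      EuclideanSpace ℝ (Fin n) × EuclideanSpace ℝ (Fin n) × EuclideanSpace ℝ (Fin n) × ℝ :=
    fun z => 𝒮.rhs (b z.2.1, z.1, 𝒮.p (σ z.2.1), 𝒮.ψ (σ z.2.1), z.2.2) with hf
  have hfl : LipschitzNear f (𝒮.U (om * t₀), u₀, q₀) := by
    have hlw : ∀ {β : Type} [PseudoEMetricSpace β] {g : EuclideanSpace ℝ (Fin n) ×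
        EuclideanSpace ℝ (Fin n) × EuclideanSpace ℝ (Fin n) × EuclideanSpace ℝ (Fin n) × ℝ → β}
        {K : NNReal} (hg : LipschitzWith K g) {z}, LipschitzNear g z :=
      fun hg z => ⟨_, univ, univ_mem, hg.lipschitzOnWith⟩
    have hu := hlw (LipschitzWith.prod_fst.comp LipschitzWith.prod_snd)
      (z := (𝒮.U (om * t₀), u₀, q₀))
    have hq := hlw (LipschitzWith.prod_snd.comp LipschitzWith.prod_snd)
      (z := (𝒮.U (om * t₀), u₀, q₀))
    have hU := hlw LipschitzWith.prod_fst (z := (𝒮.U (om * t₀), u₀, q₀))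
    have hσu := LipschitzNear.comp (g := σ) hσl hu
    have hall := (LipschitzNear.comp (g := b) hb hu).prodMk (hU.prodMk
      ((LipschitzNear.comp (g := 𝒮.p) (𝒮.p_lip _) hσu).prodMk
      ((LipschitzNear.comp (g := 𝒮.ψ) (𝒮.ψ_lip _) hσu).prodMk hq)))
    exact LipschitzNear.comp (g := 𝒮.rhs) (𝒮.contDiff_rhs.locallyLipschitz _) hall
  have hW : {z : EuclideanSpace ℝ (Fin n) × EuclideanSpace ℝ (Fin n) ×
      EuclideanSpace ℝ (Fin n) × ℝ | ∃ A : EuclideanSpace ℝ (Fin n) →L[ℝ] EuclideanSpace ℝ (Fin N),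
        HasFDerivAt (𝒮.ι ∘ σ) A z.1 ∧ ∀ ξ, A (b z.1 ξ) = 𝒮.D (σ z.1) ξ} ∈ 𝓝 (u₀, q₀) :=
    (continuous_fst.tendsto (u₀, q₀)).eventually hA
  have hUom : Continuous fun t => 𝒮.U (om * t) := 𝒮.U_continuous.comp (by fun_prop)
  obtain ⟨ε, hε, z, hz, hzd⟩ := exists_local_solution hUom hfl hW
  refine ⟨ε, hε, fun t => (σ (z t).1, (z t).2), by simp [hz, hσ], ?_⟩
  refine isSolutionOn_of_hasDerivWithinAt 𝒮.isometry_Φ.isEmbedding.isInducing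
    (𝒮.continuous_uncurry_field om) ordConnected_Icc fun t ht => ?_
  obtain ⟨⟨A, hAd, hAb⟩, hd⟩ := hzd t ht
  have h1 : HasDerivWithinAt (fun t => (z t).1) (f (𝒮.U (om * t), z t)).1 (Icc t₀ (t₀ + ε)) t :=
    (hasFDerivAt_fst (𝕜 := ℝ) (p := z t)).comp_hasDerivWithinAt t hd
  have h2 : HasDerivWithinAt (fun t => (z t).2) (f (𝒮.U (om * t), z t)).2 (Icc t₀ (t₀ + ε)) t :=
    (hasFDerivAt_snd (𝕜 := ℝ) (p := z t)).comp_hasDerivWithinAt t hd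
  have h3 := hAd.comp_hasDerivWithinAt t h1
  have h4 : A (f (𝒮.U (om * t), z t)).1 = (𝒮.field (𝒮.U (om * t)) (σ (z t).1, (z t).2)).1 :=
    hAb _
  rw [h4] at h3
  exact h3.prodMk h2

theorem eqOn_of_isSolutionOn {om : ℝ} (J : Set ℝ) (y y' : ℝ → RState n X) (t₀ : ℝ)
    (hJ : J.OrdConnected) (ht₀ : t₀ ∈ J)
    (h : IsSolutionOn 𝒮.Φ (fun t y => 𝒮.field (𝒮.U (om * t)) y) J y)
    (h' : IsSolutionOn 𝒮.Φ (fun t y => 𝒮.field (𝒮.U (om * t)) y) J y') (heq : y t₀ = y' t₀) :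
    EqOn y y' J :=
  h.eqOn_of_locallyLipschitz 𝒮.isometry_Φ (𝒮.continuous_uncurry_field om)
    (fun K hK => by
      obtain ⟨L, hL⟩ := 𝒮.exists_lipschitzOnWith_field hK
      exact ⟨L, fun t => hL _⟩) hJ ht₀ h' heq

end ReducedSystem

end ExtremumSeeking
end

noncomputable section

namespace ExtremumSeeking

section Components

variable {E F : Type*} [NormedAddCommGroup E] [NormedSpace ℝ E] [NormedAddCommGroup F]
  [NormedSpace ℝ F] {f : ℝ → E × F} {f' : E × F} {s : Set ℝ} {t : ℝ}

theorem _root_.HasDerivWithinAt.prod_fst (h : HasDerivWithinAt f f' s t) :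
    HasDerivWithinAt (fun τ => (f τ).1) f'.1 s t := by
  simpa using h.hasFDerivWithinAt.fst.hasDerivWithinAt

theorem _root_.HasDerivWithinAt.prod_snd (h : HasDerivWithinAt f f' s t) :
    HasDerivWithinAt (fun τ => (f τ).2) f'.2 s t := by
  simpa using h.hasFDerivWithinAt.snd.hasDerivWithinAt

theorem _root_.HasDerivWithinAt.euclidean_apply {ι : Type*} [Fintype ι]
    {f : ℝ → EuclideanSpace ℝ ι} {f' : EuclideanSpace ℝ ι} (h : HasDerivWithinAt f f' s t) (i : ι) :
    HasDerivWithinAt (fun τ => f τ i) (f' i) s t :=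
  (EuclideanSpace.proj (𝕜 := ℝ) i).hasFDerivAt.comp_hasDerivWithinAt t h

end Components

namespace ReducedSystem

variable {n N : ℕ} {X : Type*} [MetricSpace X] (𝒮 : ReducedSystem n N X)

/-- `y` solves the reduced system with frequency `om` on `J`. -/
def IsTrajectory (om : ℝ) (J : Set ℝ) (y : ℝ → RState n X) : Prop :=
  ∀ t ∈ J, HasDerivWithinAt (𝒮.Φ ∘ y) (𝒮.field (𝒮.U (om * t)) (y t)) J t

variable {𝒮}

theorem IsTrajectory.mono {om : ℝ} {J J' : Set ℝ} {y : ℝ → RState n X} (h : 𝒮.IsTrajectory om J y)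
    (hJ : J' ⊆ J) : 𝒮.IsTrajectory om J' y := fun t ht => (h t (hJ ht)).mono hJ

theorem IsTrajectory.continuousOn {om : ℝ} {J : Set ℝ} {y : ℝ → RState n X}
    (h : 𝒮.IsTrajectory om J y) : ContinuousOn y J :=
  𝒮.isometry_Φ.isEmbedding.isInducing.continuousOn_iff.2 fun t ht => (h t ht).continuousWithinAt

theorem exists_lipschitzOnWith_of_isTrajectory {K : Set (RState n X)} (hK : IsCompact K) :
    ∃ L : NNReal, ∀ om a b y, 𝒮.IsTrajectory om (Icc a b) y → MapsTo y (Icc a b) K →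
      LipschitzOnWith L y (Icc a b) := by
  obtain ⟨C, hC⟩ := 𝒮.exists_bound_field hK
  refine ⟨C, fun om a b y h hy => ?_⟩
  have h1 : LipschitzOnWith C (𝒮.Φ ∘ y) (Icc a b) :=
    Convex.lipschitzOnWith_of_nnnorm_hasDerivWithin_le (convex_Icc a b) h
      fun t ht => hC _ _ (hy ht)
  intro s hs t ht
  rw [← 𝒮.isometry_Φ.edist_eq]
  exact h1 hs ht

/-- A function whose derivative along trajectories is `fbar`, up to products of locally Lipschitz
functions of the state and of periodic functions of `om * t` of zero mean, has average derivative
`fbar`. -/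
theorem hasAverage_of_hasDerivWithinAt {κ : Type*} [Fintype κ] {K : Set (RState n X)}
    (hK : IsCompact K) {f fbar : RState n X → ℝ} {c : κ → RState n X → ℝ} {p : κ → ℝ → ℝ}
    (hfbar : Continuous fbar) (hc : ∀ k, LocallyLipschitz (c k)) (hp : ∀ k, Continuous (p k))
    (hper : ∀ k, Function.Periodic (p k) 𝒮.T) (hzero : ∀ k, ∫ t in (0 : ℝ)..𝒮.T, p k t = 0)
    (hd : ∀ om J y, 𝒮.IsTrajectory om J y → ∀ t ∈ J,
      HasDerivWithinAt (f ∘ y) (fbar (y t) + ∑ k, c k (y t) * p k (om * t)) J t) :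
    HasAverage 𝒮.IsTrajectory K f fbar := by
  obtain ⟨L, hL⟩ := 𝒮.exists_lipschitzOnWith_of_isTrajectory hK
  have h1 : ∀ k, ∃ B, ∀ om > 0, ∀ a b y, a ≤ b → b ≤ a + 1 → 𝒮.IsTrajectory om (Icc a b) y →
      MapsTo y (Icc a b) K → |∫ t in a..b, c k (y t) * p k (om * t)| ≤ B / om := fun k => by
    obtain ⟨Q, hQ, hosc⟩ := exists_oscillation_bound 𝒮.T_pos (hp k) (hper k) (hzero k)
    obtain ⟨L', hL'⟩ := ((hc k).locallyLipschitzOn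
      (s := K)).exists_lipschitzOnWith_of_compact hK
    obtain ⟨M, hM⟩ := hK.exists_bound_of_continuousOn (hc k).continuous.continuousOn
    refine ⟨Q * ((L' * L : NNReal) + 2 * M), fun om hom a b y hab hb htr hy => ?_⟩
    exact hosc om hom a b hab hb (fun t => c k (y t)) (L' * L) M
      (hL'.comp (hL om a b y htr hy) hy) fun t ht => hM _ (hy ht)
  choose B hB using h1
  refine ⟨∑ k, B k, fun om hom a b y hab hb htr hy => ?_⟩
  have hyc := htr.continuousOn
  have hu : uIcc a b = Icc a b := uIcc_of_le hab
  have hi0 : IntervalIntegrable (fun t => fbar (y t)) volume a b :=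
    (hfbar.comp_continuousOn (hu ▸ hyc)).intervalIntegrable
  have hik : ∀ k, IntervalIntegrable (fun t => c k (y t) * p k (om * t)) volume a b := fun k =>
    (((hc k).continuous.comp_continuousOn (hu ▸ hyc)).mul
      ((hp k).comp (continuous_const.mul continuous_id)).continuousOn).intervalIntegrable
  have his : IntervalIntegrable (fun t => ∑ k, c k (y t) * p k (om * t)) volume a b := by
    have := IntervalIntegrable.sum (s := Finset.univ) (f := fun k t => c k (y t) * p k (om * t))
      (μ := volume) (a := a) (b := b) fun k _ => hik k
    simpa [Finset.sum_fn] using this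
  have h2 := integral_eq_of_hasDerivWithinAt ordConnected_Icc (hd om _ y htr) (left_mem_Icc.2 hab)
    (right_mem_Icc.2 hab) (hi0.add his)
  simp only [Function.comp_apply] at h2
  rw [h2, intervalIntegral.integral_add hi0 his, add_sub_cancel_left,
    intervalIntegral.integral_finsetSum fun k _ => hik k, Finset.sum_div]
  exact (Finset.abs_sum_le_sum_abs _ _).trans
    (Finset.sum_le_sum fun k _ => hB k om hom a b y hab hb htr hy)

/-- The averages of functions whose derivative along trajectories is quadratic in `U`. -/
theorem hasAverage_of_quadratic {K : Set (RState n X)} (hK : IsCompact K)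
    {f fbar : RState n X → ℝ} {A B C : RState n X → EuclideanSpace ℝ (Fin n)}
    (hfbar : Continuous fbar) (hA : LocallyLipschitz A) (hB : LocallyLipschitz B)
    (hC : LocallyLipschitz C)
    (hd : ∀ om J y, 𝒮.IsTrajectory om J y → ∀ t ∈ J,
      HasDerivWithinAt (f ∘ y) (fbar (y t) - inner ℝ (B (y t)) (C (y t))
        + inner ℝ (A (y t)) (𝒮.U (om * t))
        + inner ℝ (B (y t)) (𝒮.U (om * t)) * inner ℝ (C (y t)) (𝒮.U (om * t))) J t) :
    HasAverage 𝒮.IsTrajectory K f fbar := by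
  have hcoord : ∀ {A : RState n X → EuclideanSpace ℝ (Fin n)}, LocallyLipschitz A → ∀ i,
      LocallyLipschitz fun y => A y i := fun hA i =>
    (EuclideanSpace.proj (𝕜 := ℝ) i).lipschitz.locallyLipschitz.comp hA
  have hUc : ∀ i, Continuous fun t => 𝒮.U t i := fun i =>
    (EuclideanSpace.proj (𝕜 := ℝ) i).continuous.comp 𝒮.U_continuous
  have hmul : ∀ {f g : RState n X → ℝ}, LocallyLipschitz f → LocallyLipschitz g →
      LocallyLipschitz fun y => f y * g y := fun hf hg =>
    (ContDiff.locallyLipschitz (f := fun z : ℝ × ℝ => z.1 * z.2) (𝕂 := ℝ) (by fun_prop)).comp (hf.prodMk hg)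
  refine hasAverage_of_hasDerivWithinAt (𝒮 := 𝒮) hK (κ := Fin n ⊕ Fin n × Fin n)
    (c := Sum.elim (fun i y => A y i) fun q y => B y q.1 * C y q.2)
    (p := Sum.elim (fun i t => 𝒮.U t i) fun q t => 𝒮.U t q.1 * 𝒮.U t q.2 - if q.1 = q.2 then 1 else 0)
    hfbar ?_ ?_ ?_ ?_ fun om J y hy t ht => ?_
  · rintro (i | q)
    · exact hcoord hA i
    · exact hmul (hcoord hB q.1) (hcoord hC q.2)
  · rintro (i | q)
    · exact hUc i
    · exact ((hUc q.1).mul (hUc q.2)).sub continuous_const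
  · rintro (i | q) t
    · simp only [Sum.elim_inl, 𝒮.U_periodic t]
    · simp only [Sum.elim_inr, 𝒮.U_periodic t]
  · rintro (i | q)
    · exact 𝒮.U_zeroMean i
    · exact 𝒮.U_orthonormal q.1 q.2
  · convert hd om J y hy t ht using 1
    simp only [PiLp.inner_apply, RCLike.inner_apply, conj_trivial, Fintype.sum_sum_type,
      Sum.elim_inl, Sum.elim_inr, Fintype.sum_prod_type, mul_sub, Finset.sum_sub_distrib,
      Finset.sum_mul_sum, mul_ite, mul_one, mul_zero, Finset.sum_ite_eq, Finset.mem_univ, if_true]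
    have e1 : ∑ i, A (y t) i * 𝒮.U (om * t) i = ∑ i, 𝒮.U (om * t) i * A (y t) i :=
      Finset.sum_congr rfl fun _ _ => mul_comm _ _
    have e2 : ∑ i, B (y t) i * C (y t) i = ∑ i, C (y t) i * B (y t) i :=
      Finset.sum_congr rfl fun _ _ => mul_comm _ _
    have e3 : ∑ i, ∑ j, B (y t) i * C (y t) j * (𝒮.U (om * t) i * 𝒮.U (om * t) j)
        = ∑ i, ∑ j, 𝒮.U (om * t) i * B (y t) i * (𝒮.U (om * t) j * C (y t) j) :=
      Finset.sum_congr rfl fun _ _ => Finset.sum_congr rfl fun _ _ => by ring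
    rw [e1, e2, e3]
    ring

variable (𝒮)

/-- The product `α α'`. -/
def αα' (z : ℝ) : ℝ := 𝒮.α z * deriv 𝒮.α z

theorem contDiff_αα' : ContDiff ℝ 1 𝒮.αα' :=
  (𝒮.α_smooth.mul 𝒮.contDiff_deriv_α).of_le (WithTop.coe_le_coe.2 (le_top : (1 : ℕ∞) ≤ ⊤))

theorem locallyLipschitz_of_contDiff {F : Type*} [NormedAddCommGroup F] [NormedSpace ℝ F]
    {g : (EuclideanSpace ℝ (Fin n) →L[ℝ] EuclideanSpace ℝ (Fin N)) × EuclideanSpace ℝ (Fin n) × ℝ ×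
      EuclideanSpace ℝ (Fin n) × EuclideanSpace ℝ (Fin n) × ℝ → F} (hg : ContDiff ℝ 1 g) :
    LocallyLipschitz fun y : RState n X => g (𝒮.D y.1, 𝒮.p y.1, 𝒮.ψ y.1, y.2) := by
  have hX : LocallyLipschitz (fun y : RState n X => y.1) :=
    LipschitzWith.prod_fst.locallyLipschitz
  have hY : LocallyLipschitz (fun y : RState n X => y.2) :=
    LipschitzWith.prod_snd.locallyLipschitz
  exact hg.locallyLipschitz.comp ((𝒮.D_lip.comp hX).prodMk
    ((𝒮.p_lip.comp hX).prodMk ((𝒮.ψ_lip.comp hX).prodMk hY)))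

variable {𝒮}

section Derivatives

variable {om : ℝ} {J : Set ℝ} {y : ℝ → RState n X} {t : ℝ}

theorem IsTrajectory.hasDerivWithinAt_fst (h : 𝒮.IsTrajectory om J y) (ht : t ∈ J) :
    HasDerivWithinAt (fun t => 𝒮.ι (y t).1) (𝒮.D (y t).1 (𝒮.vel (𝒮.U (om * t)) (y t))) J t :=
  (h t ht).prod_fst

theorem IsTrajectory.hasDerivWithinAt_snd (h : 𝒮.IsTrajectory om J y) (ht : t ∈ J) :
    HasDerivWithinAt (fun t => (y t).2) (𝒮.field (𝒮.U (om * t)) (y t)).2 J t :=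
  (h t ht).prod_snd

theorem IsTrajectory.hasDerivWithinAt_velocity (h : 𝒮.IsTrajectory om J y) (ht : t ∈ J) :
    HasDerivWithinAt (fun t => (y t).2.1) (𝒮.field (𝒮.U (om * t)) (y t)).2.1 J t :=
  (h.hasDerivWithinAt_snd ht).prod_fst

theorem IsTrajectory.hasDerivWithinAt_filter (h : 𝒮.IsTrajectory om J y) (ht : t ∈ J) :
    HasDerivWithinAt (fun t => (y t).2.2.1) (𝒮.field (𝒮.U (om * t)) (y t)).2.2.1 J t :=
  (h.hasDerivWithinAt_snd ht).prod_snd.prod_fst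

theorem IsTrajectory.hasDerivWithinAt_ψ (h : 𝒮.IsTrajectory om J y) (ht : t ∈ J) :
    HasDerivWithinAt (fun t => 𝒮.ψ (y t).1)
      (inner ℝ (𝒮.p (y t).1) (𝒮.vel (𝒮.U (om * t)) (y t))) J t :=
  𝒮.chain (fun t => (y t).1) J t _ (h.hasDerivWithinAt_fst ht)

theorem IsTrajectory.hasDerivWithinAt_err (h : 𝒮.IsTrajectory om J y) (ht : t ∈ J) :
    HasDerivWithinAt (fun t => 𝒮.err (y t)) (𝒮.errDeriv (𝒮.U (om * t)) (y t)) J t :=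
  (h.hasDerivWithinAt_ψ ht).sub (h.hasDerivWithinAt_snd ht).prod_snd.prod_snd

end Derivatives

variable (𝒮)

theorem hasAverage_position {K : Set (RState n X)} (hK : IsCompact K) (k : Fin N) :
    HasAverage 𝒮.IsTrajectory K (fun y => 𝒮.ι y.1 k) (fun y => 𝒮.D y.1 y.2.1 k) := by
  have h1 : ContDiff ℝ 1 𝒮.α := 𝒮.α_smooth.of_le (WithTop.coe_le_coe.2 (le_top : (1 : ℕ∞) ≤ ⊤))
  have hk := (EuclideanSpace.proj (𝕜 := ℝ) (ι := Fin N) k).contDiff (n := 1)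
  refine hasAverage_of_hasDerivWithinAt (𝒮 := 𝒮) hK
    (c := fun i y => 𝒮.lam * 𝒮.α (𝒮.err y) * 𝒮.D y.1 (EuclideanSpace.single i 1) k)
    (p := fun i t => 𝒮.U t i)
    ?_ (fun i => ?_) (fun i => ?_) (fun i t => ?_) 𝒮.U_zeroMean fun om J y hy t ht => ?_
  · refine (𝒮.locallyLipschitz_of_contDiff (g := fun z => (z.1 z.2.2.2.1) k) ?_).continuous
    exact hk.comp (contDiff_fst.clm_apply (by fun_prop))
  · refine 𝒮.locallyLipschitz_of_contDiff (g := fun z =>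
      𝒮.lam * 𝒮.α (z.2.2.1 - z.2.2.2.2.2) * (z.1 (EuclideanSpace.single i 1)) k) ?_
    refine ContDiff.mul (by fun_prop) (hk.comp (contDiff_fst.clm_apply contDiff_const))
  · exact (EuclideanSpace.proj (𝕜 := ℝ) i).continuous.comp 𝒮.U_continuous
  · simp only [𝒮.U_periodic t]
  · have h2 := (hy.hasDerivWithinAt_fst ht).euclidean_apply k
    refine h2.congr_deriv ?_
    have h3 : 𝒮.D (y t).1 (𝒮.U (om * t))
        = ∑ i, 𝒮.U (om * t) i • 𝒮.D (y t).1 (EuclideanSpace.single i 1) := by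
      conv_lhs => rw [← (EuclideanSpace.basisFun (Fin n) ℝ).sum_repr (𝒮.U (om * t))]
      simp
    simp only [vel, map_add, map_smul, h3, Finset.smul_sum, PiLp.add_apply, PiLp.smul_apply,
      WithLp.ofLp_sum, Finset.sum_apply, smul_eq_mul]
    congr 1
    exact Finset.sum_congr rfl fun i _ => by ring

theorem hasAverage_filter {K : Set (RState n X)} (hK : IsCompact K) (k : Fin n) :
    HasAverage 𝒮.IsTrajectory K (fun y => y.2.2.1 k)
      (fun y => - 𝒮.a * y.2.2.1 k - 𝒮.κ * 𝒮.lam * 𝒮.αα' (𝒮.err y) * 𝒮.p y.1 k) := by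
  have h1 : ContDiff ℝ 1 𝒮.α := 𝒮.α_smooth.of_le (WithTop.coe_le_coe.2 (le_top : (1 : ℕ∞) ≤ ⊤))
  have h2 : ContDiff ℝ 1 (deriv 𝒮.α) :=
    𝒮.contDiff_deriv_α.of_le (WithTop.coe_le_coe.2 (le_top : (1 : ℕ∞) ≤ ⊤))
  have h3 := 𝒮.contDiff_αα'
  refine hasAverage_of_quadratic (𝒮 := 𝒮) hK
    (A := fun y => (- (𝒮.κ * deriv 𝒮.α (𝒮.err y)
      * (inner ℝ (𝒮.p y.1) y.2.1 - 𝒮.h * 𝒮.err y))) • EuclideanSpace.single k 1)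
    (B := fun y => (- (𝒮.κ * 𝒮.lam * 𝒮.αα' (𝒮.err y))) • 𝒮.p y.1)
    (C := fun _ => EuclideanSpace.single k 1) ?_ ?_ ?_ (LocallyLipschitz.const _)
    fun om J y hy t ht => ?_
  · refine (𝒮.locallyLipschitz_of_contDiff (g := fun z => -𝒮.a * z.2.2.2.2.1 k
      - 𝒮.κ * 𝒮.lam * 𝒮.αα' (z.2.2.1 - z.2.2.2.2.2) * z.2.1 k) ?_).continuous
    fun_prop
  · refine 𝒮.locallyLipschitz_of_contDiff (g := fun z => (-(𝒮.κ * deriv 𝒮.α (z.2.2.1 - z.2.2.2.2.2)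
      * (inner ℝ z.2.1 z.2.2.2.1 - 𝒮.h * (z.2.2.1 - z.2.2.2.2.2)))) • EuclideanSpace.single k 1) ?_
    have hi := ContDiff.inner ℝ (n := 1)
      (f := fun z : (EuclideanSpace ℝ (Fin n) →L[ℝ] EuclideanSpace ℝ (Fin N)) ×
        EuclideanSpace ℝ (Fin n) × ℝ ×
        EuclideanSpace ℝ (Fin n) × EuclideanSpace ℝ (Fin n) × ℝ => z.2.1)
      (g := fun z => z.2.2.2.1) (by fun_prop) (by fun_prop)
    fun_prop
  · refine 𝒮.locallyLipschitz_of_contDiff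
      (g := fun z => (-(𝒮.κ * 𝒮.lam * 𝒮.αα' (z.2.2.1 - z.2.2.2.2.2))) • z.2.1) ?_
    fun_prop
  · have h4 := (hy.hasDerivWithinAt_filter ht).euclidean_apply k
    refine h4.congr_deriv ?_
    simp only [field, errDeriv, vel, αα', inner_add_right, inner_smul_left, inner_smul_right,
      EuclideanSpace.inner_single_left, EuclideanSpace.inner_single_right, PiLp.sub_apply,
      PiLp.smul_apply, smul_eq_mul, conj_trivial, map_one]
    ring

end ReducedSystem

end ExtremumSeeking
end

noncomputable section

namespace ExtremumSeeking

namespace ReducedSystem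

variable {n N : ℕ} {X : Type*} [MetricSpace X] (𝒮 : ReducedSystem n N X)

/-! ### The potential of the error -/

theorem αα'_pos (z : ℝ) : 0 < 𝒮.αα' z := 𝒮.α_mul_deriv_pos z

theorem αα'_strictMono : StrictMono 𝒮.αα' := 𝒮.α_mul_deriv_strictMono

/-- The integral of `αα' - αα' 0`. -/
def β (z : ℝ) : ℝ := ∫ s in (0 : ℝ)..z, (𝒮.αα' s - 𝒮.αα' 0)

theorem hasDerivAt_β (z : ℝ) : HasDerivAt 𝒮.β (𝒮.αα' z - 𝒮.αα' 0) z := by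
  have hc : Continuous fun s => 𝒮.αα' s - 𝒮.αα' 0 := 𝒮.contDiff_αα'.continuous.sub continuous_const
  exact intervalIntegral.integral_hasDerivAt_right (hc.intervalIntegrable _ _)
    hc.stronglyMeasurable.stronglyMeasurableAtFilter hc.continuousAt

theorem continuous_β : Continuous 𝒮.β :=
  continuous_iff_continuousAt.2 fun z => (𝒮.hasDerivAt_β z).continuousAt

theorem β_zero : 𝒮.β 0 = 0 := by simp [β]

theorem β_tangent_le (x y : ℝ) : 𝒮.β x + (y - x) * (𝒮.αα' x - 𝒮.αα' 0) ≤ 𝒮.β y := by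
  have hc : Continuous fun s => 𝒮.αα' s - 𝒮.αα' 0 := 𝒮.contDiff_αα'.continuous.sub continuous_const
  have h1 : 𝒮.β y - 𝒮.β x = ∫ s in x..y, (𝒮.αα' s - 𝒮.αα' 0) :=
    intervalIntegral.integral_interval_sub_left (hc.intervalIntegrable _ _)
      (hc.intervalIntegrable _ _)
  have h2 : (y - x) * (𝒮.αα' x - 𝒮.αα' 0) = ∫ _s in x..y, (𝒮.αα' x - 𝒮.αα' 0) := by
    rw [intervalIntegral.integral_const, smul_eq_mul]
  have hm := 𝒮.αα'_strictMono.monotone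
  have h3 : ∫ _s in x..y, (𝒮.αα' x - 𝒮.αα' 0) ≤ ∫ s in x..y, (𝒮.αα' s - 𝒮.αα' 0) := by
    rcases le_total x y with h | h
    · refine intervalIntegral.integral_mono_on h (by simp) (hc.intervalIntegrable _ _)
        fun s hs => ?_
      linarith [hm hs.1]
    · rw [intervalIntegral.integral_symm, intervalIntegral.integral_symm y x, neg_le_neg_iff]
      refine intervalIntegral.integral_mono_on h (hc.intervalIntegrable _ _) (by simp)
        fun s hs => ?_
      linarith [hm hs.2]
  linarith

theorem β_nonneg (z : ℝ) : 0 ≤ 𝒮.β z := by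
  have := 𝒮.β_tangent_le 0 z
  rwa [β_zero, sub_self, mul_zero, add_zero] at this

theorem mul_αα'_sub_nonneg (z : ℝ) : 0 ≤ z * (𝒮.αα' z - 𝒮.αα' 0) := by
  have := 𝒮.β_tangent_le z 0
  rw [β_zero] at this
  linarith [𝒮.β_nonneg z]

theorem mul_αα'_sub_pos {z : ℝ} (hz : z ≠ 0) : 0 < z * (𝒮.αα' z - 𝒮.αα' 0) := by
  rcases hz.lt_or_gt with h | h
  · exact mul_pos_of_neg_of_neg h (sub_neg.2 (𝒮.αα'_strictMono h))
  · exact mul_pos h (sub_pos.2 (𝒮.αα'_strictMono h))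

theorem β_pos {z : ℝ} (hz : z ≠ 0) : 0 < 𝒮.β z := by
  have h1 := 𝒮.β_tangent_le (z / 2) z
  have h2 := 𝒮.mul_αα'_sub_pos (z := z / 2) (by simpa using hz)
  have h3 := 𝒮.β_nonneg (z / 2)
  have h4 : z - z / 2 = z / 2 := by ring
  rw [h4] at h1
  linarith

theorem exists_abs_le_of_β_le (C : ℝ) : ∃ B, ∀ z, 𝒮.β z ≤ C → |z| ≤ B := by
  have h1 := sub_pos.2 (𝒮.αα'_strictMono (zero_lt_one : (0 : ℝ) < 1))
  have h2 := sub_pos.2 (𝒮.αα'_strictMono (neg_one_lt_zero : (-1 : ℝ) < 0))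
  refine ⟨max (C / (𝒮.αα' 1 - 𝒮.αα' 0) + 1) (C / (𝒮.αα' 0 - 𝒮.αα' (-1)) + 1), fun z hz => ?_⟩
  have h3 := 𝒮.β_tangent_le 1 z
  have h4 := 𝒮.β_tangent_le (-1) z
  have h5 := 𝒮.β_nonneg 1
  have h6 := 𝒮.β_nonneg (-1)
  refine abs_le'.2 ⟨le_max_of_le_left ?_, le_max_of_le_right ?_⟩
  · rw [← sub_le_iff_le_add, le_div_iff₀ h1]
    linarith
  · rw [← sub_le_iff_le_add, le_div_iff₀ h2]
    linarith

/-! ### The resolvent of the dissipation -/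

/-- The decay rate of the filter. -/
def decay : ℝ := (𝒮.a * 𝒮.lam - 𝒮.b * 𝒮.κ) / 𝒮.lam

/-- The coupling of the filter. -/
def coupling : ℝ := 𝒮.b * 𝒮.κ / 𝒮.lam

theorem decay_pos : 0 < 𝒮.decay := div_pos 𝒮.gain_condition 𝒮.lam_pos

theorem coupling_pos : 0 < 𝒮.coupling := div_pos (mul_pos 𝒮.b_pos 𝒮.κ_pos) 𝒮.lam_pos

theorem decay_add_coupling : 𝒮.decay + 𝒮.coupling = 𝒮.a := by
  have := 𝒮.lam_pos.ne'
  rw [decay, coupling]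
  field_simp
  ring

theorem injective_decay_add_R :
    Function.Injective ((𝒮.decay • LinearMap.id + 𝒮.R.toLinearMap :
      EuclideanSpace ℝ (Fin n) →ₗ[ℝ] EuclideanSpace ℝ (Fin n))) := by
  rw [← LinearMap.ker_eq_bot, LinearMap.ker_eq_bot']
  intro x hx
  have h1 : inner ℝ (𝒮.decay • x + 𝒮.R x) x = 0 := by
    have : 𝒮.decay • x + 𝒮.R x = 0 := hx
    rw [this, inner_zero_left]
  rw [inner_add_left, inner_smul_left, real_inner_self_eq_norm_sq] at h1
  simp only [conj_trivial] at h1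
  have h2 := 𝒮.R_nonneg x
  have h3 := 𝒮.decay_pos
  by_contra h
  have h4 : 0 < ‖x‖ ^ 2 := by positivity
  nlinarith [mul_pos h3 h4]

/-- The inverse of `decay + R`. -/
def resolvent : EuclideanSpace ℝ (Fin n) →L[ℝ] EuclideanSpace ℝ (Fin n) :=
  (LinearEquiv.ofInjectiveEndo _ 𝒮.injective_decay_add_R).symm.toLinearMap.toContinuousLinearMap

theorem decay_smul_resolvent_add (x : EuclideanSpace ℝ (Fin n)) :
    𝒮.decay • 𝒮.resolvent x + 𝒮.R (𝒮.resolvent x) = x :=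
  (LinearEquiv.ofInjectiveEndo _ 𝒮.injective_decay_add_R).apply_symm_apply x

theorem inner_resolvent_self (x : EuclideanSpace ℝ (Fin n)) :
    inner ℝ (𝒮.resolvent x) x = 𝒮.decay * ‖𝒮.resolvent x‖ ^ 2
      + inner ℝ (𝒮.R (𝒮.resolvent x)) (𝒮.resolvent x) := by
  conv_lhs => enter [3]; rw [← 𝒮.decay_smul_resolvent_add x]
  rw [inner_add_right, inner_smul_right, real_inner_self_eq_norm_sq, 𝒮.R_symm]

theorem resolvent_symm (x y : EuclideanSpace ℝ (Fin n)) :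
    inner ℝ (𝒮.resolvent x) y = inner ℝ x (𝒮.resolvent y) := by
  conv_lhs => rw [← 𝒮.decay_smul_resolvent_add y]
  conv_rhs => rw [← 𝒮.decay_smul_resolvent_add x]
  simp only [inner_add_right, inner_add_left, inner_smul_left, inner_smul_right, 𝒮.R_symm,
    conj_trivial]

theorem R_eq_zero_of_inner_eq_zero {x : EuclideanSpace ℝ (Fin n)}
    (hx : inner ℝ (𝒮.R x) x = 0) : 𝒮.R x = 0 := by
  have h1 : ∀ t : ℝ, 0 ≤ 2 * t * ‖𝒮.R x‖ ^ 2 + t ^ 2 * inner ℝ (𝒮.R (𝒮.R x)) (𝒮.R x) := fun t => by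
    have h := 𝒮.R_nonneg (x + t • 𝒮.R x)
    simp only [map_add, map_smul, inner_add_left, inner_add_right, inner_smul_left,
      inner_smul_right, hx, conj_trivial, 𝒮.R_symm (𝒮.R x) x, real_inner_self_eq_norm_sq] at h
    linarith
  by_contra h
  have h2 : 0 < ‖𝒮.R x‖ ^ 2 := by positivity
  set A := inner ℝ (𝒮.R (𝒮.R x)) (𝒮.R x)
  have h3 : 0 ≤ A := 𝒮.R_nonneg _
  have h4 := h1 (-(‖𝒮.R x‖ ^ 2 / (A + 1)))
  have h5 : 2 * -(‖𝒮.R x‖ ^ 2 / (A + 1)) * ‖𝒮.R x‖ ^ 2 + (-(‖𝒮.R x‖ ^ 2 / (A + 1))) ^ 2 * A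
      = -((‖𝒮.R x‖ ^ 2) ^ 2 * (A + 2) / (A + 1) ^ 2) := by
    field_simp
    ring
  rw [h5] at h4
  have h6 : 0 < (‖𝒮.R x‖ ^ 2) ^ 2 * (A + 2) / (A + 1) ^ 2 := by positivity
  linarith

/-! ### The Lyapunov function -/

/-- The difference of the velocity and of the rescaled filter state. -/
def gap (y : RState n X) : EuclideanSpace ℝ (Fin n) := y.2.1 - (𝒮.lam / 𝒮.κ) • y.2.2.1

/-- The Lyapunov function, with reference point `gs`. -/
def lyapunov (gs : X) (y : RState n X) : ℝ :=
  (1 / 2) * ‖y.2.1‖ ^ 2 + (1 / 2) * (𝒮.coupling * inner ℝ (𝒮.resolvent (𝒮.gap y)) (𝒮.gap y))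
    + 𝒮.lam ^ 2 * 𝒮.αα' 0 * (𝒮.ψ y.1 - 𝒮.ψ gs) + 𝒮.lam ^ 2 * 𝒮.β (𝒮.err y)

/-- The decay of the Lyapunov function along the averaged system. -/
def dissipation (y : RState n X) : ℝ :=
  𝒮.coupling * ‖y.2.1 - 𝒮.decay • 𝒮.resolvent (𝒮.gap y)‖ ^ 2 + inner ℝ (𝒮.R y.2.1) y.2.1
    + 𝒮.decay * 𝒮.coupling * inner ℝ (𝒮.R (𝒮.resolvent (𝒮.gap y))) (𝒮.resolvent (𝒮.gap y))
    + 𝒮.lam ^ 2 * 𝒮.h * (𝒮.err y * (𝒮.αα' (𝒮.err y) - 𝒮.αα' 0))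

theorem dissipation_terms_nonneg (y : RState n X) :
    0 ≤ 𝒮.coupling * ‖y.2.1 - 𝒮.decay • 𝒮.resolvent (𝒮.gap y)‖ ^ 2 ∧
    0 ≤ inner ℝ (𝒮.R y.2.1) y.2.1 ∧
    0 ≤ 𝒮.decay * 𝒮.coupling *
      inner ℝ (𝒮.R (𝒮.resolvent (𝒮.gap y))) (𝒮.resolvent (𝒮.gap y)) ∧
    0 ≤ 𝒮.lam ^ 2 * 𝒮.h * (𝒮.err y * (𝒮.αα' (𝒮.err y) - 𝒮.αα' 0)) := by
  have h1 := 𝒮.decay_pos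
  have h2 := 𝒮.coupling_pos
  have h3 := 𝒮.h_pos
  have h4 := 𝒮.mul_αα'_sub_nonneg (𝒮.err y)
  have h5 := 𝒮.R_nonneg (𝒮.resolvent (𝒮.gap y))
  exact ⟨by positivity, 𝒮.R_nonneg _, by positivity, by positivity⟩

theorem dissipation_nonneg (y : RState n X) : 0 ≤ 𝒮.dissipation y := by
  obtain ⟨h1, h2, h3, h4⟩ := 𝒮.dissipation_terms_nonneg y
  rw [dissipation]
  linarith

theorem filter_eq_zero_of_dissipation_eq_zero {y : RState n X} (h : 𝒮.dissipation y = 0) :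
    y.2.2.1 = 0 := by
  obtain ⟨h1, h2, h3, h4⟩ := 𝒮.dissipation_terms_nonneg y
  rw [dissipation] at h
  have h5 : 𝒮.coupling * ‖y.2.1 - 𝒮.decay • 𝒮.resolvent (𝒮.gap y)‖ ^ 2 = 0 := by linarith
  have h6 : 𝒮.decay * 𝒮.coupling *
      inner ℝ (𝒮.R (𝒮.resolvent (𝒮.gap y))) (𝒮.resolvent (𝒮.gap y)) = 0 := by linarith
  have h7 : y.2.1 - 𝒮.decay • 𝒮.resolvent (𝒮.gap y) = 0 := by
    simpa [𝒮.coupling_pos.ne'] using h5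
  have h8 : 𝒮.R (𝒮.resolvent (𝒮.gap y)) = 0 := 𝒮.R_eq_zero_of_inner_eq_zero (by
    simpa [𝒮.coupling_pos.ne', 𝒮.decay_pos.ne'] using h6)
  have h9 := 𝒮.decay_smul_resolvent_add (𝒮.gap y)
  rw [h8, add_zero, ← sub_eq_zero.1 h7, gap, eq_comm, sub_eq_self] at h9
  exact (smul_eq_zero.1 h9).resolve_left (div_pos 𝒮.lam_pos 𝒮.κ_pos).ne'

theorem err_eq_zero_of_dissipation_eq_zero {y : RState n X} (h : 𝒮.dissipation y = 0) :
    𝒮.err y = 0 := by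
  obtain ⟨h1, h2, h3, h4⟩ := 𝒮.dissipation_terms_nonneg y
  rw [dissipation] at h
  have h5 : 𝒮.lam ^ 2 * 𝒮.h * (𝒮.err y * (𝒮.αα' (𝒮.err y) - 𝒮.αα' 0)) = 0 := by linarith
  by_contra hne
  have := mul_pos (mul_pos (pow_pos 𝒮.lam_pos 2) 𝒮.h_pos) (𝒮.mul_αα'_sub_pos hne)
  linarith

theorem locallyLipschitz_dissipation : LocallyLipschitz 𝒮.dissipation := by
  have h3 := 𝒮.contDiff_αα'
  have hz : ContDiff ℝ 1 fun z : (EuclideanSpace ℝ (Fin n) →L[ℝ] EuclideanSpace ℝ (Fin N)) ×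
      EuclideanSpace ℝ (Fin n) × ℝ × EuclideanSpace ℝ (Fin n) × EuclideanSpace ℝ (Fin n) × ℝ =>
      𝒮.resolvent (z.2.2.2.1 - (𝒮.lam / 𝒮.κ) • z.2.2.2.2.1) :=
    𝒮.resolvent.contDiff.comp (by fun_prop)
  have hv : ContDiff ℝ 1 fun z : (EuclideanSpace ℝ (Fin n) →L[ℝ] EuclideanSpace ℝ (Fin N)) ×
      EuclideanSpace ℝ (Fin n) × ℝ × EuclideanSpace ℝ (Fin n) × EuclideanSpace ℝ (Fin n) × ℝ =>
      z.2.2.2.1 := by fun_prop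
  have hs : ContDiff ℝ 1 fun z : (EuclideanSpace ℝ (Fin n) →L[ℝ] EuclideanSpace ℝ (Fin N)) ×
      EuclideanSpace ℝ (Fin n) × ℝ × EuclideanSpace ℝ (Fin n) × EuclideanSpace ℝ (Fin n) × ℝ =>
      (z.2.2.1 - z.2.2.2.2.2) * (𝒮.αα' (z.2.2.1 - z.2.2.2.2.2) - 𝒮.αα' 0) := by fun_prop
  exact 𝒮.locallyLipschitz_of_contDiff
    (((contDiff_const.mul ((hv.sub (hz.const_smul 𝒮.decay)).norm_sq ℝ)).add
      ((𝒮.R.contDiff.comp hv).inner ℝ hv)).add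
      (contDiff_const.mul ((𝒮.R.contDiff.comp hz).inner ℝ hz)) |>.add (contDiff_const.mul hs))

omit 𝒮 in
theorem lyapunov_identity {E : Type*} [NormedAddCommGroup E] [InnerProductSpace ℝ E]
    (R : E →L[ℝ] E) (hR : ∀ v w, inner ℝ (R v) w = inner ℝ v (R w)) {v π p U z x : E}
    {c d l q q₀ m k s h e : ℝ} (hz : z = c • π + R π) (hq : l ^ 2 * q = m * k)
    (hx : x = v + m • U) (he : e = inner ℝ p x - h * s) :
    1 / 2 * (2 * inner ℝ v (- R x - d • (v - z) - (k * e) • U))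
      + 1 / 2 * (d * (inner ℝ π (- R x + c • (v - z)) + inner ℝ (- R x + c • (v - z)) π))
      + l ^ 2 * q₀ * inner ℝ p x + l ^ 2 * ((q - q₀) * e)
    = -(d * ‖v - c • π‖ ^ 2 + inner ℝ (R v) v + c * d * inner ℝ (R π) π
        + l ^ 2 * h * (s * (q - q₀)))
      - inner ℝ ((-(l ^ 2 * q)) • p) v
      + inner ℝ (-m • R v - (k * (inner ℝ p v - h * s)) • v - (d * m) • R π
        + (l ^ 2 * q * m) • p) U
      + inner ℝ ((-(l ^ 2 * q)) • p) U * inner ℝ v U := by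
  subst hz hx he
  have e1 := real_inner_comm v π
  have e2 : inner ℝ π (R v) = inner ℝ v (R π) := by rw [← hR, real_inner_comm]
  have e3 : inner ℝ U (R π) = inner ℝ π (R U) := by rw [← hR, real_inner_comm]
  simp only [← real_inner_self_eq_norm_sq, inner_add_left, inner_add_right, inner_sub_left,
    inner_sub_right, inner_neg_left, inner_neg_right, inner_smul_left, inner_smul_right, map_add,
    map_smul, conj_trivial, hR, e3, e2, e1, neg_mul]
  linear_combination (inner ℝ p U * inner ℝ v U) * hq

theorem hasAverage_lyapunov {K : Set (RState n X)} (hK : IsCompact K) (gs : X) :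
    HasAverage 𝒮.IsTrajectory K (𝒮.lyapunov gs) (fun y => - 𝒮.dissipation y) := by
  have h1 : ContDiff ℝ 1 𝒮.α := 𝒮.α_smooth.of_le (WithTop.coe_le_coe.2 (le_top : (1 : ℕ∞) ≤ ⊤))
  have h2 : ContDiff ℝ 1 (deriv 𝒮.α) :=
    𝒮.contDiff_deriv_α.of_le (WithTop.coe_le_coe.2 (le_top : (1 : ℕ∞) ≤ ⊤))
  have h3 := 𝒮.contDiff_αα'
  refine hasAverage_of_quadratic (𝒮 := 𝒮) hK
    (A := fun y => - (𝒮.lam * 𝒮.α (𝒮.err y)) • 𝒮.R y.2.1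
      - (𝒮.lam * deriv 𝒮.α (𝒮.err y) * (inner ℝ (𝒮.p y.1) y.2.1 - 𝒮.h * 𝒮.err y)) • y.2.1
      - (𝒮.coupling * (𝒮.lam * 𝒮.α (𝒮.err y))) • 𝒮.R (𝒮.resolvent (𝒮.gap y))
      + (𝒮.lam ^ 2 * 𝒮.αα' (𝒮.err y) * (𝒮.lam * 𝒮.α (𝒮.err y))) • 𝒮.p y.1)
    (B := fun y => (- (𝒮.lam ^ 2 * 𝒮.αα' (𝒮.err y))) • 𝒮.p y.1)
    (C := fun y => y.2.1) 𝒮.locallyLipschitz_dissipation.continuous.neg ?_ ?_ ?_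
    fun om J y hy t ht => ?_
  · have hz : ContDiff ℝ 1 fun z : (EuclideanSpace ℝ (Fin n) →L[ℝ] EuclideanSpace ℝ (Fin N)) ×
        EuclideanSpace ℝ (Fin n) × ℝ × EuclideanSpace ℝ (Fin n) × EuclideanSpace ℝ (Fin n) × ℝ =>
        𝒮.R (𝒮.resolvent (z.2.2.2.1 - (𝒮.lam / 𝒮.κ) • z.2.2.2.2.1)) :=
      𝒮.R.contDiff.comp (𝒮.resolvent.contDiff.comp (by fun_prop))
    have hv : ContDiff ℝ 1 fun z : (EuclideanSpace ℝ (Fin n) →L[ℝ] EuclideanSpace ℝ (Fin N)) ×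
        EuclideanSpace ℝ (Fin n) × ℝ × EuclideanSpace ℝ (Fin n) × EuclideanSpace ℝ (Fin n) × ℝ =>
        z.2.2.2.1 := by fun_prop
    have hp : ContDiff ℝ 1 fun z : (EuclideanSpace ℝ (Fin n) →L[ℝ] EuclideanSpace ℝ (Fin N)) ×
        EuclideanSpace ℝ (Fin n) × ℝ × EuclideanSpace ℝ (Fin n) × EuclideanSpace ℝ (Fin n) × ℝ =>
        z.2.1 := by fun_prop
    have hs : ContDiff ℝ 1 fun z : (EuclideanSpace ℝ (Fin n) →L[ℝ] EuclideanSpace ℝ (Fin N)) ×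
        EuclideanSpace ℝ (Fin n) × ℝ × EuclideanSpace ℝ (Fin n) × EuclideanSpace ℝ (Fin n) × ℝ =>
        z.2.2.1 - z.2.2.2.2.2 := by fun_prop
    have hm := contDiff_const (c := 𝒮.lam) |>.mul (h1.comp hs)
    exact 𝒮.locallyLipschitz_of_contDiff
      (((hm.neg.smul (𝒮.R.contDiff.comp hv)).sub
        (((contDiff_const.mul (h2.comp hs)).mul
          ((hp.inner ℝ hv).sub (contDiff_const.mul hs))).smul hv)).sub
        ((contDiff_const.mul hm).smul hz) |>.add
        (((contDiff_const.mul (h3.comp hs)).mul hm).smul hp))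
  · refine 𝒮.locallyLipschitz_of_contDiff
      (g := fun z => (-(𝒮.lam ^ 2 * 𝒮.αα' (z.2.2.1 - z.2.2.2.2.2))) • z.2.1) ?_
    fun_prop
  · exact 𝒮.locallyLipschitz_of_contDiff (g := fun z => z.2.2.2.1) (by fun_prop)
  · have hv := hy.hasDerivWithinAt_velocity ht
    have hw := hy.hasDerivWithinAt_filter ht
    have hψ := hy.hasDerivWithinAt_ψ ht
    have hβ := (𝒮.hasDerivAt_β (𝒮.err (y t))).comp_hasDerivWithinAt t (hy.hasDerivWithinAt_err ht)
    have hz := hv.sub (hw.const_smul (𝒮.lam / 𝒮.κ))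
    have hPz := 𝒮.resolvent.hasFDerivAt.comp_hasDerivWithinAt t hz
    have hV := (((hv.norm_sq.const_mul (1 / 2)).add
      (((hPz.inner ℝ hz).const_mul 𝒮.coupling).const_mul (1 / 2))).add
      ((hψ.sub_const (𝒮.ψ gs)).const_mul (𝒮.lam ^ 2 * 𝒮.αα' 0))).add (hβ.const_mul (𝒮.lam ^ 2))
    refine HasDerivWithinAt.congr_deriv (f := 𝒮.lyapunov gs ∘ y) hV ?_
    have hκ := 𝒮.κ_pos.ne'
    have hl := 𝒮.lam_pos.ne'
    set U := 𝒮.U (om * t)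
    set v := (y t).2.1 with hvdef
    set e := 𝒮.errDeriv U (y t) with he
    set z := 𝒮.gap (y t) with hzdef
    have hbw : 𝒮.b • (y t).2.2.1 = 𝒮.coupling • (v - z) := by
      rw [hzdef, gap, sub_sub_cancel, smul_smul, coupling]
      congr 1
      field_simp
    have hf1 : (𝒮.field U (y t)).2.1 = - 𝒮.R (𝒮.vel U (y t)) - 𝒮.coupling • (v - z)
        - (𝒮.lam * deriv 𝒮.α (𝒮.err (y t)) * e) • U := by
      rw [← hbw]
      rfl
    have hf2 : (𝒮.field U (y t)).2.1 - (𝒮.lam / 𝒮.κ) • (𝒮.field U (y t)).2.2.1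
        = - 𝒮.R (𝒮.vel U (y t)) + 𝒮.decay • (v - z) := by
      have e1 : (𝒮.lam / 𝒮.κ) • (𝒮.field U (y t)).2.2.1
          = - (𝒮.a • (v - z)) - (𝒮.lam * deriv 𝒮.α (𝒮.err (y t)) * e) • U := by
        have e2 : (𝒮.field U (y t)).2.2.1
          = - 𝒮.a • (y t).2.2.1 - (𝒮.κ * deriv 𝒮.α (𝒮.err (y t)) * e) • U := rfl
        rw [e2, hzdef, gap, sub_sub_cancel, smul_sub, smul_smul, smul_smul, smul_smul, ← neg_smul]
        congr 2
        · ring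
        · field_simp
      rw [e1, hf1, ← 𝒮.decay_add_coupling, add_smul]
      abel
    have hz' : (y t).2.1 - (𝒮.lam / 𝒮.κ) • (y t).2.2.1 = z := rfl
    have hzπ := 𝒮.decay_smul_resolvent_add z
    simp only [Pi.sub_apply, Pi.smul_apply, hf2, Function.comp_apply]
    rw [hf1]
    rw [hz', 𝒮.resolvent_symm _ z]
    have hdis : 𝒮.dissipation (y t) = 𝒮.coupling * ‖v - 𝒮.decay • 𝒮.resolvent z‖ ^ 2
        + inner ℝ (𝒮.R v) v + 𝒮.decay * 𝒮.coupling * inner ℝ (𝒮.R (𝒮.resolvent z)) (𝒮.resolvent z)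
        + 𝒮.lam ^ 2 * 𝒮.h * (𝒮.err (y t) * (𝒮.αα' (𝒮.err (y t)) - 𝒮.αα' 0)) := rfl
    have hq : 𝒮.lam ^ 2 * 𝒮.αα' (𝒮.err (y t))
        = (𝒮.lam * 𝒮.α (𝒮.err (y t))) * (𝒮.lam * deriv 𝒮.α (𝒮.err (y t))) := by
      rw [αα']
      ring
    rw [hdis]
    exact lyapunov_identity 𝒮.R 𝒮.R_symm hzπ.symm hq rfl he

end ReducedSystem

end ExtremumSeeking
end

noncomputable section

namespace ExtremumSeeking

namespace ReducedSystem

variable {n N : ℕ} {X : Type*} [MetricSpace X] (𝒮 : ReducedSystem n N X)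

theorem p_eq_zero_of_isLocalMin {x : X} (hx : IsLocalMin 𝒮.ψ x) : 𝒮.p x = 0 := by
  obtain ⟨σ, u₀, b, hσ, -, hσl, hA⟩ := 𝒮.chart x
  obtain ⟨A, hAd, hAb⟩ := hA.self_of_nhds
  set ξ := 𝒮.p x
  set γ : ℝ → X := fun τ => σ (u₀ + τ • b u₀ ξ) with hγ
  have hγ0 : γ 0 = x := by simp [hγ, hσ]
  have hl : HasDerivAt (fun τ : ℝ => u₀ + τ • b u₀ ξ) (b u₀ ξ) 0 := by
    simpa using ((hasDerivAt_id (0 : ℝ)).smul_const (b u₀ ξ)).const_add u₀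
  have h0 : u₀ + (0 : ℝ) • b u₀ ξ = u₀ := by simp
  have h1 : HasDerivAt (𝒮.ι ∘ γ) (𝒮.D (γ 0) ξ) 0 := by
    have h2 := HasFDerivAt.comp_hasDerivAt (0 : ℝ) (l := 𝒮.ι ∘ σ) (l' := A)
      (f := fun τ : ℝ => u₀ + τ • b u₀ ξ) (by rwa [h0]) hl
    rw [hAb, hσ, ← hγ0] at h2
    exact h2
  have h3 := (𝒮.chain γ univ 0 ξ h1.hasDerivWithinAt).hasDerivAt univ_mem
  have hγc : ContinuousAt γ 0 :=
    ContinuousAt.comp (f := fun τ : ℝ => u₀ + τ • b u₀ ξ) (g := σ)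
      (by rw [h0]; exact hσl.continuousAt) hl.continuousAt
  have h4 : IsLocalMin (𝒮.ψ ∘ γ) 0 := by
    have : ∀ᶠ z in 𝓝 (γ 0), 𝒮.ψ (γ 0) ≤ 𝒮.ψ z := by rw [hγ0]; exact hx
    exact hγc.eventually this
  have h5 := h4.hasDerivAt_eq_zero h3
  rw [hγ0] at h5
  exact inner_self_eq_zero.1 h5

section SublevelComponent

omit 𝒮 in
theorem _root_.ExtremumSeeking.sublevelComponent_mem_nhds {Z : Type*} [TopologicalSpace Z]
    [LocallyConnectedSpace Z] {f : Z → ℝ} (hf : Continuous f) {c : ℝ} {x z : Z}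
    (hz : z ∈ sublevelComponent f c x) (hzc : f z < c) : sublevelComponent f c x ∈ 𝓝 z := by
  have h : {w | f w ≤ c} ∈ 𝓝 z :=
    mem_of_superset ((isOpen_lt hf continuous_const).mem_nhds hzc) fun w hw => show f w ≤ c from le_of_lt hw
  rw [sublevelComponent, connectedComponentIn_eq hz]
  exact connectedComponentIn_mem_nhds h

omit 𝒮 in
theorem _root_.ExtremumSeeking.isClosed_sublevelComponent {Z : Type*} [TopologicalSpace Z]
    {f : Z → ℝ} (hf : Continuous f) (c : ℝ) (x : Z) : IsClosed (sublevelComponent f c x) := by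
  by_cases hx : x ∈ {z | f z ≤ c}
  · refine isClosed_of_closure_subset ?_
    have hcl : IsClosed {z | f z ≤ c} := isClosed_le hf continuous_const
    exact isPreconnected_connectedComponentIn.closure.subset_connectedComponentIn
      (subset_closure (mem_connectedComponentIn hx))
      (closure_minimal (connectedComponentIn_subset _ _) hcl)
  · rw [sublevelComponent, connectedComponentIn_eq_empty hx]
    exact isClosed_empty

variable [LocallyConnectedSpace X] {gs : X} {y₀ : ℝ} (hy₀ : 𝒮.ψ gs < y₀)
  (hcompact : IsCompact (sublevelComponent 𝒮.ψ y₀ gs))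
  (hcrit : ∀ x ∈ sublevelComponent 𝒮.ψ y₀ gs, x ≠ gs → 𝒮.p x ≠ 0)

include hy₀ hcompact hcrit

theorem ψ_lt_of_mem {x : X} (hx : x ∈ sublevelComponent 𝒮.ψ y₀ gs) (hne : x ≠ gs) :
    𝒮.ψ gs < 𝒮.ψ x := by
  have hψ := 𝒮.ψ_lip.continuous
  have hgs : gs ∈ sublevelComponent 𝒮.ψ y₀ gs := mem_connectedComponentIn (le_of_lt hy₀)
  obtain ⟨m, hm, hmin⟩ := hcompact.exists_isMinOn ⟨gs, hgs⟩ hψ.continuousOn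
  have key : ∀ z ∈ sublevelComponent 𝒮.ψ y₀ gs, 𝒮.ψ z ≤ 𝒮.ψ m → z = gs := fun z hz hzm => by
    by_contra h
    refine hcrit z hz h (𝒮.p_eq_zero_of_isLocalMin ?_)
    have hzy : 𝒮.ψ z < y₀ := (hzm.trans (hmin hgs)).trans_lt hy₀
    filter_upwards [sublevelComponent_mem_nhds hψ hz hzy] with w hw
    exact hzm.trans (hmin hw)
  have hm' : m = gs := key m hm le_rfl
  by_contra! h
  exact hne (key x hx (hm' ▸ h))

/-- A neighborhood of the sublevel component on which `ψ` has no other minimizer and no other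
critical point than `gs`. -/
theorem exists_open_nhd : ∃ O : Set X, IsOpen O ∧ sublevelComponent 𝒮.ψ y₀ gs ⊆ O ∧
    ∀ x ∈ O, x ≠ gs → 𝒮.ψ gs < 𝒮.ψ x ∧ 𝒮.p x ≠ 0 := by
  have hψ := 𝒮.ψ_lip.continuous
  have hgs : gs ∈ sublevelComponent 𝒮.ψ y₀ gs := mem_connectedComponentIn (le_of_lt hy₀)
  refine ⟨interior (sublevelComponent 𝒮.ψ y₀ gs) ∪ {x | 𝒮.ψ gs < 𝒮.ψ x ∧ 𝒮.p x ≠ 0},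
    isOpen_interior.union ((isOpen_lt continuous_const hψ).inter
      (isOpen_ne_fun 𝒮.p_lip.continuous continuous_const)), fun x hx => ?_, ?_⟩
  · by_cases h : x = gs
    · subst h
      exact Or.inl (mem_interior_iff_mem_nhds.2 (sublevelComponent_mem_nhds hψ hgs hy₀))
    · exact Or.inr ⟨𝒮.ψ_lt_of_mem hy₀ hcompact hcrit hx h, hcrit x hx h⟩
  · rintro x (hx | hx) hne
    · exact ⟨𝒮.ψ_lt_of_mem hy₀ hcompact hcrit (interior_subset hx) hne,
        hcrit x (interior_subset hx) hne⟩
    · exact hx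

end SublevelComponent

/-! ### Properties of the Lyapunov function -/

/-- The equilibrium. -/
def equilibrium (gs : X) : RState n X := (gs, 0, 0, 𝒮.ψ gs)

theorem continuous_err : Continuous 𝒮.err := by
  have := 𝒮.ψ_lip.continuous
  unfold err
  fun_prop

theorem continuous_gap : Continuous 𝒮.gap := by
  unfold gap
  fun_prop

theorem continuous_lyapunov (gs : X) : Continuous (𝒮.lyapunov gs) := by
  have h1 := 𝒮.ψ_lip.continuous
  have h2 := 𝒮.continuous_err
  have h3 := 𝒮.continuous_gap
  have h4 := 𝒮.continuous_β
  have h5 : Continuous fun y => inner ℝ (𝒮.resolvent (𝒮.gap y)) (𝒮.gap y) :=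
    (𝒮.resolvent.continuous.comp h3).inner h3
  unfold lyapunov
  fun_prop

theorem lyapunov_equilibrium (gs : X) : 𝒮.lyapunov gs (𝒮.equilibrium gs) = 0 := by
  simp [lyapunov, equilibrium, gap, err, β_zero]

theorem decay_mul_norm_sq_le (x : EuclideanSpace ℝ (Fin n)) :
    𝒮.decay * ‖𝒮.resolvent x‖ ^ 2 ≤ inner ℝ (𝒮.resolvent x) x := by
  rw [inner_resolvent_self]
  linarith [𝒮.R_nonneg (𝒮.resolvent x)]

theorem lyapunov_terms_nonneg (y : RState n X) :
    0 ≤ 𝒮.coupling * inner ℝ (𝒮.resolvent (𝒮.gap y)) (𝒮.gap y) ∧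
      0 ≤ 𝒮.lam ^ 2 * 𝒮.β (𝒮.err y) := by
  have h1 := 𝒮.decay_mul_norm_sq_le (𝒮.gap y)
  have h2 := 𝒮.decay_pos
  have h3 := 𝒮.coupling_pos
  have h4 := 𝒮.β_nonneg (𝒮.err y)
  have h5 : 0 ≤ 𝒮.decay * ‖𝒮.resolvent (𝒮.gap y)‖ ^ 2 := by positivity
  exact ⟨mul_nonneg h3.le (h5.trans h1), by positivity⟩

theorem le_lyapunov (gs : X) (y : RState n X) :
    𝒮.lam ^ 2 * 𝒮.αα' 0 * (𝒮.ψ y.1 - 𝒮.ψ gs) ≤ 𝒮.lyapunov gs y := by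
  obtain ⟨h1, h2⟩ := 𝒮.lyapunov_terms_nonneg y
  rw [lyapunov]
  nlinarith [sq_nonneg ‖y.2.1‖]

theorem level_pos : 0 < 𝒮.lam ^ 2 * 𝒮.αα' 0 := mul_pos (pow_pos 𝒮.lam_pos 2) (𝒮.αα'_pos 0)

theorem eq_zero_of_resolvent_eq_zero {x : EuclideanSpace ℝ (Fin n)} (h : 𝒮.resolvent x = 0) :
    x = 0 := by
  rw [← 𝒮.decay_smul_resolvent_add x, h]
  simp

theorem lyapunov_pos {gs : X} {y : RState n X} (hy : y.1 ≠ gs → 𝒮.ψ gs < 𝒮.ψ y.1)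
    (hne : y ≠ 𝒮.equilibrium gs) : 0 < 𝒮.lyapunov gs y := by
  by_cases hg : y.1 = gs
  · obtain ⟨h1, h2⟩ := 𝒮.lyapunov_terms_nonneg y
    by_contra! hV
    rw [lyapunov, hg, sub_self, mul_zero, add_zero] at hV
    have h3 : ‖y.2.1‖ ^ 2 = 0 := by nlinarith [sq_nonneg ‖y.2.1‖]
    have h4 : 𝒮.coupling * inner ℝ (𝒮.resolvent (𝒮.gap y)) (𝒮.gap y) = 0 := by
      nlinarith [sq_nonneg ‖y.2.1‖]
    have h5 : 𝒮.lam ^ 2 * 𝒮.β (𝒮.err y) = 0 := by nlinarith [sq_nonneg ‖y.2.1‖]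
    have hv : y.2.1 = 0 := by simpa using h3
    have hs : 𝒮.err y = 0 := by
      by_contra h
      have := mul_pos (pow_pos 𝒮.lam_pos 2) (𝒮.β_pos h)
      linarith
    have h6 : inner ℝ (𝒮.resolvent (𝒮.gap y)) (𝒮.gap y) = 0 :=
      (mul_eq_zero.1 h4).resolve_left 𝒮.coupling_pos.ne'
    have h7 := 𝒮.decay_mul_norm_sq_le (𝒮.gap y)
    rw [h6] at h7
    have h8 : 𝒮.resolvent (𝒮.gap y) = 0 := by
      by_contra h
      have h9 : 0 < ‖𝒮.resolvent (𝒮.gap y)‖ ^ 2 := by positivity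
      nlinarith [mul_pos 𝒮.decay_pos h9]
    have h10 := 𝒮.eq_zero_of_resolvent_eq_zero h8
    rw [gap, hv, zero_sub, neg_eq_zero] at h10
    have hw := (smul_eq_zero.1 h10).resolve_left (div_pos 𝒮.lam_pos 𝒮.κ_pos).ne'
    have hη : y.2.2.2 = 𝒮.ψ gs := by rw [err, hg] at hs; linarith
    exact hne (Prod.ext hg (Prod.ext hv (Prod.ext hw hη)))
  · have h1 := 𝒮.le_lyapunov gs y
    have h2 := mul_pos 𝒮.level_pos (sub_pos.2 (hy hg))
    linarith

/-- The sublevel component of the Lyapunov function at the equilibrium. -/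
def region (gs : X) (y₀ : ℝ) : Set (RState n X) :=
  sublevelComponent (𝒮.lyapunov gs) (𝒮.lam ^ 2 * 𝒮.αα' 0 * (y₀ - 𝒮.ψ gs)) (𝒮.equilibrium gs)

section Region

variable {gs : X} {y₀ : ℝ} (hy₀ : 𝒮.ψ gs < y₀)

theorem lyapunov_le_of_mem_region {y : RState n X} (hy : y ∈ 𝒮.region gs y₀) :
    𝒮.lyapunov gs y ≤ 𝒮.lam ^ 2 * 𝒮.αα' 0 * (y₀ - 𝒮.ψ gs) :=
  connectedComponentIn_subset {y | 𝒮.lyapunov gs y ≤ 𝒮.lam ^ 2 * 𝒮.αα' 0 * (y₀ - 𝒮.ψ gs)} _ hy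

include hy₀

theorem equilibrium_mem_region : 𝒮.equilibrium gs ∈ 𝒮.region gs y₀ := by
  refine mem_connectedComponentIn ?_
  rw [mem_ofPred_eq, lyapunov_equilibrium]
  exact (mul_pos 𝒮.level_pos (sub_pos.2 hy₀)).le

theorem fst_mem_of_mem_region {y : RState n X} (hy : y ∈ 𝒮.region gs y₀) :
    y.1 ∈ sublevelComponent 𝒮.ψ y₀ gs := by
  have h : Prod.fst '' 𝒮.region gs y₀ ⊆ sublevelComponent 𝒮.ψ y₀ gs := by
    refine IsPreconnected.subset_connectedComponentIn
      (isPreconnected_connectedComponentIn.image _ continuous_fst.continuousOn)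
      ⟨_, 𝒮.equilibrium_mem_region hy₀, rfl⟩ ?_
    rintro _ ⟨z, hz, rfl⟩
    have h1 := (𝒮.le_lyapunov gs z).trans (𝒮.lyapunov_le_of_mem_region hz)
    have h2 := le_of_mul_le_mul_left h1 𝒮.level_pos
    change 𝒮.ψ z.1 ≤ y₀
    linarith
  exact h (mem_image_of_mem _ hy)

variable (hcompact : IsCompact (sublevelComponent 𝒮.ψ y₀ gs))
include hcompact

theorem isCompact_region (hmin : ∀ x ∈ sublevelComponent 𝒮.ψ y₀ gs, 𝒮.ψ gs ≤ 𝒮.ψ x) :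
    IsCompact (𝒮.region gs y₀) := by
  set c := 𝒮.lam ^ 2 * 𝒮.αα' 0 * (y₀ - 𝒮.ψ gs) with hc
  have hl := 𝒮.lam_pos
  have hκ := 𝒮.κ_pos
  have hdec := 𝒮.decay_pos
  have hcoup := 𝒮.coupling_pos
  obtain ⟨B, hB⟩ := 𝒮.exists_abs_le_of_β_le (c / 𝒮.lam ^ 2)
  obtain ⟨M, hM⟩ := hcompact.exists_bound_of_continuousOn 𝒮.ψ_lip.continuous.continuousOn
  set r₁ := √(2 * c)
  set r₂ := √(2 * c / (𝒮.decay * 𝒮.coupling))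
  set r₃ := (𝒮.κ / 𝒮.lam) * (r₁ + (𝒮.decay * r₂ + ‖𝒮.R‖ * r₂))
  refine IsCompact.of_isClosed_subset (hcompact.prod
    ((isCompact_closedBall (0 : EuclideanSpace ℝ (Fin n)) r₁).prod
    ((isCompact_closedBall (0 : EuclideanSpace ℝ (Fin n)) r₃).prod
      (isCompact_closedBall (0 : ℝ) (M + B)))))
    (isClosed_sublevelComponent (𝒮.continuous_lyapunov gs) _ _) fun y hy => ?_
  have h0 := 𝒮.fst_mem_of_mem_region hy₀ hy
  have hV := 𝒮.lyapunov_le_of_mem_region hy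
  obtain ⟨h1, h2⟩ := 𝒮.lyapunov_terms_nonneg y
  have h3 := mul_nonneg 𝒮.level_pos.le (sub_nonneg.2 (hmin _ h0))
  rw [lyapunov, ← hc] at hV
  have hv : ‖y.2.1‖ ≤ r₁ := Real.le_sqrt_of_sq_le (by linarith)
  have hP : ‖𝒮.resolvent (𝒮.gap y)‖ ≤ r₂ := by
    refine Real.le_sqrt_of_sq_le ?_
    rw [le_div_iff₀ (by positivity)]
    have h4 := mul_le_mul_of_nonneg_left (𝒮.decay_mul_norm_sq_le (𝒮.gap y)) hcoup.le
    nlinarith [sq_nonneg ‖y.2.1‖]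
  have hs : |𝒮.err y| ≤ B := by
    refine hB _ ?_
    rw [le_div_iff₀ (by positivity)]
    nlinarith [sq_nonneg ‖y.2.1‖]
  have hz : ‖𝒮.gap y‖ ≤ 𝒮.decay * r₂ + ‖𝒮.R‖ * r₂ := by
    calc ‖𝒮.gap y‖ = ‖𝒮.decay • 𝒮.resolvent (𝒮.gap y) + 𝒮.R (𝒮.resolvent (𝒮.gap y))‖ := by
          rw [𝒮.decay_smul_resolvent_add]
      _ ≤ 𝒮.decay * ‖𝒮.resolvent (𝒮.gap y)‖ + ‖𝒮.R‖ * ‖𝒮.resolvent (𝒮.gap y)‖ := by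
          refine (norm_add_le _ _).trans (add_le_add ?_ (𝒮.R.le_opNorm _))
          rw [norm_smul, Real.norm_of_nonneg hdec.le]
      _ ≤ _ := by gcongr
  have hw : ‖y.2.2.1‖ ≤ r₃ := by
    have h4 : y.2.2.1 = (𝒮.κ / 𝒮.lam) • (y.2.1 - 𝒮.gap y) := by
      rw [gap, sub_sub_cancel, smul_smul, div_mul_div_cancel₀ hl.ne', div_self hκ.ne', one_smul]
    rw [h4, norm_smul, Real.norm_of_nonneg (by positivity)]
    have h5 := norm_sub_le y.2.1 (𝒮.gap y)
    exact mul_le_mul_of_nonneg_left (by linarith) (by positivity)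
  have hη : ‖y.2.2.2‖ ≤ M + B := by
    have h4 : y.2.2.2 = 𝒮.ψ y.1 - 𝒮.err y := by rw [err]; ring
    rw [h4]
    exact (norm_sub_le _ _).trans (add_le_add (hM _ h0) hs)
  exact ⟨h0, by simpa using hv, by simpa using hw, by simpa using hη⟩

end Region

/-- The maximal solutions of the reduced system. -/
def IsMaximalTrajectory (om t₀ : ℝ) (J : Set ℝ) (y : ℝ → RState n X) : Prop :=
  IsMaximalSolution 𝒮.Φ (fun t y => 𝒮.field (𝒮.U (om * t)) y) t₀ (y t₀) J y

/-- Practical stability of the reduced system. -/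
theorem practicallyStable [LocallyConnectedSpace X] {gs : X} {y₀ : ℝ} (hy₀ : 𝒮.ψ gs < y₀)
    (hcompact : IsCompact (sublevelComponent 𝒮.ψ y₀ gs))
    (hcrit : ∀ x ∈ sublevelComponent 𝒮.ψ y₀ gs, x ≠ gs → 𝒮.p x ≠ 0) :
    𝒮.region gs y₀ ∈ 𝓝 (𝒮.equilibrium gs) ∧
    (∀ ε > 0, ∃ om₀ > 0, ∃ δ > 0, ∀ om ≥ om₀, ∀ t₀ J y, 𝒮.IsMaximalTrajectory om t₀ J y →
      dist (y t₀) (𝒮.equilibrium gs) ≤ δ → ∀ t ≥ t₀, t ∈ J ∧ dist (y t) (𝒮.equilibrium gs) ≤ ε) ∧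
    ∃ K : Set (RState n X), IsCompact K ∧ ∀ ε > 0, ∃ om₀ > 0, ∃ Δ > 0, ∀ om ≥ om₀, ∀ t₀ J y,
      𝒮.IsMaximalTrajectory om t₀ J y → y t₀ ∈ 𝒮.region gs y₀ →
      (∀ t ≥ t₀, t ∈ J ∧ y t ∈ K) ∧ ∀ t ≥ t₀ + Δ, dist (y t) (𝒮.equilibrium gs) ≤ ε := by
  have : ProperSpace X := 𝒮.properSpace
  have hVc := 𝒮.continuous_lyapunov gs
  have hV₀ : 0 < 𝒮.lam ^ 2 * 𝒮.αα' 0 * (y₀ - 𝒮.ψ gs) := mul_pos 𝒮.level_pos (sub_pos.2 hy₀)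
  have hVe := 𝒮.lyapunov_equilibrium gs
  have hmem := 𝒮.equilibrium_mem_region hy₀
  obtain ⟨O, hO, hKO, hOp⟩ := 𝒮.exists_open_nhd hy₀ hcompact hcrit
  have hcpt : IsCompact (𝒮.region gs y₀) := 𝒮.isCompact_region hy₀ hcompact fun x hx => by
    by_cases h : x = gs
    · rw [h]
    · exact (𝒮.ψ_lt_of_mem hy₀ hcompact hcrit hx h).le
  obtain ⟨W, K, hW, hK, hSW, hWK, hKO', V₁, hV₁, hWV⟩ := exists_isolating_nhd hVc
    (x := 𝒮.equilibrium gs) (hVe.trans_le hV₀.le) hcpt (O := Prod.fst ⁻¹' O)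
    (hO.preimage continuous_fst) fun y hy => hKO (𝒮.fst_mem_of_mem_region hy₀ hy)
  have hpK : ∀ y ∈ K, 𝒮.p y.1 = 0 → y.1 = gs := fun y hy hp => by
    by_contra h
    exact (hOp _ (hKO' hy) h).2 hp
  have hzero : ∀ y ∈ K, 𝒮.dissipation y = 0 →
      (∀ k, - 𝒮.a * y.2.2.1 k - 𝒮.κ * 𝒮.lam * 𝒮.αα' (𝒮.err y) * 𝒮.p y.1 k = 0) →
        y.1 = gs := fun y hy hq hF => by
    refine hpK y hy ?_
    ext k
    have h1 := hF k
    rw [𝒮.filter_eq_zero_of_dissipation_eq_zero hq] at h1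
    have h2 := mul_pos (mul_pos 𝒮.κ_pos 𝒮.lam_pos) (𝒮.αα'_pos (𝒮.err y))
    simpa [𝒮.κ_pos.ne', 𝒮.lam_pos.ne', (𝒮.αα'_pos (𝒮.err y)).ne'] using h1
  have hmono : ∀ om J J' (y : ℝ → RState n X), 𝒮.IsTrajectory om J y → J' ⊆ J →
      𝒮.IsTrajectory om J' y := fun om J J' y h hJ => h.mono hJ
  have havg := 𝒮.hasAverage_lyapunov hK gs
  have hD := fun (η : ℝ) (hη : 0 < η) => HasAverage.exists_decrease (ys := 𝒮.equilibrium gs) hmono hK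
    (𝒮.exists_lipschitzOnWith_of_isTrajectory hK) havg (fun y _ => 𝒮.dissipation_nonneg y)
    𝒮.locallyLipschitz_dissipation (𝒮.hasAverage_filter hK) (fun k => by fun_prop)
    (fun k => 𝒮.locallyLipschitz_of_contDiff (g := fun z => -𝒮.a * z.2.2.2.2.1 k
      - 𝒮.κ * 𝒮.lam * 𝒮.αα' (z.2.2.1 - z.2.2.2.2.2) * z.2.1 k) (by
        have := 𝒮.contDiff_αα'
        fun_prop))
    (𝒮.hasAverage_position hK) (fun k => by
      have := 𝒮.ι_isometry.continuous
      fun_prop)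
    (fun k => 𝒮.locallyLipschitz_of_contDiff (g := fun z => (z.1 z.2.2.2.1) k) (
      (EuclideanSpace.proj (𝕜 := ℝ) (ι := Fin N) k).contDiff.comp
        (contDiff_fst.clm_apply (by fun_prop))))
    (fun y _ hq k => by rw [𝒮.filter_eq_zero_of_dissipation_eq_zero hq]; rfl)
    (fun y hy hq hF k => by rw [hzero y hy hq hF]; rfl)
    (fun y hy hq hF hd => by
      have hg := hzero y hy hq hF
      have hs := 𝒮.err_eq_zero_of_dissipation_eq_zero hq
      have hw := 𝒮.filter_eq_zero_of_dissipation_eq_zero hq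
      have hv : y.2.1 = 0 := 𝒮.D_injective y.1 (by
        rw [map_zero]
        ext k
        exact hd k)
      have hη : y.2.2.2 = 𝒮.ψ gs := by rw [err, hg] at hs; linarith
      exact Prod.ext hg (Prod.ext hv (Prod.ext hw hη))) hη
  obtain ⟨h1, h2⟩ := practicallyStable_of_lyapunov (P := 𝒮.IsMaximalTrajectory) (N := K)
    (V₀ := 𝒮.lam ^ 2 * 𝒮.αα' 0 * (y₀ - 𝒮.ψ gs)) hmono
    (fun om t₀ J y h => ⟨h.ordConnected, h.mem, fun t ht =>
      h.solution.hasDerivWithinAt 𝒮.isometry_Φ (𝒮.continuous_uncurry_field om) h.ordConnected ht,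
      h.solution.continuousOn 𝒮.isometry_Φ.isEmbedding.isInducing h.ordConnected⟩)
    (fun om _ t₀ J y h hyK => h.Ici_subset 𝒮.isometry_Φ (𝒮.continuous_uncurry_field om)
      (fun t₀ y₀ => 𝒮.exists_local om t₀ y₀) hK hyK)
    hW hK hWK (hSW hmem) hVc hVe
    (fun y hy hne => 𝒮.lyapunov_pos (fun h => (hOp _ (hKO' hy) h).1) hne) hV₀ hV₁ hWV
    (fun σ hσ => havg.exists_almost_nonincreasing (fun y _ => 𝒮.dissipation_nonneg y) hσ) hD
  refine ⟨sublevelComponent_mem_nhds hVc hmem (hVe.trans_lt hV₀), h1, K, hK, fun ε hε => ?_⟩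
  obtain ⟨om₀, hom₀, Δ, hΔ, h⟩ := h2 ε hε
  exact ⟨om₀, hom₀, Δ, hΔ, fun om hom t₀ J y hy hyS =>
    h om hom t₀ J y hy (hSW hyS) (𝒮.lyapunov_le_of_mem_region hyS)⟩

end ReducedSystem

end ExtremumSeeking
end

noncomputable section

namespace ExtremumSeeking

/-! ### Products with absolutely continuous functions -/

section Product

theorem intervalIntegrable_of_measurable_of_bounded {E : Type*} [NormedAddCommGroup E]
    [MeasurableSpace E] [BorelSpace E] [SecondCountableTopology E] {w : ℝ → E} (hw : Measurable w)
    {B : ℝ} (hB : ∀ t, ‖w t‖ ≤ B) (s t : ℝ) : IntervalIntegrable w volume s t :=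
  (intervalIntegrable_const (c := B)).mono_fun hw.aestronglyMeasurable
    (Eventually.of_forall fun t => (hB t).trans (le_abs_self B))

theorem lipschitzWith_of_integral_eq {E : Type*} [NormedAddCommGroup E] [NormedSpace ℝ E]
    [MeasurableSpace E] [BorelSpace E] [SecondCountableTopology E] {W w : ℝ → E}
    (hw : Measurable w) {B : ℝ} (hB : ∀ t, ‖w t‖ ≤ B)
    (hW : ∀ t, W t = W 0 + ∫ τ in (0 : ℝ)..t, w τ) : LipschitzWith (Real.toNNReal B) W := by
  refine LipschitzWith.of_dist_le_mul fun s t => ?_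
  have hi := intervalIntegrable_of_measurable_of_bounded hw hB
  rw [dist_eq_norm, hW s, hW t, add_sub_add_left_eq_sub,
    intervalIntegral.integral_interval_sub_left (hi _ _) (hi _ _), Real.dist_eq]
  refine (intervalIntegral.norm_integral_le_of_norm_le_const fun τ _ => hB τ).trans ?_
  exact mul_le_mul_of_nonneg_right (Real.le_coe_toNNReal B) (abs_nonneg _)

theorem integral_mul_of_integral_eq {J : Set ℝ} (hJ : J.OrdConnected) {f f' : ℝ → ℝ}
    (hf : ∀ τ ∈ J, HasDerivWithinAt f (f' τ) J τ) (hf' : ContinuousOn f' J) {W w : ℝ → ℝ}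
    (hw : Measurable w) {B : ℝ} (hB : ∀ t, ‖w t‖ ≤ B)
    (hW : ∀ t, W t = W 0 + ∫ τ in (0 : ℝ)..t, w τ) {s t : ℝ} (hs : s ∈ J) (ht : t ∈ J) :
    f t * W t - f s * W s = ∫ τ in s..t, (f' τ * W τ + f τ * w τ) := by
  have hsub : uIcc s t ⊆ J := hJ.uIcc_subset hs ht
  obtain ⟨M, hM⟩ := isCompact_uIcc.exists_bound_of_continuousOn (hf'.mono hsub)
  have hfl : LipschitzOnWith (Real.toNNReal M) f (uIcc s t) :=
    Convex.lipschitzOnWith_of_nnnorm_hasDerivWithin_le (convex_uIcc s t)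
      (fun τ hτ => (hf τ (hsub hτ)).mono hsub)
      fun τ hτ => by
        rw [← NNReal.coe_le_coe, coe_nnnorm]
        exact (hM τ hτ).trans (Real.le_coe_toNNReal M)
  have hWl := lipschitzWith_of_integral_eq hw hB hW
  rw [← hfl.absolutelyContinuousOnInterval.integral_deriv_mul_eq_sub
    hWl.lipschitzOnWith.absolutelyContinuousOnInterval]
  refine intervalIntegral.integral_congr_ae ?_
  have hloc : LocallyIntegrable w volume := (locallyIntegrable_const B).mono
    hw.aestronglyMeasurable (Eventually.of_forall fun τ => (hB τ).trans (le_abs_self B))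
  have hne : ∀ᵐ τ ∂(volume : Measure ℝ), τ ≠ s ∧ τ ≠ t := by
    have h1 : ∀ c : ℝ, ∀ᵐ τ ∂(volume : Measure ℝ), τ ≠ c := fun c => by
      simp [ae_iff]
    filter_upwards [h1 s, h1 t] with τ h h' using ⟨h, h'⟩
  filter_upwards [LocallyIntegrable.ae_hasDerivAt_integral hloc, hne] with τ hτ hτne hmem
  have hnhds : J ∈ 𝓝 τ := by
    have h2 : τ ∈ Ioo (min s t) (max s t) := by
      rcases le_total s t with h | h
      · rw [uIoc_of_le h] at hmem
        rw [min_eq_left h, max_eq_right h]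
        exact ⟨hmem.1, lt_of_le_of_ne hmem.2 hτne.2⟩
      · rw [uIoc_of_ge h] at hmem
        rw [min_eq_right h, max_eq_left h]
        exact ⟨hmem.1, lt_of_le_of_ne hmem.2 hτne.1⟩
    exact mem_of_superset (Ioo_mem_nhds h2.1 h2.2) (Ioo_subset_Icc_self.trans hsub)
  have hWd : HasDerivAt W (w τ) τ := by
    have := (hτ 0).const_add (W 0)
    rwa [← funext hW] at this
  rw [((hf τ (mem_of_mem_nhds hnhds)).hasDerivAt hnhds).deriv, hWd.deriv]

theorem integral_smul_of_integral_eq {n : ℕ} {J : Set ℝ} (hJ : J.OrdConnected) {f f' : ℝ → ℝ}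
    (hf : ∀ τ ∈ J, HasDerivWithinAt f (f' τ) J τ) (hf' : ContinuousOn f' J)
    {W w : ℝ → EuclideanSpace ℝ (Fin n)} (hw : Measurable w) {B : ℝ} (hB : ∀ t, ‖w t‖ ≤ B)
    (hW : ∀ t, W t = W 0 + ∫ τ in (0 : ℝ)..t, w τ) {s t : ℝ} (hs : s ∈ J) (ht : t ∈ J) :
    IntervalIntegrable (fun τ => f' τ • W τ + f τ • w τ) volume s t ∧
      f t • W t - f s • W s = ∫ τ in s..t, (f' τ • W τ + f τ • w τ) := by
  have hsub : uIcc s t ⊆ J := hJ.uIcc_subset hs ht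
  have hfc : ContinuousOn f J := fun τ hτ => (hf τ hτ).continuousWithinAt
  have hWc := (lipschitzWith_of_integral_eq hw hB hW).continuous
  have hi := intervalIntegrable_of_measurable_of_bounded hw hB
  have hint : IntervalIntegrable (fun τ => f' τ • W τ + f τ • w τ) volume s t :=
    ((hf'.mono hsub).smul hWc.continuousOn).intervalIntegrable.add
      ((hi s t).continuousOn_smul (hfc.mono hsub))
  refine ⟨hint, ?_⟩
  ext i
  have h1 := (EuclideanSpace.proj (𝕜 := ℝ) i).intervalIntegral_comp_comm hint
  have hpi : ∀ t, IntervalIntegrable w volume 0 t := fun t => hi 0 t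
  have hWi : ∀ t, W t i = W 0 i + ∫ τ in (0 : ℝ)..t, w τ i := fun t => by
    have h2 := (EuclideanSpace.proj (𝕜 := ℝ) i).intervalIntegral_comp_comm (hpi t)
    have h3 := congrArg (fun v : EuclideanSpace ℝ (Fin n) => v i) (hW t)
    simp only [EuclideanSpace.coe_proj] at h2
    rw [h2]
    exact h3
  have h4 := integral_mul_of_integral_eq hJ hf hf' (W := fun t => W t i) (w := fun t => w t i)
    ((EuclideanSpace.proj (𝕜 := ℝ) i).continuous.measurable.comp hw)
    (fun t => (PiLp.norm_apply_le (w t) i).trans (hB t)) hWi hs ht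
  exact h4.trans h1

end Product

/-! ### The perturbation signals -/

namespace ControlLaw

variable {n N : ℕ} {G : Type*} [TopologicalSpace G] [ChartedSpace (EuclideanSpace ℝ (Fin n)) G]
  [Group G] {S : MechanicalSystem n N G} (C : ControlLaw S)

theorem intervalIntegrable_u (s t : ℝ) : IntervalIntegrable C.u volume s t := by
  obtain ⟨B, hB⟩ := C.u_bounded
  exact intervalIntegrable_of_measurable_of_bounded C.u_measurable hB s t

theorem U_eq (t : ℝ) : C.U t = C.U 0 + ∫ s in (0 : ℝ)..t, C.u s := by
  simp only [U, zeroMeanAntideriv, intervalIntegral.integral_same, zero_sub]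
  abel

theorem U_comp_mul_eq (om t : ℝ) :
    C.U (om * t) = C.U (om * 0) + ∫ s in (0 : ℝ)..t, om • C.u (om * s) := by
  rw [intervalIntegral.integral_smul, intervalIntegral.smul_integral_comp_mul_left, mul_zero,
    ← C.U_eq]

theorem continuous_U : Continuous C.U := by
  obtain ⟨B, hB⟩ := C.u_bounded
  exact (lipschitzWith_of_integral_eq C.u_measurable hB C.U_eq).continuous

theorem U_periodic : Function.Periodic C.U C.T := fun t => by
  have h := intervalIntegral.integral_add_adjacent_intervals
    (C.intervalIntegrable_u 0 t) (C.intervalIntegrable_u t (t + C.T))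
  rw [C.u_periodic.intervalIntegral_add_eq t 0, zero_add, C.u_zeroMean, add_zero] at h
  rw [C.U_eq, C.U_eq t, h]

theorem integral_U : ∫ t in (0 : ℝ)..C.T, C.U t = 0 := by
  have hc : Continuous fun t => ∫ s in (0 : ℝ)..t, C.u s :=
    intervalIntegral.continuous_primitive (fun s t => C.intervalIntegrable_u s t) 0
  simp only [U, zeroMeanAntideriv]
  rw [intervalIntegral.integral_sub (hc.intervalIntegrable _ _) (by simp),
    intervalIntegral.integral_const, smul_smul, sub_zero, mul_one_div, div_self C.T_pos.ne',
    one_smul, sub_self]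

theorem integral_U_apply (i : Fin n) : ∫ t in (0 : ℝ)..C.T, C.U t i = 0 := by
  have h := (EuclideanSpace.proj (𝕜 := ℝ) i).intervalIntegral_comp_comm
    (C.continuous_U.intervalIntegrable (μ := volume) 0 C.T)
  rw [C.integral_U, map_zero] at h
  exact h

theorem integral_U_mul_U (i j : Fin n) :
    ∫ t in (0 : ℝ)..C.T, (C.U t i * C.U t j - if i = j then 1 else 0) = 0 := by
  have hUc : ∀ i, Continuous fun t => C.U t i := fun i =>
    (EuclideanSpace.proj (𝕜 := ℝ) i).continuous.comp C.continuous_U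
  have h := C.u_orthonormal i j
  rw [one_div, inv_mul_eq_iff_eq_mul₀ C.T_pos.ne'] at h
  have hij : Continuous fun t => C.U t i * C.U t j := (hUc i).mul (hUc j)
  rw [intervalIntegral.integral_sub (hij.intervalIntegrable _ _) (by simp),
    intervalIntegral.integral_const, smul_eq_mul, sub_zero, sub_eq_zero]
  exact h

end ControlLaw

end ExtremumSeeking
end

noncomputable section

namespace ExtremumSeeking

variable {n N : ℕ} {G : Type*} [TopologicalSpace G] [ChartedSpace (EuclideanSpace ℝ (Fin n)) G]
  [Group G]

namespace MechanicalSystem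

/-- The group `G` with the metric of the ambient Euclidean space. -/
def Body (_S : MechanicalSystem n N G) : Type _ := G

variable (S : MechanicalSystem n N G)

instance : MetricSpace S.Body :=
  MetricSpace.induced S.ι S.ι_embedding.isEmbedding.injective inferInstance

/-- The inclusion of the group into Euclidean space, as a map on `Body`. -/
def bodyι (g : S.Body) : EuclideanSpace ℝ (Fin N) := S.ι g

theorem isometry_bodyι : Isometry S.bodyι := fun _ _ => rfl

/-- The identity of `G`, as a homeomorphism. -/
def toBody : G ≃ₜ S.Body where
  toFun g := g
  invFun g := g
  left_inv _ := rfl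
  right_inv _ := rfl
  continuous_toFun := S.isometry_bodyι.isEmbedding.isInducing.continuous_iff.2
    S.ι_embedding.isEmbedding.continuous
  continuous_invFun := S.ι_embedding.isEmbedding.isInducing.continuous_iff.2
    S.isometry_bodyι.continuous

theorem locallyLipschitz_of_contMDiff {F : Type*} [NormedAddCommGroup F] [NormedSpace ℝ F]
    {f : G → F} (hf : ContMDiff (𝓡 n) 𝓘(ℝ, F) 1 f) : LocallyLipschitz (fun g : S.Body => f g) :=
  fun g₀ => by
  obtain ⟨K, W, hW, hK⟩ := S.exists_lipschitz (hf g₀)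
  refine ⟨K, S.toBody.symm ⁻¹' W, S.toBody.symm.continuous.continuousAt.preimage_mem_nhds hW,
    fun g hg g' hg' => hK g hg g' hg'⟩

theorem dι_injective [LieGroup (𝓡 n) ∞ G] (g : G) : Function.Injective (S.dι g) := by
  rw [injective_iff_map_eq_zero]
  intro X hX
  have hman : IsManifold (𝓡 n) ∞ G := inferInstance
  have : IsManifold (𝓡 n) 1 G := inferInstance
  have hf : ContMDiffAt (𝓡 n) 𝓘(ℝ, EuclideanSpace ℝ (Fin n)) 1 (extChartAt (𝓡 n) g) g :=
    contMDiffAt_extChartAt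
  have h1 : HasDerivWithinAt (S.ι ∘ fun _ : ℝ => g) (S.dι g X) univ 0 := by
    rw [hX]
    exact hasDerivWithinAt_const _ _ _
  have h2 := S.hasDerivWithinAt_comp (γ := fun _ => g) hf h1
  have h3 : mvfderiv (𝓡 n) (extChartAt (𝓡 n) g) g X = 0 :=
    (uniqueDiffWithinAt_univ (𝕜 := ℝ)).eq_deriv _ h2 (hasDerivWithinAt_const (0 : ℝ) univ _)
  have h4 := isInvertible_mfderiv_extChartAt (I := 𝓡 n) (mem_extChartAt_source (I := 𝓡 n) g)
  exact h4.injective (h3.trans (map_zero _).symm)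

end MechanicalSystem

namespace ControlLaw

variable {S : MechanicalSystem n N G} (C : ControlLaw S)

/-- The isomorphism of `ℝⁿ` with the Lie algebra given by the orthonormal basis. -/
def frame : EuclideanSpace ℝ (Fin n) ≃ₗ[ℝ] LieAlg n G :=
  (WithLp.linearEquiv 2 ℝ (Fin n → ℝ)).trans C.e.equivFun.symm

theorem frame_apply (w : EuclideanSpace ℝ (Fin n)) : C.frame w = C.E w := by
  simp [frame, E, Module.Basis.equivFun_symm_apply]

theorem inner_frame (v w : EuclideanSpace ℝ (Fin n)) :
    S.inner (C.frame v) (C.frame w) = inner ℝ v w := by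
  simp only [frame_apply, E, map_sum, LinearMap.sum_apply, map_smul, LinearMap.smul_apply,
    C.e_orthonormal, smul_eq_mul, mul_ite, mul_one, mul_zero, PiLp.inner_apply,
    RCLike.inner_apply, conj_trivial]
  simp [mul_comm]

/-- The dissipation in the coordinates given by the orthonormal basis. -/
def dissipationMatrix : EuclideanSpace ℝ (Fin n) →L[ℝ] EuclideanSpace ℝ (Fin n) :=
  (C.frame.symm.toLinearMap ∘ₗ S.R ∘ₗ C.frame.toLinearMap).toContinuousLinearMap

theorem frame_dissipationMatrix (v : EuclideanSpace ℝ (Fin n)) :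
    C.frame (C.dissipationMatrix v) = S.R (C.frame v) := by
  simp [dissipationMatrix]

/-- The trivialization of the tangent bundle given by the orthonormal basis. -/
def trivialization (g : G) : EuclideanSpace ℝ (Fin n) →L[ℝ] EuclideanSpace ℝ (Fin N) :=
  ∑ i, (EuclideanSpace.proj (𝕜 := ℝ) i).smulRight
    (S.dι g (MechanicalSystem.tangentLeft g (C.e i)))

theorem trivialization_apply (g : G) (v : EuclideanSpace ℝ (Fin n)) :
    C.trivialization g v = S.dι g (MechanicalSystem.tangentLeft g (C.frame v)) := by
  simp [trivialization, frame_apply, E]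

/-- The components of the gradient of `ψ` in the orthonormal basis. -/
def gradComponents (g : G) : EuclideanSpace ℝ (Fin n) :=
  ∑ i, (mvfderiv (𝓡 n) S.ψ g (MechanicalSystem.tangentLeft g (C.e i))) •
    EuclideanSpace.single i (1 : ℝ)

theorem inner_gradComponents (g : G) (v : EuclideanSpace ℝ (Fin n)) :
    inner ℝ (C.gradComponents g) v
      = mvfderiv (𝓡 n) S.ψ g (MechanicalSystem.tangentLeft g (C.frame v)) := by
  simp [gradComponents, frame_apply, E, sum_inner, inner_smul_left, mul_comm,
    EuclideanSpace.inner_single_left]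

theorem hasDerivWithinAt_ψ {γ : ℝ → G} {J : Set ℝ} {t : ℝ} {ξ : EuclideanSpace ℝ (Fin n)}
    (h : HasDerivWithinAt (S.ι ∘ γ) (C.trivialization (γ t) ξ) J t) :
    HasDerivWithinAt (S.ψ ∘ γ) (inner ℝ (C.gradComponents (γ t)) ξ) J t := by
  rw [C.trivialization_apply] at h
  rw [C.inner_gradComponents]
  exact S.hasDerivWithinAt_comp ((S.ψ_smooth.of_le (by exact_mod_cast le_top)).contMDiffAt) h

variable [LieGroup (𝓡 n) ∞ G]

theorem trivialization_injective (g : G) : Function.Injective (C.trivialization g) :=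
  fun v w h => by
  rw [C.trivialization_apply, C.trivialization_apply] at h
  have h1 := congrArg (MechanicalSystem.tangentLeftInv (n := n) g) (S.dι_injective g h)
  rw [MechanicalSystem.tangentLeftInv_tangentLeft,
    MechanicalSystem.tangentLeftInv_tangentLeft] at h1
  exact C.frame.injective h1

theorem contMDiff_trivialization :
    ContMDiff (𝓡 n) 𝓘(ℝ, EuclideanSpace ℝ (Fin n) →L[ℝ] EuclideanSpace ℝ (Fin N)) 1
      C.trivialization := fun g => by
  unfold trivialization
  refine ContMDiffAt.sum fun i _ => ?_
  have h := MechanicalSystem.contMDiffAt_mvfderiv_tangentLeft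
    (S.ι_embedding.contMDiff.contMDiffAt (x := g)) (C.e i)
  exact (ContinuousLinearMap.smulRightL ℝ (EuclideanSpace ℝ (Fin n)) (EuclideanSpace ℝ (Fin N))
    (EuclideanSpace.proj (𝕜 := ℝ) i)).contMDiff.contMDiffAt.comp g h

theorem contMDiff_gradComponents :
    ContMDiff (𝓡 n) 𝓘(ℝ, EuclideanSpace ℝ (Fin n)) 1 C.gradComponents := fun g => by
  unfold gradComponents
  refine ContMDiffAt.sum fun i _ => ?_
  have h := MechanicalSystem.contMDiffAt_mvfderiv_tangentLeft
    (S.ψ_smooth.contMDiffAt (x := g)) (C.e i)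
  exact h.smul contMDiffAt_const

/-- The closed-loop system in the coordinates given by the orthonormal basis. -/
def reducedSystem : ReducedSystem n N S.Body where
  ι := S.bodyι
  ι_isometry := S.isometry_bodyι
  ι_closed := S.ι_closed
  D g := C.trivialization g
  D_lip := S.locallyLipschitz_of_contMDiff C.contMDiff_trivialization
  D_injective g := C.trivialization_injective g
  ψ := S.ψ
  ψ_lip := S.locallyLipschitz_of_contMDiff (S.ψ_smooth.of_le (by exact_mod_cast le_top))
  p g := C.gradComponents g
  p_lip := S.locallyLipschitz_of_contMDiff C.contMDiff_gradComponents
  chain γ _ _ _ h := C.hasDerivWithinAt_ψ (γ := γ) h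
  chart g₀ := by
    obtain ⟨σ, u₀, b, hσ, hb, hισ, hA⟩ := S.exists_chart (fun i => C.e i) g₀
    refine ⟨fun u => σ u, u₀, fun u => ∑ i, (EuclideanSpace.proj (𝕜 := ℝ) i).smulRight (b i u),
      hσ, ?_, ?_, ?_⟩
    · refine ContDiffAt.exists_lipschitzOnWith (𝕂 := ℝ) ?_
      refine ContDiffAt.sum fun i _ => ?_
      exact (ContinuousLinearMap.smulRightL ℝ (EuclideanSpace ℝ (Fin n))
        (EuclideanSpace ℝ (Fin n)) (EuclideanSpace.proj (𝕜 := ℝ) i)).contDiff.contDiffAt.comp u₀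
        (hb i)
    · exact hισ.exists_lipschitzOnWith
    · filter_upwards [hA] with u hu
      obtain ⟨A, hAd, hAb⟩ := hu
      refine ⟨A, hAd, fun ξ => ?_⟩
      simp [trivialization, hAb]
  R := C.dissipationMatrix
  R_symm v w := by
    rw [← C.inner_frame, ← C.inner_frame, C.frame_dissipationMatrix, C.frame_dissipationMatrix,
      S.R_symm]
  R_nonneg v := by
    rw [← C.inner_frame, C.frame_dissipationMatrix]
    exact S.R_nonneg _
  T := C.T
  T_pos := C.T_pos
  U := C.U
  U_continuous := C.continuous_U
  U_periodic := C.U_periodic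
  U_zeroMean := C.integral_U_apply
  U_orthonormal := C.integral_U_mul_U
  α := C.α
  α_smooth := C.α_smooth
  α_mul_deriv_strictMono := C.α_mul_deriv_strictMono
  α_mul_deriv_pos := C.α_mul_deriv_pos
  a := C.a
  lam := C.lam
  b := C.b
  κ := C.κ
  h := C.h
  a_pos := C.a_pos
  lam_pos := C.lam_pos
  b_pos := C.b_pos
  κ_pos := C.κ_pos
  h_pos := C.h_pos
  gain_condition := C.gain_condition

end ControlLaw

end ExtremumSeeking
end

noncomputable section

namespace ExtremumSeeking

/-! ### Changes of variables -/

section Transfer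

variable {M M' 𝔼 𝔼' : Type*} [NormedAddCommGroup 𝔼] [NormedSpace ℝ 𝔼] [CompleteSpace 𝔼]
  [NormedAddCommGroup 𝔼'] [NormedSpace ℝ 𝔼'] [CompleteSpace 𝔼'] {J : Set ℝ}

theorem IsSolutionOn.map {Φ : M → 𝔼} {Φ' : M' → 𝔼'} {f : ℝ → M → 𝔼} {f' : ℝ → M' → 𝔼'}
    {x : ℝ → M} {x' : ℝ → M'} (A : 𝔼 →L[ℝ] 𝔼') (h : IsSolutionOn Φ f J x)
    (hΦ : ∀ t, Φ' (x' t) = A (Φ (x t))) (hf : ∀ t, f' t (x' t) = A (f t (x t))) :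
    IsSolutionOn Φ' f' J x' := by
  have heq : (fun τ => f' τ (x' τ)) = fun τ => A (f τ (x τ)) := funext hf
  refine ⟨fun s hs t ht => ?_, fun s hs t ht => ?_⟩
  · rw [heq]
    have hi := h.integrable s hs t ht
    exact ⟨A.integrable_comp hi.1, A.integrable_comp hi.2⟩
  · rw [heq, A.intervalIntegral_comp_comm (h.integrable s hs t ht), ← h.integral_eq s hs t ht,
      hΦ, hΦ, map_sub]

omit [CompleteSpace 𝔼] [CompleteSpace 𝔼'] in
theorem IsMaximalSolution.map {Φ : M → 𝔼} {Φ' : M' → 𝔼'} {f : ℝ → M → 𝔼} {f' : ℝ → M' → 𝔼'}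
    {θ : ℝ → M ≃ M'} (hθ : ∀ (J : Set ℝ) (x : ℝ → M), J.OrdConnected →
      (IsSolutionOn Φ f J x ↔ IsSolutionOn Φ' f' J fun t => θ t (x t)))
    {t₀ : ℝ} {x₀ : M} {x : ℝ → M} (h : IsMaximalSolution Φ f t₀ x₀ J x) :
    IsMaximalSolution Φ' f' t₀ (θ t₀ x₀) J fun t => θ t (x t) := by
  refine ⟨h.ordConnected, h.mem, by simp only [h.initial], (hθ _ _ h.ordConnected).1 h.solution,
    fun J' x' hJ' hJJ' hx' hsol => ?_⟩
  refine h.maximal J' (fun t => (θ t).symm (x' t)) hJ' hJJ' (fun t ht => ?_) ((hθ _ _ hJ').2 ?_)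
  · simp only [hx' ht, Equiv.symm_apply_apply]
  · simpa using hsol

end Transfer

theorem image_sublevelComponent {A B : Type*} [TopologicalSpace A] [TopologicalSpace B]
    (e : A ≃ₜ B) {f : A → ℝ} {f' : B → ℝ} (hf : ∀ x, f' (e x) = f x) {c : ℝ} {x : A}
    (hx : f x ≤ c) : e '' sublevelComponent f c x = sublevelComponent f' c (e x) := by
  rw [sublevelComponent, e.image_connectedComponentIn hx, sublevelComponent]
  congr 1
  ext z
  obtain ⟨y, rfl⟩ := e.surjective z
  simp [hf]

namespace ReducedSystem

variable {n N : ℕ} {X : Type*} [MetricSpace X] (𝒮 : ReducedSystem n N X)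
  (u : ℝ → EuclideanSpace ℝ (Fin n))

/-- The closed-loop vector field before the change of variables. -/
def fullField (om t : ℝ) (x : RState n X) : RAmbient n N :=
  (𝒮.D x.1 x.2.1,
    - 𝒮.R x.2.1 - 𝒮.b • (x.2.2.1 - (𝒮.κ * 𝒮.α (𝒮.err x)) • 𝒮.U (om * t))
      + (𝒮.lam * 𝒮.α (𝒮.err x) * om) • u (om * t),
    - 𝒮.a • (x.2.2.1 - (𝒮.κ * 𝒮.α (𝒮.err x)) • 𝒮.U (om * t))
      + (𝒮.κ * 𝒮.α (𝒮.err x) * om) • u (om * t),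
    𝒮.h * 𝒮.err x)

/-- The change of variables. -/
def shift (om t : ℝ) : RState n X ≃ RState n X where
  toFun x := (x.1, x.2.1 - (𝒮.lam * 𝒮.α (𝒮.err x)) • 𝒮.U (om * t),
    x.2.2.1 - (𝒮.κ * 𝒮.α (𝒮.err x)) • 𝒮.U (om * t), x.2.2.2)
  invFun x := (x.1, x.2.1 + (𝒮.lam * 𝒮.α (𝒮.err x)) • 𝒮.U (om * t),
    x.2.2.1 + (𝒮.κ * 𝒮.α (𝒮.err x)) • 𝒮.U (om * t), x.2.2.2)
  left_inv x := by simp [err]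
  right_inv x := by simp [err]

/-- The direction of the perturbation. -/
def perturb : EuclideanSpace ℝ (Fin n) →L[ℝ] RAmbient n N :=
  (0 : EuclideanSpace ℝ (Fin n) →L[ℝ] EuclideanSpace ℝ (Fin N)).prod
    ((𝒮.lam • ContinuousLinearMap.id ℝ _).prod ((𝒮.κ • ContinuousLinearMap.id ℝ _).prod 0))

theorem Φ_eq_Φ_shift_add (om t : ℝ) (x : RState n X) :
    𝒮.Φ x = 𝒮.Φ (𝒮.shift om t x) + 𝒮.perturb (𝒮.α (𝒮.err x) • 𝒮.U (om * t)) := by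
  simp [Φ, shift, perturb, smul_smul, mul_comm (𝒮.α _)]

/-- The derivative of the error along the closed-loop system. -/
def fullErrDeriv (x : RState n X) : ℝ := inner ℝ (𝒮.p x.1) x.2.1 - 𝒮.h * 𝒮.err x

theorem fullField_eq (om t : ℝ) (x : RState n X) :
    𝒮.fullField u om t x = 𝒮.field (𝒮.U (om * t)) (𝒮.shift om t x)
      + 𝒮.perturb ((deriv 𝒮.α (𝒮.err x) * 𝒮.fullErrDeriv x) • 𝒮.U (om * t)
        + 𝒮.α (𝒮.err x) • om • u (om * t)) := by
  have he : 𝒮.err (𝒮.shift om t x) = 𝒮.err x := rfl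
  have hv : 𝒮.vel (𝒮.U (om * t)) (𝒮.shift om t x) = x.2.1 := by
    rw [vel, he]
    simp [shift]
  have hd : 𝒮.errDeriv (𝒮.U (om * t)) (𝒮.shift om t x) = 𝒮.fullErrDeriv x := by
    rw [errDeriv, hv, he]
    rfl
  rw [fullField, field, hv, hd, he]
  simp only [shift, Equiv.coe_fn_mk, perturb, ContinuousLinearMap.prod_apply, Prod.mk_add_mk,
    _root_.zero_apply, _root_.smul_apply, ContinuousLinearMap.id_apply,
    add_zero, smul_add, smul_smul, ← mul_assoc]
  congr 2
  · abel
  · congr 1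
    abel

variable {u}

theorem perturb_integral_eq (hu : Measurable u) {B : ℝ} (hB : ∀ t, ‖u t‖ ≤ B) {om : ℝ}
    (hU : ∀ t, 𝒮.U (om * t) = 𝒮.U (om * 0) + ∫ s in (0 : ℝ)..t, om • u (om * s))
    {J : Set ℝ} (hJ : J.OrdConnected) {x : ℝ → RState n X} (hx : ContinuousOn x J)
    (hι : ∀ t ∈ J, HasDerivWithinAt (fun t => 𝒮.ι (x t).1) (𝒮.D (x t).1 (x t).2.1) J t)
    (hη : ∀ t ∈ J, HasDerivWithinAt (fun t => (x t).2.2.2) (𝒮.h * 𝒮.err (x t)) J t)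
    {s t : ℝ} (hs : s ∈ J) (ht : t ∈ J) :
    IntervalIntegrable (fun τ => 𝒮.perturb
        ((deriv 𝒮.α (𝒮.err (x τ)) * 𝒮.fullErrDeriv (x τ)) • 𝒮.U (om * τ)
          + 𝒮.α (𝒮.err (x τ)) • om • u (om * τ))) volume s t ∧
      𝒮.perturb (𝒮.α (𝒮.err (x t)) • 𝒮.U (om * t)) - 𝒮.perturb (𝒮.α (𝒮.err (x s)) • 𝒮.U (om * s))
        = ∫ τ in s..t, 𝒮.perturb
          ((deriv 𝒮.α (𝒮.err (x τ)) * 𝒮.fullErrDeriv (x τ)) • 𝒮.U (om * τ)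
            + 𝒮.α (𝒮.err (x τ)) • om • u (om * τ)) := by
  have hψc := 𝒮.ψ_lip.continuous
  have hpc := 𝒮.p_lip.continuous
  have herrc := 𝒮.continuous_err
  have hα' := 𝒮.contDiff_deriv_α.continuous
  have hfc : Continuous 𝒮.fullErrDeriv :=
    ((hpc.comp continuous_fst).inner continuous_snd.fst).sub (continuous_const.mul herrc)
  have hs' : ∀ τ ∈ J, HasDerivWithinAt (fun τ => 𝒮.err (x τ)) (𝒮.fullErrDeriv (x τ)) J τ :=
    fun τ hτ => (𝒮.chain (fun τ => (x τ).1) J τ _ (hι τ hτ)).sub (hη τ hτ)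
  have hf : ∀ τ ∈ J, HasDerivWithinAt (fun τ => 𝒮.α (𝒮.err (x τ)))
      (deriv 𝒮.α (𝒮.err (x τ)) * 𝒮.fullErrDeriv (x τ)) J τ := fun τ hτ =>
    ((𝒮.α_smooth.differentiable (by simp)) _).hasDerivAt.comp_hasDerivWithinAt τ (hs' τ hτ)
  have hf' : ContinuousOn (fun τ => deriv 𝒮.α (𝒮.err (x τ)) * 𝒮.fullErrDeriv (x τ)) J :=
    ((hα'.comp herrc).mul hfc).comp_continuousOn hx
  have hw : Measurable fun τ => om • u (om * τ) :=
    (hu.comp (measurable_const_mul om)).const_smul om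
  have hwB : ∀ τ, ‖om • u (om * τ)‖ ≤ |om| * B := fun τ => by
    rw [norm_smul, Real.norm_eq_abs]
    exact mul_le_mul_of_nonneg_left (hB _) (abs_nonneg _)
  obtain ⟨h1, h2⟩ := integral_smul_of_integral_eq hJ hf hf' (W := fun τ => 𝒮.U (om * τ)) hw hwB
    hU hs ht
  refine ⟨⟨𝒮.perturb.integrable_comp h1.1, 𝒮.perturb.integrable_comp h1.2⟩, ?_⟩
  rw [𝒮.perturb.intervalIntegral_comp_comm h1, ← h2, map_sub]

/-- The change of variables turns solutions of the closed-loop system into solutions of the reduced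
system. -/
theorem isSolutionOn_shift_iff (hu : Measurable u) {B : ℝ} (hB : ∀ t, ‖u t‖ ≤ B) {om : ℝ}
    (hU : ∀ t, 𝒮.U (om * t) = 𝒮.U (om * 0) + ∫ s in (0 : ℝ)..t, om • u (om * s))
    {J : Set ℝ} (hJ : J.OrdConnected) (x : ℝ → RState n X) :
    IsSolutionOn 𝒮.Φ (𝒮.fullField u om) J x ↔
      IsSolutionOn 𝒮.Φ (fun t y => 𝒮.field (𝒮.U (om * t)) y) J fun t => 𝒮.shift om t (x t) := by
  have hΦ := 𝒮.isometry_Φ.isEmbedding.isInducing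
  have hα := 𝒮.α_smooth.continuous
  have hUc := 𝒮.U_continuous
  have herrc := 𝒮.continuous_err
  constructor
  · intro h
    have hx := h.continuousOn hΦ hJ
    have hcomp : ∀ {F : Type} [NormedAddCommGroup F] [NormedSpace ℝ F] [CompleteSpace F]
        (A : RAmbient n N →L[ℝ] F) (g : ℝ → F), ContinuousOn g J →
        (∀ t, A (𝒮.fullField u om t (x t)) = g t) →
        ∀ t ∈ J, HasDerivWithinAt (fun t => A (𝒮.Φ (x t))) (g t) J t := by
      intro F _ _ _ A g hg hA t ht
      refine hasDerivWithinAt_of_integral_eq hJ hg (fun s hs t ht => ?_) ht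
      rw [← map_sub, h.integral_eq s hs t ht, ← A.intervalIntegral_comp_comm (h.integrable s hs t ht)]
      simp only [hA]
    have hι := hcomp (ContinuousLinearMap.fst ℝ _ _) (fun t => 𝒮.D (x t).1 (x t).2.1)
      (((𝒮.D_lip.continuous.comp continuous_fst).clm_apply continuous_snd.fst).comp_continuousOn hx)
      fun t => rfl
    have hη := hcomp (ContinuousLinearMap.snd ℝ _ _ ∘L ContinuousLinearMap.snd ℝ _ _ ∘L
      ContinuousLinearMap.snd ℝ _ _) (fun t => 𝒮.h * 𝒮.err (x t))
      ((continuous_const.mul herrc).comp_continuousOn hx) fun t => rfl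
    have hp := fun s (hs : s ∈ J) t (ht : t ∈ J) =>
      𝒮.perturb_integral_eq hu hB hU hJ hx hι hη hs ht
    have heq : (fun τ => 𝒮.field (𝒮.U (om * τ)) (𝒮.shift om τ (x τ)))
        = fun τ => 𝒮.fullField u om τ (x τ) - 𝒮.perturb
          ((deriv 𝒮.α (𝒮.err (x τ)) * 𝒮.fullErrDeriv (x τ)) • 𝒮.U (om * τ)
            + 𝒮.α (𝒮.err (x τ)) • om • u (om * τ)) := funext fun τ => by
      rw [𝒮.fullField_eq, add_sub_cancel_right]
    refine ⟨fun s hs t ht => ?_, fun s hs t ht => ?_⟩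
    · rw [heq]
      exact (h.integrable s hs t ht).sub (hp s hs t ht).1
    · rw [heq, intervalIntegral.integral_sub (h.integrable s hs t ht) (hp s hs t ht).1,
        ← h.integral_eq s hs t ht, ← (hp s hs t ht).2, 𝒮.Φ_eq_Φ_shift_add om t (x t),
        𝒮.Φ_eq_Φ_shift_add om s (x s)]
      abel
  · intro h
    have hy := h.continuousOn hΦ hJ
    have hx : ContinuousOn x J := by
      have h1 : ∀ t, x t = (𝒮.shift om t).symm (𝒮.shift om t (x t)) := fun t => by simp
      have h2 : Continuous fun z : ℝ × RState n X => (𝒮.shift om z.1).symm z.2 := by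
        simp only [shift, Equiv.coe_fn_symm_mk]
        fun_prop
      exact (h2.comp_continuousOn (continuousOn_id.prodMk hy)).congr fun t _ => h1 t
    have hd : ∀ t ∈ J, HasDerivWithinAt (fun t => 𝒮.Φ (𝒮.shift om t (x t)))
        (𝒮.field (𝒮.U (om * t)) (𝒮.shift om t (x t))) J t := fun t ht =>
      h.hasDerivWithinAt 𝒮.isometry_Φ (𝒮.continuous_uncurry_field om) hJ ht
    have hp := fun s (hs : s ∈ J) t (ht : t ∈ J) =>
      𝒮.perturb_integral_eq hu hB hU hJ hx (fun t ht => (hd t ht).prod_fst.congr_deriv (by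
        simp [field, vel, shift, err])) (fun t ht => (hd t ht).prod_snd.prod_snd.prod_snd) hs ht
    have heq : (fun τ => 𝒮.fullField u om τ (x τ))
        = fun τ => 𝒮.field (𝒮.U (om * τ)) (𝒮.shift om τ (x τ)) + 𝒮.perturb
          ((deriv 𝒮.α (𝒮.err (x τ)) * 𝒮.fullErrDeriv (x τ)) • 𝒮.U (om * τ)
            + 𝒮.α (𝒮.err (x τ)) • om • u (om * τ)) := funext fun τ => 𝒮.fullField_eq u om τ (x τ)
    refine ⟨fun s hs t ht => ?_, fun s hs t ht => ?_⟩
    · rw [heq]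
      exact (h.integrable s hs t ht).add (hp s hs t ht).1
    · rw [heq, intervalIntegral.integral_add (h.integrable s hs t ht) (hp s hs t ht).1,
        ← h.integral_eq s hs t ht, ← (hp s hs t ht).2, 𝒮.Φ_eq_Φ_shift_add om t (x t),
        𝒮.Φ_eq_Φ_shift_add om s (x s)]
      abel

end ReducedSystem

end ExtremumSeeking
end

noncomputable section

namespace ExtremumSeeking

variable {n N : ℕ} {G : Type*} [TopologicalSpace G] [ChartedSpace (EuclideanSpace ℝ (Fin n)) G]
  [Group G]

namespace ControlLaw

variable {S : MechanicalSystem n N G} (C : ControlLaw S)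

instance : T2Space (LieAlg n G) := inferInstanceAs (T2Space (EuclideanSpace ℝ (Fin n)))

/-- The coordinates of the state given by the orthonormal basis. -/
def coordinates : State n G ≃ₜ ReducedSystem.RState n S.Body :=
  S.toBody.prodCongr
    ((C.frame.toContinuousLinearEquiv.symm.toHomeomorph).prodCongr (Homeomorph.refl _))

theorem coordinates_apply (x : State n G) :
    C.coordinates x = (S.toBody x.1, C.frame.symm x.2.1, x.2.2) := rfl

/-- The inclusion of the Lie algebra into Euclidean space, in the coordinates given by the
orthonormal basis. -/
def lieAlgebraMap : EuclideanSpace ℝ (Fin n) →L[ℝ] EuclideanSpace ℝ (Fin N) :=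
  ((S.dι 1).toLinearMap ∘ₗ C.frame.toLinearMap).toContinuousLinearMap

/-- The linear map which relates the embeddings of the state in both coordinates. -/
def ambientMap : ReducedSystem.RAmbient n N →L[ℝ] Ambient n N :=
  (WithLp.prodContinuousLinearEquiv 2 ℝ _ _).symm.toContinuousLinearMap ∘L
    (ContinuousLinearMap.fst ℝ _ _).prod
      ((WithLp.prodContinuousLinearEquiv 2 ℝ _ _).symm.toContinuousLinearMap ∘L
        (C.lieAlgebraMap ∘L ContinuousLinearMap.fst ℝ _ _ ∘L ContinuousLinearMap.snd ℝ _ _).prod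
          ((WithLp.prodContinuousLinearEquiv 2 ℝ _ _).symm.toContinuousLinearMap ∘L
            ContinuousLinearMap.snd ℝ _ _ ∘L ContinuousLinearMap.snd ℝ _ _))

theorem ambientMap_apply (z : ReducedSystem.RAmbient n N) :
    C.ambientMap z = Ambient.mk z.1 (S.dι 1 (C.frame z.2.1)) z.2.2.1 z.2.2.2 := rfl

variable [LieGroup (𝓡 n) ∞ G]

theorem exists_leftInverse_ambientMap :
    ∃ A : Ambient n N →L[ℝ] ReducedSystem.RAmbient n N, ∀ z, A (C.ambientMap z) = z := by
  obtain ⟨L, hL⟩ := C.lieAlgebraMap.toLinearMap.exists_leftInverse_of_injective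
    (LinearMap.ker_eq_bot.2 ((S.dι_injective 1).comp C.frame.injective))
  let p := (WithLp.prodContinuousLinearEquiv 2 ℝ (EuclideanSpace ℝ (Fin n)) ℝ).toContinuousLinearMap
  let q := (WithLp.prodContinuousLinearEquiv 2 ℝ (EuclideanSpace ℝ (Fin N))
    (WithLp 2 (EuclideanSpace ℝ (Fin n) × ℝ))).toContinuousLinearMap
  let r := (WithLp.prodContinuousLinearEquiv 2 ℝ (EuclideanSpace ℝ (Fin N))
    (WithLp 2 (EuclideanSpace ℝ (Fin N) ×
      WithLp 2 (EuclideanSpace ℝ (Fin n) × ℝ)))).toContinuousLinearMap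
  refine ⟨((ContinuousLinearMap.fst ℝ _ _).prod
    (((L.toContinuousLinearMap ∘L ContinuousLinearMap.fst ℝ _ _).prod
      (p ∘L ContinuousLinearMap.snd ℝ _ _)) ∘L q ∘L ContinuousLinearMap.snd ℝ _ _)) ∘L r,
    fun z => ?_⟩
  exact Prod.ext rfl (Prod.ext (LinearMap.congr_fun hL z.2.1) rfl)

theorem stateEmbedding_eq (x : State n G) :
    S.stateEmbedding x = C.ambientMap (C.reducedSystem.Φ (C.coordinates x)) := by
  rw [ambientMap_apply, coordinates_apply]
  simp only [ReducedSystem.Φ, LinearEquiv.apply_symm_apply]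
  rfl

theorem closedLoop_eq (hnabla : ∀ v : LieAlg n G, S.nabla v v = 0) (om t : ℝ) (x : State n G) :
    C.closedLoop om t x
      = C.ambientMap (C.reducedSystem.fullField C.u om t (C.coordinates x)) := by
  have hμ : C.μ = 0 := Finset.sum_eq_zero fun i _ => hnabla _
  obtain ⟨g, v, w, η⟩ := x
  obtain ⟨v, rfl⟩ := C.frame.surjective v
  rw [ambientMap_apply, coordinates_apply]
  simp only [closedLoop, closedLoopField, hnabla, hμ, smul_zero, add_zero, neg_zero, zero_sub,
    LinearEquiv.symm_apply_apply, ReducedSystem.fullField]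
  have h1 : S.dι g (MechanicalSystem.tangentLeft g (C.frame v))
      = C.reducedSystem.D (S.toBody g) v := (C.trivialization_apply g v).symm
  have h2 : C.frame (- C.reducedSystem.R v - C.reducedSystem.b •
      (w - (C.reducedSystem.κ * C.reducedSystem.α (C.reducedSystem.err (S.toBody g, v, w, η))) •
        C.reducedSystem.U (om * t))
      + (C.reducedSystem.lam * C.reducedSystem.α (C.reducedSystem.err (S.toBody g, v, w, η)) * om)
        • C.u (om * t))
      = -S.R (C.frame v) - C.b • (C.E w - (C.κ * C.α (S.ψ g - η)) • C.E (C.U (om * t)))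
        + (C.lam * C.α (S.ψ g - η) * om) • C.E (C.u (om * t)) := by
    simp only [map_add, map_sub, map_neg, map_smul, C.frame_apply w, C.frame_apply (C.u _)]
    rw [← C.frame_dissipationMatrix, ← C.frame_apply (C.U (om * t))]
    rfl
  have h3 : -C.h * η + C.h * S.ψ g
      = C.reducedSystem.h * C.reducedSystem.err (S.toBody g, v, w, η) := by
    have : C.reducedSystem.err (S.toBody g, v, w, η) = S.ψ g - η := rfl
    rw [this, mul_sub, neg_mul, neg_add_eq_sub]
    rfl
  rw [h1, h2, h3]
  rfl

theorem coordinates_changeOfVariables (om t : ℝ) (x : State n G) :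
    C.coordinates (C.changeOfVariables om t x) = C.reducedSystem.shift om t (C.coordinates x) := by
  rw [coordinates_apply, coordinates_apply]
  simp only [changeOfVariables, Equiv.coe_fn_mk, map_sub, map_smul, ← C.frame_apply,
    LinearEquiv.symm_apply_apply]
  rfl

/-- The change of variables followed by the passage to coordinates. -/
def toReduced (om t : ℝ) : State n G ≃ ReducedSystem.RState n S.Body :=
  C.coordinates.toEquiv.trans (C.reducedSystem.shift om t)

theorem toReduced_apply (om t : ℝ) (x : State n G) :
    C.toReduced om t x = C.coordinates (C.changeOfVariables om t x) :=
  (C.coordinates_changeOfVariables om t x).symm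

theorem isSolutionOn_toReduced_iff (hnabla : ∀ v : LieAlg n G, S.nabla v v = 0) (om : ℝ)
    (J : Set ℝ) (x : ℝ → State n G) (hJ : J.OrdConnected) :
    IsSolutionOn S.stateEmbedding (C.closedLoop om) J x ↔
      IsSolutionOn C.reducedSystem.Φ
        (fun t y => C.reducedSystem.field (C.reducedSystem.U (om * t)) y) J
        fun t => C.toReduced om t (x t) := by
  obtain ⟨B, hB⟩ := C.u_bounded
  have h := C.reducedSystem.isSolutionOn_shift_iff C.u_measurable hB (C.U_comp_mul_eq om) hJ
    fun t => C.coordinates (x t)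
  refine Iff.trans ?_ h
  obtain ⟨A, hA⟩ := C.exists_leftInverse_ambientMap
  constructor
  · intro h
    refine h.map A (fun t => ?_) fun t => ?_
    · rw [C.stateEmbedding_eq, hA]
    · rw [C.closedLoop_eq hnabla, hA]
  · intro h
    exact h.map C.ambientMap (fun t => C.stateEmbedding_eq _) fun t => C.closedLoop_eq hnabla _ _ _

theorem hasUniqueMaximalSolutions (hnabla : ∀ v : LieAlg n G, S.nabla v v = 0) (om : ℝ) :
    HasUniqueMaximalSolutions S.stateEmbedding (C.closedLoop om) :=
  hasUniqueMaximalSolutions_of_unique fun J x x' t₀ hJ ht₀ h h' heq t ht => by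
    have h1 := C.reducedSystem.eqOn_of_isSolutionOn J _ _ t₀ hJ ht₀
      ((C.isSolutionOn_toReduced_iff hnabla om J x hJ).1 h)
      ((C.isSolutionOn_toReduced_iff hnabla om J x' hJ).1 h') (by simp only [heq]) ht
    exact (C.toReduced om t).injective h1

theorem isMaximalTrajectory (hnabla : ∀ v : LieAlg n G, S.nabla v v = 0) {om t₀ : ℝ}
    {x₀ : State n G} {J : Set ℝ} {x : ℝ → State n G}
    (h : IsMaximalSolution S.stateEmbedding (C.closedLoop om) t₀
      ((C.changeOfVariables om t₀).symm x₀) J x) :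
    C.reducedSystem.IsMaximalTrajectory om t₀ J
        (fun t => C.coordinates (C.changeOfVariables om t (x t))) ∧
      C.coordinates (C.changeOfVariables om t₀ (x t₀)) = C.coordinates x₀ := by
  have h1 := h.map (θ := C.toReduced om) fun J x hJ => C.isSolutionOn_toReduced_iff hnabla om J x hJ
  rw [← h.initial] at h1
  refine ⟨?_, by rw [h.initial, Equiv.apply_symm_apply]⟩
  simp only [← toReduced_apply]
  exact h1

theorem inner_frame_resolvent (z : EuclideanSpace ℝ (Fin n)) :
    S.inner (C.Ξ (C.frame z)) (C.frame z)
      = C.reducedSystem.coupling * inner ℝ (C.reducedSystem.resolvent z) z := by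
  have hl : C.lam ≠ 0 := C.lam_pos.ne'
  set A : Module.End ℝ (LieAlg n G) := (C.a * C.lam - C.b * C.κ) • 1 + C.lam • S.R with hA
  have h1 : A (C.frame ((1 / C.lam) • C.reducedSystem.resolvent z)) = C.frame z := by
    have h2 : (1 / C.lam) * (C.a * C.lam - C.b * C.κ) = C.reducedSystem.decay := by
      rw [one_div, inv_mul_eq_div]
      rfl
    have h3 : C.frame (C.reducedSystem.R (C.reducedSystem.resolvent z))
      = S.R (C.frame (C.reducedSystem.resolvent z)) := C.frame_dissipationMatrix _
    conv_rhs => rw [← C.reducedSystem.decay_smul_resolvent_add z, map_add, map_smul, h3, ← h2]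
    simp only [hA, LinearMap.add_apply, LinearMap.smul_apply, Module.End.one_apply, map_smul,
      smul_add, smul_smul]
    congr 2
    rw [one_div, inv_mul_cancel₀ hl, one_smul]
  have h4 : C.Ξ (C.frame z) = C.frame (C.reducedSystem.coupling • C.reducedSystem.resolvent z) := by
    rw [Ξ, ← h1, ← hA, LinearMap.smul_apply, ← Module.End.mul_apply,
      Ring.inverse_mul_cancel _ C.isUnit_Ξ, Module.End.one_apply, ← map_smul, smul_smul,
      mul_one_div]
    rfl
  rw [h4, C.inner_frame, inner_smul_left, conj_trivial]

theorem V_eq (gs : G) (x : State n G) :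
    C.V gs x = C.reducedSystem.lyapunov (S.toBody gs) (C.coordinates x) := by
  obtain ⟨g, v, w, η⟩ := x
  obtain ⟨v, rfl⟩ := C.frame.surjective v
  have h1 : S.seminorm 1 (C.frame v) ^ 2 = ‖v‖ ^ 2 := by
    rw [MechanicalSystem.seminorm, Module.End.one_apply, C.inner_frame,
      Real.sq_sqrt (real_inner_self_nonneg), real_inner_self_eq_norm_sq]
  have h2 : C.frame v - (C.lam / C.κ) • C.E w
      = C.frame (C.reducedSystem.gap (S.toBody g, v, w, η)) := by
    rw [← C.frame_apply, ← map_smul, ← map_sub]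
    rfl
  have h3 := (C.reducedSystem.lyapunov_terms_nonneg (S.toBody g, v, w, η)).1
  rw [← C.inner_frame_resolvent] at h3
  rw [coordinates_apply]
  simp only [V, LinearEquiv.symm_apply_apply]
  rw [h1, h2, MechanicalSystem.seminorm, Real.sq_sqrt h3, C.inner_frame_resolvent]
  rfl

theorem gradComponents_ne_zero {g : G} (h : S.grad g ≠ 0) : C.gradComponents g ≠ 0 := fun h0 => by
  refine h ?_
  have h1 := S.metric_grad g (S.grad g)
  obtain ⟨v, hv⟩ := C.frame.surjective (MechanicalSystem.tangentLeftInv g (S.grad g))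
  have h2 := C.inner_gradComponents g v
  rw [h0, inner_zero_left, hv, MechanicalSystem.tangentLeft_tangentLeftInv, ← h1] at h2
  have h3 : MechanicalSystem.tangentLeftInv g (S.grad g) = 0 := by
    by_contra hne
    exact (S.inner_pos _ hne).ne h2
  rw [← MechanicalSystem.tangentLeft_tangentLeftInv g (S.grad g), h3, map_zero]

end ControlLaw

end ExtremumSeeking
end

open ExtremumSeeking in
theorem theorem2 {n N : ℕ} {G : Type*} [TopologicalSpace G]
    [ChartedSpace (EuclideanSpace ℝ (Fin n)) G] [Group G] [LieGroup (𝓡 n) ∞ G]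
    (S : ExtremumSeeking.MechanicalSystem n N G) (C : ExtremumSeeking.ControlLaw S)
    (hnabla : ∀ v : ExtremumSeeking.LieAlg n G, S.nabla v v = 0)
    (gs : G) (y₀ : ℝ) (hy₀ : S.ψ gs < y₀)
    (hcompact : IsCompact (ExtremumSeeking.sublevelComponent S.ψ y₀ gs))
    (hgrad : ∀ g ∈ ExtremumSeeking.sublevelComponent S.ψ y₀ gs, g ≠ gs → S.grad g ≠ 0) :
    (∀ om > 0, ExtremumSeeking.HasUniqueMaximalSolutions S.stateEmbedding (C.closedLoop om)) ∧
    ExtremumSeeking.IsPracticallyUniformlyAsymptoticallyStable S.stateEmbedding C.closedLoop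
      C.changeOfVariables
      (ExtremumSeeking.sublevelComponent (C.V gs) (C.lam ^ 2 * C.αα' 0 * (y₀ - S.ψ gs))
        (gs, 0, 0, S.ψ gs))
      (gs, 0, 0, S.ψ gs) := by
  set xs : State n G := (gs, 0, 0, S.ψ gs) with hxs
  have hcoord : C.coordinates xs = C.reducedSystem.equilibrium (S.toBody gs) := by
    rw [C.coordinates_apply, hxs, map_zero]
    rfl
  have himg : S.toBody '' sublevelComponent S.ψ y₀ gs
      = sublevelComponent C.reducedSystem.ψ y₀ (S.toBody gs) :=
    image_sublevelComponent S.toBody (fun _ => rfl) hy₀.le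
  have hVxs : C.V gs xs = 0 := by
    rw [C.V_eq, hcoord, ReducedSystem.lyapunov_equilibrium]
  have hregion : C.coordinates '' sublevelComponent (C.V gs)
      (C.lam ^ 2 * C.αα' 0 * (y₀ - S.ψ gs)) xs = C.reducedSystem.region (S.toBody gs) y₀ := by
    rw [image_sublevelComponent C.coordinates (fun x => (C.V_eq gs x).symm), hcoord]
    · rfl
    · rw [hVxs]
      exact (mul_pos C.reducedSystem.level_pos (sub_pos.2 hy₀)).le
  have : LocallyConnectedSpace G :=
    ChartedSpace.locallyConnectedSpace (EuclideanSpace ℝ (Fin n)) G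
  have : LocallyConnectedSpace S.Body := S.toBody.symm.isOpenEmbedding.locallyConnectedSpace
  obtain ⟨hnhds, hstab, K, hK, hattr⟩ := C.reducedSystem.practicallyStable (gs := S.toBody gs) hy₀
    (himg ▸ hcompact.image S.toBody.continuous) (by
      rw [← himg]
      rintro _ ⟨g, hg, rfl⟩ hne
      exact C.gradComponents_ne_zero (hgrad g hg fun h => hne (by rw [h])))
  rw [← hcoord] at hnhds hstab hattr
  obtain ⟨A, hA⟩ := C.exists_leftInverse_ambientMap
  have hupper : ∀ x, ‖S.stateEmbedding x - S.stateEmbedding xs‖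
      ≤ ‖C.ambientMap‖ * dist (C.coordinates x) (C.coordinates xs) := fun x => by
    rw [C.stateEmbedding_eq, C.stateEmbedding_eq, ← map_sub,
      ← C.reducedSystem.isometry_Φ.dist_eq, dist_eq_norm]
    exact C.ambientMap.le_opNorm _
  have hlower : ∀ x, dist (C.coordinates x) (C.coordinates xs)
      ≤ ‖A‖ * ‖S.stateEmbedding x - S.stateEmbedding xs‖ := fun x => by
    rw [C.stateEmbedding_eq, C.stateEmbedding_eq, ← C.reducedSystem.isometry_Φ.dist_eq,
      dist_eq_norm]
    conv_lhs => rw [← hA (C.reducedSystem.Φ (C.coordinates x)),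
      ← hA (C.reducedSystem.Φ (C.coordinates xs)), ← map_sub]
    exact A.le_opNorm _
  have hsmall : ∀ ε > 0, ∀ x, dist (C.coordinates x) (C.coordinates xs)
      ≤ ε / (‖C.ambientMap‖ + 1) → ‖S.stateEmbedding x - S.stateEmbedding xs‖ ≤ ε :=
    fun ε hε x hx => by
    refine (hupper x).trans ((mul_le_mul_of_nonneg_left hx (norm_nonneg _)).trans ?_)
    rw [mul_div_assoc', div_le_iff₀ (by positivity)]
    nlinarith [norm_nonneg C.ambientMap]
  refine ⟨fun om _ => C.hasUniqueMaximalSolutions hnabla om, ?_, fun ε hε => ?_,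
    fun r hr ε hε => ?_⟩
  · rw [← hregion] at hnhds
    have := C.coordinates.continuous.continuousAt.preimage_mem_nhds hnhds
    rwa [C.coordinates.injective.preimage_image] at this
  · obtain ⟨om₀, hom₀, δ, hδ, h⟩ := hstab (ε / (‖C.ambientMap‖ + 1)) (by positivity)
    refine ⟨om₀, hom₀, δ / (‖A‖ + 1), by positivity, fun om hom t₀ x₀ hx₀ J x hx t ht => ?_⟩
    obtain ⟨hmax, hinit⟩ := C.isMaximalTrajectory hnabla hx
    have h1 := h om hom t₀ J _ hmax (by
      rw [hinit]
      refine (hlower x₀).trans ((mul_le_mul_of_nonneg_left hx₀ (norm_nonneg _)).trans ?_)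
      rw [mul_div_assoc', div_le_iff₀ (by positivity)]
      nlinarith [norm_nonneg A]) t ht
    exact ⟨h1.1, hsmall ε hε _ h1.2⟩
  · obtain ⟨om₀, hom₀, Δ, hΔ, h⟩ := hattr (ε / (‖C.ambientMap‖ + 1)) (by positivity)
    obtain ⟨B, hB⟩ := hK.isBounded.subset_closedBall (C.coordinates xs)
    refine ⟨om₀, hom₀, Δ, hΔ, ‖C.ambientMap‖ * |B| + 1, by positivity,
      fun om hom t₀ x₀ hx₀ _ J x hx => ?_⟩
    obtain ⟨hmax, hinit⟩ := C.isMaximalTrajectory hnabla hx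
    obtain ⟨h1, h2⟩ := h om hom t₀ J _ hmax (by
      rw [hinit, ← hregion]
      exact mem_image_of_mem _ hx₀)
    refine ⟨fun t ht => ⟨(h1 t ht).1, ?_⟩, fun t ht => hsmall ε hε _ (h2 t ht)⟩
    have h3 := Metric.mem_closedBall.1 (hB (h1 t ht).2)
    refine (hupper _).trans ?_
    have h4 := mul_le_mul_of_nonneg_left (h3.trans (le_abs_self B)) (norm_nonneg C.ambientMap)
    linarith
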